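/- Let $\mathcal M^2$ be the set of distribution functions on $\mathbb R$ with finite second moment, with left quantile $G^{-1}(p)=\inf\{x:G(x)\ge p\}$, and let $d_W(F,G)=\big(\int_0^1|F^{-1}(t)-G^{-1}(t)|^2\,dt\big)^{1/2}$. Let $F\in\mathcal M^2$ have mean $\mu_F$ and standard deviation $\sigma_F>0$, let $\mu\in\mathbb R$, $\sigma>0$, $\epsilon>0$, and let $$\mathcal M_\epsilon(\mu,\sigma)=\Big\{G\in\mathcal M^2:\int x\,dG=\mu,\ \int x^2\,dG=\mu^2+\sigma^2,\ d_W(G,F)\le\sqrt\epsilon\Big\}.$$ Let $\mathcal H$ be the set of functions $g:[0,1]\to\mathbb R$ of bounded variation with $g(0)=g(0+)=0$ and $g(1)=g(1-)$. For $g\in\mathcal H$ put $\hat g(x)=\max\{g(x-),g(x),g(x+)\}$ for $x\in(0,1)$, $\hat g(x)=g(x)$ for $x\in\{0,1\}$, and $$\rho_g(G)=\int_0^\infty g(1-G(x))\,dx+\int_{-\infty}^0\big(g(1-G(x))-g(1)\big)\,dx\in[-\infty,\infty)$$ (under the assumptions below the positive parts of the integrands are integrable). Let $g^*=\inf\{h\in\mathcal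 H: h \text{ concave on }[0,1],\ h\ge g\}$ be the concave envelope, and let $(g^*)'$ denote its right derivative on $(0,1)$. For $\lambda\ge0$ let $g_\lambda(t)=g(t)+\lambda\int_{1-t}^1F^{-1}(s)\,ds$. With $V$ uniform on $(0,1)$, let $c_0=\mathrm{Corr}(F^{-1}(V),(g^*)'(1-V))$ ($c_0=0$ if $(g^*)'$ is constant), $a_\lambda=\mathbb E[(g_\lambda^*)'(V)]$, $b_\lambda=\sqrt{\mathrm{Var}((g_\lambda^*)'(V))}$, and let $H_\lambda$ be the distribution with quantile function $$h_\lambda(t)=\mu+\sigma\,\frac{(g_\lambda^*)'(1-t)-a_\lambda}{b_\lambda},\qquad t\in(0,1).$$ Let $g\in\mathcal H$ be such that $\int_0^1((g^*)'(t))^2\,dt<\infty$ and, for every $\lambda>0$, $(g_\lambda^*)'$ is not constant. Put $\epsilon_{\min}=(\mu_F-\mu)^2+(\sigma_F-\sigma)^2$ and $\epsilon_0=\epsilon_{\min}+2\sigma_F\sigma(1-c_0)$. (i) If $\epsilon_{\min}<\epsilon<\epsilon_0$ and $\lambda\mapsto\rho_{\hat g}(H_\lambda)$ is continuous on $(0,\infty)$,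 then $$\sup_{G\in\mathcal M_\epsilon(\mu,\sigma)}\rho_g(G)=\sup_{G\in\mathcal M_\epsilon(\mu,\sigma)}\rho_{\hat g}(G)=\rho_{\hat g}(H_{\lambda_\epsilon}),$$ where the first equality always holds, and the second holds for every $\lambda_\epsilon>0$ with $d_W(F,H_{\lambda_\epsilon})=\sqrt\epsilon$; such a $\lambda_\epsilon$ exists whenever $(g^*)'$ is not constant. (ii) Let $\epsilon\ge\epsilon_0$. If $(g^*)'$ is not constant, then $\sup_{G\in\mathcal M_\epsilon(\mu,\sigma)}\rho_{\hat g}(G)=\rho_{\hat g}(H_0)$, and if moreover $\epsilon>\epsilon_{\min}$ (which is automatic unless $c_0=1$), then also $\sup_{G\in\mathcal M_\epsilon(\mu,\sigma)}\rho_g(G)=\sup_{G\in\mathcal M_\epsilon(\mu,\sigma)}\rho_{\hat g}(G)$. If $(g^*)'$ is constant, then $\sup_{G\in\mathcal M_\epsilon(\mu,\sigma)}\rho_g(G)=g(1)\mu$. -/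

import Mathlib

open MeasureTheory ProbabilityTheory Set Filter Topology

namespace DistortionRisk

noncomputable section

/-- The left quantile `G⁻¹(p) = inf {x : G(x) ≥ p}` of a probability measure `G` on `ℝ`
(only used for `0 < p < 1`). Distributions are represented by probability measures on `ℝ`. -/
def quantile (G : Measure ℝ) (p : ℝ) : ℝ := sInf {x : ℝ | p ≤ cdf G x}

/-- The mean of a distribution. -/
def mean (G : Measure ℝ) : ℝ := ∫ x, x ∂G

/-- The standard deviation of a distribution. -/
def stdDev (G : Measure ℝ) : ℝ := √(Var[fun x => x; G])

/-- The one-dimensional Wasserstein distance of order 2. -/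
def wasserstein (F G : Measure ℝ) : ℝ :=
  √(∫ t in Ioo (0 : ℝ) 1, (quantile F t - quantile G t) ^ 2)

/-- All distributions with mean `m`, variance `s ^ 2` and Wasserstein distance at most `√ε`
from `F`. -/
def uncertaintySet (F : Measure ℝ) (m s ε : ℝ) : Set (Measure ℝ) :=
  {G | IsProbabilityMeasure G ∧ MemLp (fun x : ℝ => x) 2 G ∧ ∫ x, x ∂G = m ∧
    ∫ x, x ^ 2 ∂G = m ^ 2 + s ^ 2 ∧ wasserstein G F ≤ √ε}

/-- The class of distortion functions: functions on `[0,1]` of bounded variation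
with `g(0) = g(0+) = 0` and `g(1) = g(1-)`. Values outside `[0,1]` are irrelevant. -/
structure IsDistortion (g : ℝ → ℝ) : Prop where
  boundedVariation : BoundedVariationOn g (Icc 0 1)
  zero : g 0 = 0
  right_zero : Tendsto g (𝓝[>] 0) (𝓝 0)
  left_one : Tendsto g (𝓝[<] 1) (𝓝 (g 1))

/-- The upper semicontinuous version of `g`. -/
def uscVersion (g : ℝ → ℝ) (x : ℝ) : ℝ :=
  open Classical in
  if x ∈ Ioo (0 : ℝ) 1 then
    max (max (Function.leftLim g x) (g x)) (Function.rightLim g x)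
  else g x

/-- The extended-real integral of `f` over `s`, positive part minus negative part. It is the
usual integral, possibly `-∞`, whenever the positive part has finite integral. -/
def extIntegral (s : Set ℝ) (f : ℝ → ℝ) : EReal :=
  ((∫⁻ x in s, ENNReal.ofReal (f x) : ENNReal) : EReal) -
    ((∫⁻ x in s, ENNReal.ofReal (-f x) : ENNReal) : EReal)

/-- The distortion risk metric `ρ_g(G)`, which may take the value `-∞`. -/
def rho (g : ℝ → ℝ) (G : Measure ℝ) : EReal :=
  extIntegral (Ioi 0) (fun x => g (1 - cdf G x)) +
    extIntegral (Iio 0) (fun x => g (1 - cdf G x) - g 1)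

/-- The worst-case value of `ρ_g` over the uncertainty set. -/
def worstCase (g : ℝ → ℝ) (F : Measure ℝ) (m s ε : ℝ) : EReal :=
  ⨆ G ∈ uncertaintySet F m s ε, rho g G

/-- The concave envelope of `g` on `[0,1]`. -/
def concaveEnvelope (g : ℝ → ℝ) (t : ℝ) : ℝ :=
  sInf {y : ℝ | ∃ h : ℝ → ℝ, IsDistortion h ∧ ConcaveOn ℝ (Icc 0 1) h ∧
    (∀ s ∈ Icc (0 : ℝ) 1, g s ≤ h s) ∧ y = h t}

/-- The right derivative of the concave envelope (used on `(0,1)`). -/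
def envDeriv (g : ℝ → ℝ) (t : ℝ) : ℝ := derivWithin (concaveEnvelope g) (Ioi t) t

/-- The right derivative of the concave envelope is a constant on `(0,1)`. -/
def EnvDerivConst (g : ℝ → ℝ) : Prop := ∃ c : ℝ, ∀ t ∈ Ioo (0 : ℝ) 1, envDeriv g t = c

/-- The law of a standard uniform random variable. -/
def unif : Measure ℝ := volume.restrict (Ioo 0 1)

/-- `g_l(t) = g(t) + l * ∫_{1-t}^1 F⁻¹(s) ds`. -/
def tilt (g : ℝ → ℝ) (F : Measure ℝ) (l t : ℝ) : ℝ :=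
  g t + l * ∫ s in (1 - t)..1, quantile F s

/-- `Corr(F⁻¹(V), (g^*)'(1-V))` for `V` standard uniform. It is `0` if `(g^*)'` is constant,
by division by zero. -/
def corrZero (g : ℝ → ℝ) (F : Measure ℝ) : ℝ :=
  cov[quantile F, fun v => envDeriv g (1 - v); unif] /
    (√(Var[quantile F; unif]) * √(Var[fun v => envDeriv g (1 - v); unif]))

/-- `h_l(t) = m + s * ((g_l^*)'(1-t) - a_l) / b_l`, with `a_l` and `b_l` the mean and the standard
deviation of `(g_l^*)'(V)`. -/
def hQuantile (g : ℝ → ℝ) (F : Measure ℝ) (m s l t : ℝ) : ℝ :=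
  m + s * ((envDeriv (tilt g F l) (1 - t) - ∫ v, envDeriv (tilt g F l) v ∂unif) /
    √(Var[envDeriv (tilt g F l); unif]))

/-- The distribution `H_l` with quantile function `h_l`, as the law of `h_l(V)`. -/
def hLaw (g : ℝ → ℝ) (F : Measure ℝ) (m s l : ℝ) : Measure ℝ :=
  unif.map (hQuantile g F m s l)

end

end DistortionRisk

open DistortionRisk

namespace DistortionRisk

/-! ### Quantile functions and laws on the real line -/

/-! A law `G` is encoded by its quantile function `q` on `(0,1)`, a monotone element of `L²`. Mean
and variance become `∫ q` and `∫ q²`. Once these are fixed, the Wasserstein constraint is a lower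
bound on `∫ F⁻¹ q`. If `Φ` has density `φ`, the layer-cake formula
(`integrable_rhoIntegrand_and_integral_eq`) turns `ρ_Φ(G)` into the linear functional `∫ φ(1-t) q(t)
dt`.

Upper bound. Let `K(t) = ∫_{1-t}^1 F⁻¹`. Since `K` is continuous, `ĝ ≤ g_l^* - l K` for every `l ≥
0`, with equality at `1`, so `ρ_ĝ(G) ≤ ∫ (g_l^*)'(1-t) q - l ∫ F⁻¹ q` (`rho_uscVersion_map_le`). By
Cauchy–Schwarz the first term is largest at `q = h_l`. The second is controlled by the ball
constraint when `H_l` lies on the boundary of the ball, and it vanishes when `l = 0`.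

Attainment. Where `g_l^*` lies strictly above the upper semicontinuous version of `g_l`, it is
affine. There `h_l` is locally constant, so the survival function of `H_l` skips that level. Hence
the bound is an equality at `H_l` (`rho_uscVersion_map_eq`), and `worstCase_uscVersion_eq` follows.

Multiplier. The distance from `F` to `H_l` depends on `l` only through the covariance of `F⁻¹` with
the normalized derivative. With `l = θ/(1-θ)`, the tilted functions are rescaled points of the
segment from `g` to `K`. Along it the normalized covariance runs continuously from `σ_F c₀` to
`σ_F`, and the intermediate value theorem gives the multiplier (`exists_covariance_eq`).

From `ĝ` to `g`. If `ρ_ĝ(G)` is finite, the quantile function of `G` is approximated in `L²` by step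
functions with almost the same value of `ρ_ĝ`. Moving their jumps slightly replaces `ĝ` by `g`. To
re-enter the uncertainty set, a vanishing multiple of a step function almost perfectly correlated
with `F⁻¹` is added, which is possible because `ε > ε_min`; the result is then rescaled to the exact
mean and variance (`le_worstCase_of_step_approximation`).

Constant derivative. Then `g^*` is linear and `g(1) μ` is an upper bound. Nonconstancy of `(g_l^*)'`
for small `l` yields a level `u` at which `g` is almost on its chord, and the two-point law jumping
there is almost optimal (`worstCase_of_envDerivConst`). -/

instance : IsProbabilityMeasure unif := ⟨by simp [unif]⟩

theorem unif_real_Ioc {a b : ℝ} (ha : 0 ≤ a) (hab : a ≤ b) (hb : b < 1) :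
    unif.real (Ioc a b) = b - a := by
  have : Ioc a b ∩ Ioo (0 : ℝ) 1 = Ioc a b :=
    inter_eq_left.2 fun x hx => ⟨ha.trans_lt hx.1, hx.2.trans_lt hb⟩
  rw [unif, measureReal_restrict_apply measurableSet_Ioc, this]
  simp [hab]

theorem ae_unif_of_forall {p : ℝ → Prop} (h : ∀ t ∈ Ioo (0 : ℝ) 1, p t) : ∀ᵐ t ∂unif, p t :=
  (ae_restrict_mem measurableSet_Ioo).mono h

theorem aemeasurable_of_monotoneOn {q : ℝ → ℝ} (hq : MonotoneOn q (Ioo 0 1)) :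
    AEMeasurable q unif :=
  aemeasurable_restrict_of_monotoneOn measurableSet_Ioo hq

theorem measurePreserving_one_sub : MeasurePreserving (fun t : ℝ => 1 - t) unif unif := by
  have h := (Measure.measurePreserving_sub_left (volume : Measure ℝ) 1).restrict_preimage
    (measurableSet_Ioo (a := (0 : ℝ)) (b := 1))
  have : (fun t : ℝ => 1 - t) ⁻¹' Ioo 0 1 = Ioo 0 1 := by
    ext t
    simp only [mem_preimage, mem_Ioo]
    constructor <;> rintro ⟨h1, h2⟩ <;> constructor <;> linarith
  rwa [this] at h

theorem integral_one_sub (f : ℝ → ℝ) : ∫ t, f (1 - t) ∂unif = ∫ t, f t ∂unif :=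
  measurePreserving_one_sub.integral_comp
    (Homeomorph.subLeft (1 : ℝ)).measurableEmbedding f

/-- Right-continuity of the distribution function makes the infimum attained; this gives the Galois
connection between quantile and distribution function. -/
theorem quantile_le_iff (G : Measure ℝ) {p : ℝ} (hp : p ∈ Ioo (0 : ℝ) 1) (x : ℝ) :
    quantile G p ≤ x ↔ p ≤ cdf G x := by
  have hbdd : BddBelow {x : ℝ | p ≤ cdf G x} := by
    obtain ⟨y, hy⟩ := ((tendsto_cdf_atBot G).eventually (gt_mem_nhds hp.1)).exists
    refine ⟨y, fun z hz => ?_⟩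
    by_contra h
    exact absurd (hz.trans (monotone_cdf G (not_le.1 h).le)) (not_le.2 hy)
  have hne : {x : ℝ | p ≤ cdf G x}.Nonempty := by
    obtain ⟨y, hy⟩ := ((tendsto_cdf_atTop G).eventually (lt_mem_nhds hp.2)).exists
    exact ⟨y, hy.le⟩
  constructor
  · intro h
    have hr : Tendsto (cdf G) (𝓝[>] x) (𝓝 (cdf G x)) :=
      ((cdf G).right_continuous x).tendsto.mono_left (nhdsWithin_mono _ Ioi_subset_Ici_self)
    refine ge_of_tendsto hr ?_
    filter_upwards [self_mem_nhdsWithin] with y hy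
    obtain ⟨z, hz, hzy⟩ := exists_lt_of_csInf_lt hne (h.trans_lt hy)
    exact le_trans hz (monotone_cdf G hzy.le)
  · intro h
    exact csInf_le hbdd h

theorem lt_quantile_iff (G : Measure ℝ) {p : ℝ} (hp : p ∈ Ioo (0 : ℝ) 1) (x : ℝ) :
    x < quantile G p ↔ cdf G x < p := by
  rw [← not_le, quantile_le_iff G hp, not_le]

theorem quantile_monotoneOn (G : Measure ℝ) : MonotoneOn (quantile G) (Ioo 0 1) := by
  intro a ha b hb hab
  rw [quantile_le_iff G ha]
  exact hab.trans ((quantile_le_iff G hb _).1 le_rfl)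

theorem cdf_map_eq {q : ℝ → ℝ} (hq : MonotoneOn q (Ioo 0 1)) (x : ℝ) :
    cdf (unif.map q) x = unif.real {t | q t ≤ x} := by
  have hm := aemeasurable_of_monotoneOn hq
  have := Measure.isProbabilityMeasure_map (μ := unif) hm
  rw [cdf_eq_real, map_measureReal_apply_of_aemeasurable hm measurableSet_Iic]
  rfl

/-- A monotone `q` need not be left-continuous, so it may differ from the quantile of its law at
jumps. With strict inequalities, this inversion and the next hold at every point. -/
theorem lt_of_cdf_map_lt {q : ℝ → ℝ} (hq : MonotoneOn q (Ioo 0 1)) {x t : ℝ}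
    (ht : t ∈ Ioo (0 : ℝ) 1) (h : cdf (unif.map q) x < t) : x < q t := by
  by_contra hx
  rw [cdf_map_eq hq] at h
  have h1 : unif.real (Ioc 0 t) ≤ unif.real {t | q t ≤ x} :=
    measureReal_mono fun y hy =>
      (hq ⟨hy.1, hy.2.trans_lt ht.2⟩ ht hy.2).trans (not_lt.1 hx)
  rw [unif_real_Ioc le_rfl ht.1.le ht.2] at h1
  linarith

theorem le_of_lt_cdf_map {q : ℝ → ℝ} (hq : MonotoneOn q (Ioo 0 1)) {x t : ℝ}
    (ht : t ∈ Ioo (0 : ℝ) 1) (h : t < cdf (unif.map q) x) : q t ≤ x := by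
  by_contra hx
  rw [cdf_map_eq hq] at h
  have h1 : unif.real {t | q t ≤ x} ≤ unif.real (Ioc 0 t) := by
    refine ENNReal.toReal_mono (measure_ne_top _ _) (measure_mono_ae ?_)
    refine ae_unif_of_forall fun y hy (hyx : q y ≤ x) => ⟨hy.1, ?_⟩
    by_contra hty
    exact hx ((hq ht hy (not_le.1 hty).le).trans hyx)
  rw [unif_real_Ioc le_rfl ht.1.le ht.2] at h1
  linarith

/-- The survival function of the law of a monotone `q` avoids a level `v` whenever `q` is
constant near `1 - v`. -/
theorem one_sub_cdf_map_ne_of_eventually_const {q : ℝ → ℝ} (hq : MonotoneOn q (Ioo 0 1))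
    {v c : ℝ} (hv : v ∈ Ioo (0 : ℝ) 1) (hc : ∀ᶠ t in 𝓝 (1 - v), q t = c) (x : ℝ) :
    1 - cdf (unif.map q) x ≠ v := by
  intro h
  have hcdf : cdf (unif.map q) x = 1 - v := by linarith
  have hmem : ∀ᶠ t in 𝓝 (1 - v), t ∈ Ioo (0 : ℝ) 1 :=
    Ioo_mem_nhds (by linarith [hv.2]) (by linarith [hv.1])
  obtain ⟨a, ⟨hac, ha⟩, hav⟩ := ((hc.and hmem).filter_mono nhdsWithin_le_nhds |>.and
    (self_mem_nhdsWithin (s := Iio (1 - v)))).exists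
  obtain ⟨b, ⟨hbc, hb⟩, hbv⟩ := ((hc.and hmem).filter_mono nhdsWithin_le_nhds |>.and
    (self_mem_nhdsWithin (s := Ioi (1 - v)))).exists
  have h1 := le_of_lt_cdf_map hq ha (x := x) (by rw [hcdf]; exact hav)
  have h2 := lt_of_cdf_map_lt hq hb (x := x) (by rw [hcdf]; exact hbv)
  linarith

theorem ae_continuousAt_of_monotoneOn {q : ℝ → ℝ} (hq : MonotoneOn q (Ioo 0 1)) :
    ∀ᵐ t ∂unif, ContinuousAt q t := by
  have h0 : ∀ᵐ t ∂(volume : Measure ℝ),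
      t ∉ {x ∈ Ioo (0 : ℝ) 1 | ¬ ContinuousWithinAt q (Ioo 0 1) x} :=
    (hq.countable_not_continuousWithinAt).ae_notMem volume
  filter_upwards [ae_restrict_of_ae h0, ae_restrict_mem measurableSet_Ioo] with t h1 h2
  by_contra h
  exact h1 ⟨h2, fun h' => h (h'.continuousAt (isOpen_Ioo.mem_nhds h2))⟩

/-- The two functions agree wherever `q` is continuous, and a monotone function has only countably
many discontinuities. -/
theorem quantile_map_ae_eq {q : ℝ → ℝ} (hq : MonotoneOn q (Ioo 0 1)) :
    quantile (unif.map q) =ᵐ[unif] q := by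
  filter_upwards [ae_continuousAt_of_monotoneOn hq, ae_restrict_mem measurableSet_Ioo]
    with t hc ht
  refine le_antisymm ((quantile_le_iff _ ht _).2 ?_) ?_
  · by_contra h
    exact lt_irrefl _ (lt_of_cdf_map_lt hq ht (not_le.1 h))
  · by_contra h
    have hev : ∀ᶠ y in 𝓝[<] t, quantile (unif.map q) t < q y ∧ y ∈ Ioo (0 : ℝ) 1 :=
      (((hc.tendsto.eventually (lt_mem_nhds (not_le.1 h)))).and
        (isOpen_Ioo.mem_nhds ht)).filter_mono nhdsWithin_le_nhds
    obtain ⟨y, ⟨hy, hy1⟩, hyt⟩ := (hev.and self_mem_nhdsWithin).exists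
    have h2 : t ≤ cdf (unif.map q) (quantile (unif.map q) t) :=
      (quantile_le_iff _ ht _).1 le_rfl
    exact absurd (le_of_lt_cdf_map hq hy1 (lt_of_lt_of_le hyt h2)) (not_le.2 hy)

theorem map_quantile (G : Measure ℝ) [IsProbabilityMeasure G] : unif.map (quantile G) = G := by
  have hq := quantile_monotoneOn G
  have := Measure.isProbabilityMeasure_map (μ := unif) (aemeasurable_of_monotoneOn hq)
  refine Measure.eq_of_cdf _ _ ?_
  ext x
  rw [cdf_map_eq hq]
  have hset : {t | quantile G t ≤ x} =ᵐ[unif] Iic (cdf G x) := by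
    refine ae_unif_of_forall fun t ht => ?_
    exact propext (quantile_le_iff G ht x)
  rw [measureReal_congr hset, unif, measureReal_restrict_apply measurableSet_Iic]
  rcases (cdf_le_one G x).lt_or_eq with h | h
  · have : Iic (cdf G x) ∩ Ioo (0 : ℝ) 1 = Ioc 0 (cdf G x) := by
      ext y
      simp only [mem_inter_iff, mem_Iic, mem_Ioo, mem_Ioc]
      constructor
      · tauto
      · rintro ⟨h1, h2⟩; exact ⟨h2, h1, h2.trans_lt h⟩
    rw [this]
    simp [cdf_nonneg]
  · have : Iic (cdf G x) ∩ Ioo (0 : ℝ) 1 = Ioo 0 1 := by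
      rw [h]; exact inter_eq_right.2 fun y hy => hy.2.le
    rw [this, h]
    simp

theorem one_sub_cdf_mem (G : Measure ℝ) (x : ℝ) : 1 - cdf G x ∈ Icc (0 : ℝ) 1 :=
  ⟨by linarith [cdf_le_one G x], by linarith [cdf_nonneg G x]⟩

/-! ### The distortion risk metric as an integral over the real line -/

/-- The integrand of `rho g G` on the whole line. -/
noncomputable def rhoIntegrand (g : ℝ → ℝ) (G : Measure ℝ) (x : ℝ) : ℝ :=
  g (1 - cdf G x) - if x < 0 then g 1 else 0

theorem compl_Iio_ae_eq_Ioi (a : ℝ) : ((Iio a)ᶜ : Set ℝ) =ᵐ[volume] (Ioi a : Set ℝ) := by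
  rw [compl_Iio]
  exact Ioi_ae_eq_Ici.symm

theorem extIntegral_of_integrable {s : Set ℝ} {f : ℝ → ℝ} (hf : IntegrableOn f s) :
    extIntegral s f = ((∫ x in s, f x : ℝ) : EReal) := by
  have h1 : ∫⁻ x in s, ENNReal.ofReal (f x) ≠ ⊤ := hf.lintegral_lt_top.ne
  have h2 : ∫⁻ x in s, ENNReal.ofReal (-f x) ≠ ⊤ := hf.neg.lintegral_lt_top.ne
  rw [extIntegral, integral_eq_lintegral_pos_part_sub_lintegral_neg_part hf, EReal.coe_sub,
    EReal.coe_ennreal_toReal h1, EReal.coe_ennreal_toReal h2]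

theorem extIntegral_mono {s : Set ℝ} {f h : ℝ → ℝ} (hfh : ∀ x, f x ≤ h x) :
    extIntegral s f ≤ extIntegral s h := by
  refine EReal.sub_le_sub ?_ ?_
  · exact EReal.coe_ennreal_le_coe_ennreal_iff.2
      (lintegral_mono fun x => ENNReal.ofReal_le_ofReal (hfh x))
  · exact EReal.coe_ennreal_le_coe_ennreal_iff.2
      (lintegral_mono fun x => ENNReal.ofReal_le_ofReal (neg_le_neg (hfh x)))

theorem extIntegral_congr {s : Set ℝ} (hs : MeasurableSet s) {f h : ℝ → ℝ}
    (hfh : ∀ x ∈ s, f x = h x) : extIntegral s f = extIntegral s h := by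
  unfold extIntegral
  congr 2
  · exact setLIntegral_congr_fun hs fun x hx => by simp only [hfh x hx]
  · exact setLIntegral_congr_fun hs fun x hx => by simp only [hfh x hx]

theorem extIntegral_eq_bot {s : Set ℝ} {f : ℝ → ℝ}
    (hf : ∫⁻ x in s, ENNReal.ofReal (-f x) = ⊤) : extIntegral s f = ⊥ := by
  rw [extIntegral, hf]
  simp [sub_eq_add_neg]

theorem rho_eq_extIntegral (g : ℝ → ℝ) (G : Measure ℝ) :
    rho g G = extIntegral (Ioi 0) (rhoIntegrand g G) + extIntegral (Iio 0) (rhoIntegrand g G) := by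
  unfold rho
  congr 1
  · refine extIntegral_congr measurableSet_Ioi fun x hx => ?_
    simp [rhoIntegrand, not_lt.2 (le_of_lt (mem_Ioi.1 hx))]
  · refine extIntegral_congr measurableSet_Iio fun x hx => ?_
    simp [rhoIntegrand, mem_Iio.1 hx]

theorem rho_mono {g h : ℝ → ℝ} (hgh : ∀ u ∈ Icc (0 : ℝ) 1, g u ≤ h u) (h1 : g 1 = h 1)
    (G : Measure ℝ) : rho g G ≤ rho h G := by
  have hle : ∀ x, rhoIntegrand g G x ≤ rhoIntegrand h G x := fun x => by
    unfold rhoIntegrand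
    rw [h1]
    exact sub_le_sub_right (hgh _ (one_sub_cdf_mem G x)) _
  rw [rho_eq_extIntegral, rho_eq_extIntegral]
  exact add_le_add (extIntegral_mono hle) (extIntegral_mono hle)

theorem rho_eq_integral {g : ℝ → ℝ} {G : Measure ℝ} (hr : Integrable (rhoIntegrand g G)) :
    rho g G = ((∫ x, rhoIntegrand g G x : ℝ) : EReal) := by
  rw [rho_eq_extIntegral, extIntegral_of_integrable hr.integrableOn,
    extIntegral_of_integrable hr.integrableOn, ← EReal.coe_add]
  congr 1
  rw [add_comm, ← integral_add_compl (measurableSet_Iio (a := (0 : ℝ))) hr,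
    setIntegral_congr_set (compl_Iio_ae_eq_Ioi 0)]

/-- The integrable majorant bounds the positive part, so integrability can fail only through an
infinite negative part, which forces the value `⊥`. -/
theorem rho_eq_bot_or_integrable {g : ℝ → ℝ} {G : Measure ℝ} {b : ℝ → ℝ}
    (hm : AEStronglyMeasurable (rhoIntegrand g G) volume) (hb : Integrable b)
    (hle : ∀ x, rhoIntegrand g G x ≤ b x) :
    rho g G = ⊥ ∨ Integrable (rhoIntegrand g G) := by
  by_cases h1 : ∫⁻ x in Ioi 0, ENNReal.ofReal (-rhoIntegrand g G x) = ⊤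
  · left; rw [rho_eq_extIntegral, extIntegral_eq_bot h1, EReal.bot_add]
  by_cases h2 : ∫⁻ x in Iio 0, ENNReal.ofReal (-rhoIntegrand g G x) = ⊤
  · left; rw [rho_eq_extIntegral, extIntegral_eq_bot h2, EReal.add_bot]
  right
  have h3 : ∫⁻ x, ENNReal.ofReal (-rhoIntegrand g G x) ≠ ⊤ := by
    rw [← lintegral_add_compl _ (measurableSet_Iio (a := (0 : ℝ))), setLIntegral_congr (compl_Iio_ae_eq_Ioi 0)]
    exact ENNReal.add_ne_top.2 ⟨h2, h1⟩
  refine ⟨hm, ?_⟩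
  rw [hasFiniteIntegral_iff_norm]
  have h4 : ∀ x, ENNReal.ofReal ‖rhoIntegrand g G x‖ ≤
      ENNReal.ofReal ‖b x‖ + ENNReal.ofReal (-rhoIntegrand g G x) := fun x => by
    rcases le_total 0 (rhoIntegrand g G x) with h | h
    · refine le_add_right (ENNReal.ofReal_le_ofReal ?_)
      rw [Real.norm_of_nonneg h]
      exact (hle x).trans (le_abs_self _)
    · rw [Real.norm_of_nonpos h]
      exact le_add_left le_rfl
  refine (lintegral_mono h4).trans_lt ?_
  rw [lintegral_add_left' hb.1.norm.aemeasurable.ennreal_ofReal]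
  exact ENNReal.add_lt_top.2 ⟨(hasFiniteIntegral_iff_norm _).1 hb.2, lt_top_iff_ne_top.2 h3⟩

/-! ### The layer-cake representation -/

theorem integral_indicator_Ioi_one_sub {φ : ℝ → ℝ} {c : ℝ} (hc : c ∈ Icc (0 : ℝ) 1) :
    ∫ t, φ (1 - t) * (Ioi c).indicator 1 t ∂unif = ∫ x in (0 : ℝ)..(1 - c), φ x := by
  have h1 : ∀ t, φ (1 - t) * (Ioi c).indicator 1 t
      = (Ioi c).indicator (fun t => φ (1 - t)) t := fun t => by
    by_cases h : t ∈ Ioi c <;> simp [h]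
  simp_rw [h1]
  rw [unif, integral_indicator measurableSet_Ioi, Measure.restrict_restrict measurableSet_Ioi]
  have h2 : Ioi c ∩ Ioo 0 1 = Ioo c 1 := by
    ext t; simp only [mem_inter_iff, mem_Ioi, mem_Ioo]
    constructor
    · tauto
    · rintro ⟨h, h'⟩; exact ⟨h, hc.1.trans_lt h, h'⟩
  rw [h2, ← integral_Ioc_eq_integral_Ioo, ← intervalIntegral.integral_of_le hc.2,
    intervalIntegral.integral_comp_sub_left (fun t => φ t)]
  simp

/-- The kernel of the layer-cake formula: `∫ layer z x dx = z`. -/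
noncomputable def layer (z x : ℝ) : ℝ :=
  (Ico 0 z).indicator 1 x - (Ico z 0).indicator 1 x

theorem integrable_layer (z : ℝ) : Integrable (layer z) := by
  refine Integrable.sub ?_ ?_
  · exact (integrable_indicator_iff measurableSet_Ico).2 (integrableOn_const (by simp))
  · exact (integrable_indicator_iff measurableSet_Ico).2 (integrableOn_const (by simp))

theorem integral_layer (z : ℝ) : ∫ x, layer z x = z := by
  unfold layer
  rw [integral_sub ((integrable_indicator_iff measurableSet_Ico).2 (integrableOn_const (by simp)))
    ((integrable_indicator_iff measurableSet_Ico).2 (integrableOn_const (by simp))),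
    integral_indicator_one measurableSet_Ico, integral_indicator_one measurableSet_Ico]
  rcases le_total 0 z with h | h <;> simp [h]


theorem integral_norm_layer (z : ℝ) : ∫ x, ‖layer z x‖ = |z| := by
  rcases le_total 0 z with h | h
  · have : ∀ x, ‖layer z x‖ = layer z x := fun x => by
      simp only [layer, Ico_eq_empty (not_lt.2 h), indicator_empty, sub_zero]
      by_cases hx : x ∈ Ico 0 z <;> simp [hx]
    simp_rw [this]
    rw [integral_layer, abs_of_nonneg h]
  · have : ∀ x, ‖layer z x‖ = - layer z x := fun x => by
      simp only [layer, Ico_eq_empty (not_lt.2 h), indicator_empty, zero_sub]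
      by_cases hx : x ∈ Ico z 0 <;> simp [hx]
    simp_rw [this]
    rw [integral_neg, integral_layer, abs_of_nonpos h]

theorem aestronglyMeasurable_layer {q : ℝ → ℝ} (hq : AEMeasurable q unif) :
    AEStronglyMeasurable (fun p : ℝ × ℝ => layer (q p.2) p.1) (volume.prod unif) := by
  have hq2 : AEMeasurable (fun p : ℝ × ℝ => q p.2) (volume.prod unif) := hq.comp_snd
  have h1 : NullMeasurableSet {p : ℝ × ℝ | p.1 < q p.2} (volume.prod unif) :=
    nullMeasurableSet_lt measurable_fst.aemeasurable hq2
  have h2 : NullMeasurableSet {p : ℝ × ℝ | q p.2 ≤ p.1} (volume.prod unif) :=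
    nullMeasurableSet_le hq2 measurable_fst.aemeasurable
  have h3 : MeasurableSet {p : ℝ × ℝ | 0 ≤ p.1} := measurableSet_le measurable_const measurable_fst
  have h4 : MeasurableSet {p : ℝ × ℝ | p.1 < 0} := measurableSet_lt measurable_fst measurable_const
  exact ((aestronglyMeasurable_const (b := (1 : ℝ))).indicator₀ (h3.nullMeasurableSet.inter h1)).sub
    ((aestronglyMeasurable_const (b := (1 : ℝ))).indicator₀ (h2.inter h4.nullMeasurableSet))

/-- With `c` the distribution function at `x`, one has `layer (q t) x = 1_{t > c} - 1_{x < 0}` for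
every `t ≠ c`. Integrating against `φ(1 - t)` produces `Φ(1 - c) - 1_{x < 0} Φ(1)`. -/
theorem rhoIntegrand_map_eq {q φ Φ : ℝ → ℝ} (hq : MonotoneOn q (Ioo 0 1))
    (hφ : Integrable φ unif) (hΦ : ∀ u ∈ Icc (0 : ℝ) 1, Φ u = ∫ x in (0 : ℝ)..u, φ x) (x : ℝ) :
    rhoIntegrand Φ (unif.map q) x = ∫ t, φ (1 - t) * layer (q t) x ∂unif := by
  set c := cdf (unif.map q) x with hc
  have hc1 : c ∈ Icc (0 : ℝ) 1 := ⟨cdf_nonneg _ _, cdf_le_one _ _⟩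
  have hψ : Integrable (fun t => φ (1 - t)) unif :=
    measurePreserving_one_sub.integrable_comp_of_integrable hφ
  have hae : ∀ᵐ t ∂unif, t ≠ c :=
    ae_restrict_of_ae (Measure.ae_ne volume c)
  have h1 : Φ (1 - c) = ∫ t, φ (1 - t) * (Ioi c).indicator 1 t ∂unif := by
    rw [integral_indicator_Ioi_one_sub hc1, hΦ _ (by constructor <;> linarith [hc1.1, hc1.2])]
  have h2 : Φ 1 = ∫ t, φ (1 - t) ∂unif := by
    rw [hΦ 1 (by simp), integral_one_sub, unif, ← integral_Ioc_eq_integral_Ioo,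
      ← intervalIntegral.integral_of_le zero_le_one]
  have hind : Integrable (fun t => φ (1 - t) * (Ioi c).indicator 1 t) unif := by
    have : (fun t => φ (1 - t) * (Ioi c).indicator 1 t)
      = (Ioi c).indicator (fun t => φ (1 - t)) := by
      ext t; by_cases h : t ∈ Ioi c <;> simp [h]
    rw [this]
    exact hψ.indicator measurableSet_Ioi
  unfold rhoIntegrand
  rw [← hc, h1]
  split_ifs with hx
  · rw [h2, ← integral_sub hind hψ]
    refine integral_congr_ae ?_
    filter_upwards [hae, ae_restrict_mem measurableSet_Ioo] with t htc ht
    rcases lt_or_gt_of_ne htc with h | h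
    · have := le_of_lt_cdf_map hq ht (hc ▸ h)
      simp [layer, not_lt.2 h.le, this, hx, not_le.2 hx]
    · have := lt_of_cdf_map_lt hq ht (hc ▸ h)
      simp [layer, h, not_le.2 this, not_le.2 hx]
  · rw [sub_zero]
    refine integral_congr_ae ?_
    filter_upwards [hae, ae_restrict_mem measurableSet_Ioo] with t htc ht
    rcases lt_or_gt_of_ne htc with h | h
    · have := le_of_lt_cdf_map hq ht (hc ▸ h)
      simp [layer, not_lt.2 h.le, hx, not_lt.2 this]
    · have := lt_of_cdf_map_lt hq ht (hc ▸ h)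
      simp [layer, h, this, not_lt.1 hx, hx]

/-- Fubini for the kernel `layer`: its `x`-integral is `q t` and its `x`-norm is `|q t|`, so
integrability of `φ(1 - t) q(t)` suffices. -/
theorem integrable_rhoIntegrand_and_integral_eq {q φ Φ : ℝ → ℝ} (hq : MonotoneOn q (Ioo 0 1))
    (hφ : Integrable φ unif) (hφq : Integrable (fun t => φ (1 - t) * q t) unif)
    (hΦ : ∀ u ∈ Icc (0 : ℝ) 1, Φ u = ∫ x in (0 : ℝ)..u, φ x) :
    Integrable (rhoIntegrand Φ (unif.map q)) ∧
      ∫ x, rhoIntegrand Φ (unif.map q) x = ∫ t, φ (1 - t) * q t ∂unif := by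
  have hψ : Integrable (fun t => φ (1 - t)) unif :=
    measurePreserving_one_sub.integrable_comp_of_integrable hφ
  have hK : Integrable (fun p : ℝ × ℝ => φ (1 - p.2) * layer (q p.2) p.1)
      (volume.prod unif) := by
    refine (integrable_prod_iff' ?_).2 ⟨ae_of_all _ fun t => ?_, ?_⟩
    · exact hψ.1.comp_snd.mul (aestronglyMeasurable_layer (aemeasurable_of_monotoneOn hq))
    · exact (integrable_layer (q t)).const_mul (φ (1 - t))
    · simp only [norm_mul]
      simp_rw [integral_const_mul, integral_norm_layer]
      simpa [abs_mul] using hφq.norm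
  have hr : rhoIntegrand Φ (unif.map q) = fun x => ∫ t, φ (1 - t) * layer (q t) x ∂unif :=
    funext (rhoIntegrand_map_eq hq hφ hΦ)
  rw [hr]
  refine ⟨hK.integral_prod_left, ?_⟩
  rw [integral_integral_swap hK]
  simp_rw [integral_const_mul, integral_layer]

/-- If `Φ₁ ≤ Φ₂` with equality at `1`, the risk metric of `Φ₁` is at most that of `Φ₂`. -/
theorem integral_mul_le_of_primitive_le {q φ₁ φ₂ Φ₁ Φ₂ : ℝ → ℝ} (hq : MonotoneOn q (Ioo 0 1))
    (hφ₁ : Integrable φ₁ unif) (hφq₁ : Integrable (fun t => φ₁ (1 - t) * q t) unif)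
    (hΦ₁ : ∀ u ∈ Icc (0 : ℝ) 1, Φ₁ u = ∫ x in (0 : ℝ)..u, φ₁ x)
    (hφ₂ : Integrable φ₂ unif) (hφq₂ : Integrable (fun t => φ₂ (1 - t) * q t) unif)
    (hΦ₂ : ∀ u ∈ Icc (0 : ℝ) 1, Φ₂ u = ∫ x in (0 : ℝ)..u, φ₂ x)
    (hle : ∀ u ∈ Icc (0 : ℝ) 1, Φ₁ u ≤ Φ₂ u) (h1 : Φ₁ 1 = Φ₂ 1) :
    ∫ t, φ₁ (1 - t) * q t ∂unif ≤ ∫ t, φ₂ (1 - t) * q t ∂unif := by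
  obtain ⟨i1, e1⟩ := integrable_rhoIntegrand_and_integral_eq hq hφ₁ hφq₁ hΦ₁
  obtain ⟨i2, e2⟩ := integrable_rhoIntegrand_and_integral_eq hq hφ₂ hφq₂ hΦ₂
  rw [← e1, ← e2]
  refine integral_mono i1 i2 fun x => ?_
  unfold rhoIntegrand
  rw [h1]
  exact sub_le_sub_right (hle _ (one_sub_cdf_mem _ x)) _

/-! ### Bounded variation -/

theorem boundedVariationOn_add {f h : ℝ → ℝ} {s : Set ℝ} (hf : BoundedVariationOn f s)
    (hh : BoundedVariationOn h s) : BoundedVariationOn (fun x => f x + h x) s := by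
  refine ne_top_of_le_ne_top (ENNReal.add_ne_top.2 ⟨hf, hh⟩) ?_
  refine iSup_le fun p => ?_
  calc _ ≤ ∑ i ∈ Finset.range p.1, (edist (f (p.2.1 (i + 1))) (f (p.2.1 i)) +
        edist (h (p.2.1 (i + 1))) (h (p.2.1 i))) :=
        Finset.sum_le_sum fun i _ => edist_add_add_le _ _ _ _
    _ ≤ _ := by
        rw [Finset.sum_add_distrib]
        exact add_le_add (eVariationOn.sum_le p.2.2.1 p.2.2.2)
          (eVariationOn.sum_le p.2.2.1 p.2.2.2)

theorem boundedVariationOn_const_mul {f : ℝ → ℝ} {s : Set ℝ} (hf : BoundedVariationOn f s)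
    (c : ℝ) : BoundedVariationOn (fun x => c * f x) s :=
  (lipschitzWith_smul (α := ℝ) (β := ℝ) c).comp_boundedVariationOn hf

/-- A concave function increases up to a maximizer and decreases after it. -/
theorem boundedVariationOn_of_concaveOn {f : ℝ → ℝ} (hf : ConcaveOn ℝ (Icc 0 1) f)
    (hc : ContinuousOn f (Icc 0 1)) : BoundedVariationOn f (Icc 0 1) := by
  obtain ⟨m, hm, hmax⟩ := isCompact_Icc.exists_isMaxOn ⟨0, by simp⟩ hc
  obtain ⟨C, hC⟩ := isCompact_Icc.exists_bound_of_continuousOn hc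
  simp only [Real.norm_eq_abs] at hC
  have h1 : BoundedVariationOn f (Icc 0 m) := by
    refine MonotoneOn.boundedVariationOn (C := C) (fun x hx y hy hxy => ?_)
      fun x hx => hC x ⟨hx.1, hx.2.trans hm.2⟩
    have := hf.min_le_of_mem_Icc ⟨hx.1, hx.2.trans hm.2⟩ hm ⟨hxy, hy.2⟩
    rwa [min_eq_left (hmax ⟨hx.1, hx.2.trans hm.2⟩)] at this
  have h2 : BoundedVariationOn (fun x => -1 * f x) (Icc m 1) := by
    refine MonotoneOn.boundedVariationOn (C := C) (fun x hx y hy hxy => ?_)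
      fun x hx => by simpa using hC x ⟨hm.1.trans hx.1, hx.2⟩
    have := hf.min_le_of_mem_Icc hm ⟨hm.1.trans hy.1, hy.2⟩ ⟨hx.1, hxy⟩
    rw [min_eq_right (hmax ⟨hm.1.trans hy.1, hy.2⟩)] at this
    simpa using this
  have h3 : BoundedVariationOn f (Icc m 1) := by
    simpa using boundedVariationOn_const_mul h2 (-1)
  have := eVariationOn.union f (isGreatest_Icc hm.1) (isLeast_Icc hm.2)
  rw [Icc_union_Icc_eq_Icc hm.1 hm.2] at this
  unfold BoundedVariationOn
  rw [this]
  exact ENNReal.add_ne_top.2 ⟨h1, h3⟩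

theorem IsDistortion.exists_bound {f : ℝ → ℝ} (hf : IsDistortion f) :
    ∃ M, 0 ≤ M ∧ ∀ u ∈ Icc (0 : ℝ) 1, |f u| ≤ M :=
  ⟨(eVariationOn f (Icc 0 1)).toReal, ENNReal.toReal_nonneg, fun u hu => by
    simpa [Real.dist_eq, hf.zero] using hf.boundedVariation.dist_le hu (y := 0) (by simp)⟩

theorem IsDistortion.add {f h : ℝ → ℝ} (hf : IsDistortion f) (hh : IsDistortion h) :
    IsDistortion fun t => f t + h t where
  boundedVariation := boundedVariationOn_add hf.boundedVariation hh.boundedVariation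
  zero := by simp [hf.zero, hh.zero]
  right_zero := by simpa using hf.right_zero.add hh.right_zero
  left_one := hf.left_one.add hh.left_one

theorem IsDistortion.const_mul {f : ℝ → ℝ} (hf : IsDistortion f) (c : ℝ) :
    IsDistortion fun t => c * f t where
  boundedVariation := boundedVariationOn_const_mul hf.boundedVariation c
  zero := by simp [hf.zero]
  right_zero := by simpa using hf.right_zero.const_mul c
  left_one := hf.left_one.const_mul c

theorem isDistortion_of_concaveOn {f : ℝ → ℝ} (hf : ConcaveOn ℝ (Icc 0 1) f)
    (hc : ContinuousOn f (Icc 0 1)) (h0 : f 0 = 0) : IsDistortion f where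
  boundedVariation := boundedVariationOn_of_concaveOn hf hc
  zero := h0
  right_zero := by
    have h : Tendsto f (𝓝[>] 0) (𝓝 (f 0)) :=
      (hc 0 (left_mem_Icc.2 zero_le_one)).mono_left
        (nhdsWithin_le_of_mem (mem_of_superset (Ioo_mem_nhdsGT one_pos) Ioo_subset_Icc_self))
    rwa [h0] at h
  left_one := (hc 1 (right_mem_Icc.2 zero_le_one)).mono_left
    (nhdsWithin_le_of_mem (mem_of_superset (Ioo_mem_nhdsLT one_pos) Ioo_subset_Icc_self))

/-! ### The concave envelope -/

/-- Near `0` the right limit keeps `f` below `η`; farther away a steep slope beats the global bound.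
Such lines, and their mirror images at `1`, pin down the envelope and its continuity at the
endpoints. -/
theorem IsDistortion.exists_affine_zero {f : ℝ → ℝ} (hf : IsDistortion f) {η : ℝ} (hη : 0 < η) :
    ∃ C, ∀ s ∈ Icc (0 : ℝ) 1, f s ≤ η + C * s := by
  obtain ⟨M, hM0, hM⟩ := hf.exists_bound
  obtain ⟨δ, hδ, hδf⟩ := mem_nhdsGT_iff_exists_Ioo_subset.1
    (hf.right_zero.eventually (gt_mem_nhds hη))
  have hδ0 : (0 : ℝ) < δ := hδ
  refine ⟨M / δ, fun s hs => ?_⟩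
  have hMs : 0 ≤ M / δ * s := mul_nonneg (div_nonneg hM0 hδ0.le) hs.1
  rcases hs.1.eq_or_lt with h | h
  · rw [← h, hf.zero]; simp [hη.le]
  rcases lt_or_ge s δ with h' | h'
  · have : f s < η := hδf ⟨h, h'⟩
    linarith
  · have h1 : M ≤ M / δ * s := by
      rw [div_mul_eq_mul_div, le_div_iff₀ hδ0]
      exact mul_le_mul_of_nonneg_left h' hM0
    linarith [(abs_le.1 (hM s hs)).2]

theorem IsDistortion.exists_affine_one {f : ℝ → ℝ} (hf : IsDistortion f) {η : ℝ} (hη : 0 < η) :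
    ∃ C, ∀ s ∈ Icc (0 : ℝ) 1, f s ≤ f 1 + η + C * (1 - s) := by
  obtain ⟨M, hM0, hM⟩ := hf.exists_bound
  obtain ⟨δ, hδ, hδf⟩ := mem_nhdsLT_iff_exists_Ioo_subset.1
    (hf.left_one.eventually (gt_mem_nhds (by linarith : f 1 < f 1 + η)))
  have hδ0 : (0 : ℝ) < 1 - δ := sub_pos.2 hδ
  refine ⟨2 * M / (1 - δ), fun s hs => ?_⟩
  have hMs : 0 ≤ 2 * M / (1 - δ) * (1 - s) :=
    mul_nonneg (div_nonneg (by linarith) hδ0.le) (by linarith [hs.2])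
  rcases hs.2.eq_or_lt with h | h
  · rw [h]; simp [hη.le]
  rcases lt_or_ge δ s with h' | h'
  · have : f s < f 1 + η := hδf ⟨h', h⟩
    linarith
  · have h1 : 2 * M ≤ 2 * M / (1 - δ) * (1 - s) := by
      rw [div_mul_eq_mul_div, le_div_iff₀ hδ0]
      exact mul_le_mul_of_nonneg_left (by linarith) (by linarith)
    linarith [(abs_le.1 (hM s hs)).2, (abs_le.1 (hM 1 (by simp))).1]

/-- The infimum of the affine majorants of `f` on `[0,1]`. -/
noncomputable def affineEnvelope (f : ℝ → ℝ) (t : ℝ) : ℝ :=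
  sInf {y : ℝ | ∃ a b : ℝ, (∀ s ∈ Icc (0 : ℝ) 1, f s ≤ a + b * s) ∧ y = a + b * t}

theorem affineEnvelope_le {f : ℝ → ℝ} {a b t : ℝ} (ht : t ∈ Icc (0 : ℝ) 1)
    (h : ∀ s ∈ Icc (0 : ℝ) 1, f s ≤ a + b * s) : affineEnvelope f t ≤ a + b * t := by
  refine csInf_le ⟨f t, ?_⟩ ⟨a, b, h, rfl⟩
  rintro _ ⟨a, b, h, rfl⟩
  exact h t ht

theorem IsDistortion.le_affineEnvelope_of_forall {f : ℝ → ℝ} (hf : IsDistortion f) {c t : ℝ}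
    (h : ∀ a b : ℝ, (∀ s ∈ Icc (0 : ℝ) 1, f s ≤ a + b * s) → c ≤ a + b * t) :
    c ≤ affineEnvelope f t := by
  obtain ⟨C, hC⟩ := hf.exists_affine_zero one_pos
  refine le_csInf ⟨_, 1, C, hC, rfl⟩ ?_
  rintro _ ⟨a, b, hab, rfl⟩
  exact h a b hab

theorem IsDistortion.le_affineEnvelope {f : ℝ → ℝ} (hf : IsDistortion f) {t : ℝ}
    (ht : t ∈ Icc (0 : ℝ) 1) : f t ≤ affineEnvelope f t :=
  hf.le_affineEnvelope_of_forall fun _ _ h => h t ht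

theorem IsDistortion.affineEnvelope_concaveOn {f : ℝ → ℝ} (hf : IsDistortion f) :
    ConcaveOn ℝ (Icc 0 1) (affineEnvelope f) := by
  refine ⟨convex_Icc 0 1, fun x hx y hy a b ha hb hab => ?_⟩
  refine hf.le_affineEnvelope_of_forall fun c d h => ?_
  have h1 := mul_le_mul_of_nonneg_left (affineEnvelope_le hx h) ha
  have h2 := mul_le_mul_of_nonneg_left (affineEnvelope_le hy h) hb
  simp only [smul_eq_mul]
  have : c + d * (a * x + b * y) = a * (c + d * x) + b * (c + d * y) := by
    linear_combination (-c) * hab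
  linarith

theorem IsDistortion.affineEnvelope_zero {f : ℝ → ℝ} (hf : IsDistortion f) :
    affineEnvelope f 0 = 0 := by
  refine le_antisymm (le_of_forall_pos_le_add fun η hη => ?_) ?_
  · obtain ⟨C, hC⟩ := hf.exists_affine_zero hη
    simpa using affineEnvelope_le (t := 0) (by simp) hC
  · simpa [hf.zero] using hf.le_affineEnvelope (t := 0) (by simp)

theorem IsDistortion.affineEnvelope_one {f : ℝ → ℝ} (hf : IsDistortion f) :
    affineEnvelope f 1 = f 1 := by
  refine le_antisymm (le_of_forall_pos_le_add fun η hη => ?_) (hf.le_affineEnvelope (by simp))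
  obtain ⟨C, hC⟩ := hf.exists_affine_one hη
  have := affineEnvelope_le (t := 1) (a := f 1 + η + C) (b := -C) (by simp)
    (fun s hs => (hC s hs).trans_eq (by ring))
  linarith

theorem IsDistortion.affineEnvelope_continuousOn {f : ℝ → ℝ} (hf : IsDistortion f) :
    ContinuousOn (affineEnvelope f) (Icc 0 1) := by
  refine hf.affineEnvelope_concaveOn.continuousOn_Icc one_pos ?_ ?_
  · rw [← continuousWithinAt_Ioi_iff_Ici, ContinuousWithinAt, hf.affineEnvelope_zero]
    refine tendsto_order.2 ⟨fun c hc => ?_, fun c hc => ?_⟩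
    · filter_upwards [hf.right_zero.eventually (lt_mem_nhds hc),
        Ioo_mem_nhdsGT (zero_lt_one (α := ℝ))] with t h1 h2
      exact h1.trans_le (hf.le_affineEnvelope ⟨h2.1.le, h2.2.le⟩)
    · obtain ⟨C, hC⟩ := hf.exists_affine_zero (half_pos hc)
      have h1 : Tendsto (fun t : ℝ => c / 2 + C * t) (𝓝[>] 0) (𝓝 (c / 2 + C * 0)) :=
        (Continuous.tendsto (by fun_prop) 0).mono_left nhdsWithin_le_nhds
      filter_upwards [h1.eventually (gt_mem_nhds (by linarith : c / 2 + C * 0 < c)),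
        Ioo_mem_nhdsGT (zero_lt_one (α := ℝ))] with t h2 h3
      exact (affineEnvelope_le ⟨h3.1.le, h3.2.le⟩ hC).trans_lt h2
  · rw [← continuousWithinAt_Iio_iff_Iic, ContinuousWithinAt, hf.affineEnvelope_one]
    refine tendsto_order.2 ⟨fun c hc => ?_, fun c hc => ?_⟩
    · filter_upwards [hf.left_one.eventually (lt_mem_nhds hc),
        Ioo_mem_nhdsLT (zero_lt_one (α := ℝ))] with t h1 h2
      exact h1.trans_le (hf.le_affineEnvelope ⟨h2.1.le, h2.2.le⟩)
    · obtain ⟨C, hC⟩ := hf.exists_affine_one (half_pos (sub_pos.2 hc))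
      have h1 : Tendsto (fun t : ℝ => f 1 + (c - f 1) / 2 + C * (1 - t)) (𝓝[<] 1)
          (𝓝 (f 1 + (c - f 1) / 2 + C * (1 - 1))) :=
        (Continuous.tendsto (by fun_prop) 1).mono_left nhdsWithin_le_nhds
      filter_upwards [h1.eventually (gt_mem_nhds
        (by linarith : f 1 + (c - f 1) / 2 + C * (1 - 1) < c)),
        Ioo_mem_nhdsLT (zero_lt_one (α := ℝ))] with t h2 h3
      refine lt_of_le_of_lt ?_ h2
      refine (affineEnvelope_le (a := f 1 + (c - f 1) / 2 + C) (b := -C) ⟨h3.1.le, h3.2.le⟩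
        (fun s hs => (hC s hs).trans_eq (by ring))).trans_eq (by ring)

theorem hasDerivWithinAt_of_concaveOn {h : ℝ → ℝ} (hh : ConcaveOn ℝ (Icc 0 1) h) {t : ℝ}
    (ht : t ∈ Ioo (0 : ℝ) 1) : HasDerivWithinAt h (derivWithin h (Ioi t) t) (Ioi t) t := by
  have h1 := hh.neg.hasDerivWithinAt_rightDeriv_of_mem_interior (x := t)
    (by rwa [interior_Icc])
  have h2 : HasDerivWithinAt h (-derivWithin (-h) (Ioi t) t) (Ioi t) t := by
    simpa using h1.neg
  exact h2.differentiableWithinAt.hasDerivWithinAt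

theorem le_supporting_line_of_concaveOn {h : ℝ → ℝ} (hh : ConcaveOn ℝ (Icc 0 1) h) {t : ℝ}
    (ht : t ∈ Ioo (0 : ℝ) 1) {s : ℝ} (hs : s ∈ Icc (0 : ℝ) 1) :
    h s ≤ h t + derivWithin h (Ioi t) t * (s - t) := by
  have hd := hasDerivWithinAt_of_concaveOn hh ht
  have htI : t ∈ Icc (0 : ℝ) 1 := ⟨ht.1.le, ht.2.le⟩
  rcases lt_trichotomy s t with h' | h' | h'
  · have hsl : derivWithin h (Ioi t) t ≤ slope h s t := by
      have h1 := (hasDerivWithinAt_iff_tendsto_slope' self_notMem_Ioi).1 hd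
      refine le_of_tendsto h1 ?_
      filter_upwards [Ioo_mem_nhdsGT ht.2] with y hy
      have := hh.slope_anti_adjacent hs ⟨ht.1.le.trans hy.1.le, hy.2.le⟩ h' hy.1
      simpa only [slope_def_field] using this
    rw [slope_def_field, le_div_iff₀ (by linarith)] at hsl
    linarith
  · simp [h']
  · have := hh.slope_le_of_hasDerivWithinAt_Ioi htI hs h' hd
    rw [slope_def_field, div_le_iff₀ (by linarith)] at this
    linarith

theorem IsDistortion.affineEnvelope_le_of_concaveOn {f h : ℝ → ℝ} (hf : IsDistortion f)
    (hh : ConcaveOn ℝ (Icc 0 1) h) (hfh : ∀ s ∈ Icc (0 : ℝ) 1, f s ≤ h s) {t : ℝ}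
    (ht : t ∈ Icc (0 : ℝ) 1) : affineEnvelope f t ≤ h t := by
  rcases ht.1.eq_or_lt with h0 | h0
  · rw [← h0]
    exact (hf.affineEnvelope_zero.trans hf.zero.symm).le.trans (hfh 0 (by simp))
  rcases ht.2.eq_or_lt with h1 | h1
  · rw [h1, hf.affineEnvelope_one]; exact hfh 1 (by simp)
  set d := derivWithin h (Ioi t) t
  have := affineEnvelope_le (f := f) (a := h t - d * t) (b := d) ht fun s hs =>
    (hfh s hs).trans ((le_supporting_line_of_concaveOn hh ⟨h0, h1⟩ hs).trans_eq (by ring))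
  linarith

/-- Affine majorants need not vanish at `0`, so they are not competitors in the definition. Their
infimum is, however, itself a concave distortion function, and supporting lines put it below every
other concave majorant. -/
theorem IsDistortion.concaveEnvelope_eq {f : ℝ → ℝ} (hf : IsDistortion f) {t : ℝ}
    (ht : t ∈ Icc (0 : ℝ) 1) : concaveEnvelope f t = affineEnvelope f t := by
  have hA : IsDistortion (affineEnvelope f) := isDistortion_of_concaveOn
    hf.affineEnvelope_concaveOn hf.affineEnvelope_continuousOn hf.affineEnvelope_zero
  refine IsLeast.csInf_eq ⟨⟨_, hA, hf.affineEnvelope_concaveOn,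
    fun s hs => hf.le_affineEnvelope hs, rfl⟩, ?_⟩
  rintro _ ⟨h, -, hh, hfh, rfl⟩
  exact hf.affineEnvelope_le_of_concaveOn hh hfh ht

theorem IsDistortion.concaveEnvelope_concaveOn {f : ℝ → ℝ} (hf : IsDistortion f) :
    ConcaveOn ℝ (Icc 0 1) (concaveEnvelope f) :=
  hf.affineEnvelope_concaveOn.congr fun _ ht => (hf.concaveEnvelope_eq ht).symm

theorem IsDistortion.concaveEnvelope_continuousOn {f : ℝ → ℝ} (hf : IsDistortion f) :
    ContinuousOn (concaveEnvelope f) (Icc 0 1) :=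
  hf.affineEnvelope_continuousOn.congr fun _ ht => hf.concaveEnvelope_eq ht

theorem IsDistortion.concaveEnvelope_zero {f : ℝ → ℝ} (hf : IsDistortion f) :
    concaveEnvelope f 0 = 0 := by
  rw [hf.concaveEnvelope_eq (by simp), hf.affineEnvelope_zero]

theorem IsDistortion.concaveEnvelope_one {f : ℝ → ℝ} (hf : IsDistortion f) :
    concaveEnvelope f 1 = f 1 := by
  rw [hf.concaveEnvelope_eq (by simp), hf.affineEnvelope_one]

theorem IsDistortion.le_concaveEnvelope {f : ℝ → ℝ} (hf : IsDistortion f) {t : ℝ}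
    (ht : t ∈ Icc (0 : ℝ) 1) : f t ≤ concaveEnvelope f t := by
  rw [hf.concaveEnvelope_eq ht]; exact hf.le_affineEnvelope ht

theorem IsDistortion.concaveEnvelope_le {f h : ℝ → ℝ} (hf : IsDistortion f)
    (hh : ConcaveOn ℝ (Icc 0 1) h) (hfh : ∀ s ∈ Icc (0 : ℝ) 1, f s ≤ h s) {t : ℝ}
    (ht : t ∈ Icc (0 : ℝ) 1) : concaveEnvelope f t ≤ h t := by
  rw [hf.concaveEnvelope_eq ht]; exact hf.affineEnvelope_le_of_concaveOn hh hfh ht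

theorem IsDistortion.concaveEnvelope_le_add {f h : ℝ → ℝ} (hf : IsDistortion f)
    (hh : IsDistortion h) {c : ℝ} (hfh : ∀ s ∈ Icc (0 : ℝ) 1, f s ≤ h s + c) {t : ℝ}
    (ht : t ∈ Icc (0 : ℝ) 1) : concaveEnvelope f t ≤ concaveEnvelope h t + c :=
  hf.concaveEnvelope_le (hh.concaveEnvelope_concaveOn.add_const c)
    (fun s hs => (hfh s hs).trans (add_le_add_left (hh.le_concaveEnvelope hs) c)) ht

theorem IsDistortion.concaveEnvelope_const_mul {f : ℝ → ℝ} (hf : IsDistortion f) {c : ℝ}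
    (hc : 0 < c) {t : ℝ} (ht : t ∈ Icc (0 : ℝ) 1) :
    concaveEnvelope (fun x => c * f x) t = c * concaveEnvelope f t := by
  refine le_antisymm ?_ ?_
  · refine (hf.const_mul c).concaveEnvelope_le (hf.concaveEnvelope_concaveOn.smul hc.le)
      (fun s hs => ?_) ht
    exact mul_le_mul_of_nonneg_left (hf.le_concaveEnvelope hs) hc.le
  · have := hf.concaveEnvelope_le (h := fun s => c⁻¹ * concaveEnvelope (fun x => c * f x) s)
      ((hf.const_mul c).concaveEnvelope_concaveOn.smul (inv_nonneg.2 hc.le))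
      (fun s hs => ?_) ht
    · rwa [← div_eq_inv_mul, le_div_iff₀ hc, mul_comm] at this
    · rw [← div_eq_inv_mul, le_div_iff₀ hc, mul_comm]
      exact (hf.const_mul c).le_concaveEnvelope hs

/-! ### The derivative of the concave envelope -/

theorem IsDistortion.hasDerivWithinAt_envDeriv {f : ℝ → ℝ} (hf : IsDistortion f) {t : ℝ}
    (ht : t ∈ Ioo (0 : ℝ) 1) : HasDerivWithinAt (concaveEnvelope f) (envDeriv f t) (Ioi t) t :=
  hasDerivWithinAt_of_concaveOn hf.concaveEnvelope_concaveOn ht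

theorem IsDistortion.envDeriv_antitoneOn {f : ℝ → ℝ} (hf : IsDistortion f) :
    AntitoneOn (envDeriv f) (Ioo 0 1) := by
  intro x hx y hy hxy
  rcases hxy.eq_or_lt with rfl | hxy
  · exact le_rfl
  have h1 := le_supporting_line_of_concaveOn hf.concaveEnvelope_concaveOn hx
    (s := y) ⟨hy.1.le, hy.2.le⟩
  have h2 := le_supporting_line_of_concaveOn hf.concaveEnvelope_concaveOn hy
    (s := x) ⟨hx.1.le, hx.2.le⟩
  unfold envDeriv
  nlinarith

/-- The derivative may be unbounded at both ends. After subtracting its value at `1/2` it has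
constant sign on each half, where a signed right derivative of a continuous function is integrable.
-/
theorem IsDistortion.intervalIntegrable_envDeriv {f : ℝ → ℝ} (hf : IsDistortion f) :
    IntervalIntegrable (envDeriv f) volume 0 1 := by
  have hcont := hf.concaveEnvelope_continuousOn
  set c := envDeriv f (1 / 2)
  have h1 : IntervalIntegrable (fun t => envDeriv f t - c) volume 0 (1 / 2) := by
    rw [intervalIntegrable_iff_integrableOn_Ioc_of_le (by norm_num)]
    refine intervalIntegral.integrableOn_deriv_right_of_nonneg
      (g := fun t => concaveEnvelope f t - c * t) ?_ ?_ ?_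
    · exact (hcont.mono (Icc_subset_Icc_right (by norm_num))).sub (by fun_prop)
    · intro x hx
      have := (hf.hasDerivWithinAt_envDeriv (t := x) ⟨hx.1, by linarith [hx.2]⟩).fun_sub
        ((hasDerivWithinAt_id x (Ioi x)).const_mul c)
      simpa using this
    · intro x hx
      exact sub_nonneg.2 (hf.envDeriv_antitoneOn ⟨hx.1, by linarith [hx.2]⟩
        ⟨by norm_num, by norm_num⟩ hx.2.le)
  have h2 : IntervalIntegrable (fun t => c - envDeriv f t) volume (1 / 2) 1 := by
    rw [intervalIntegrable_iff_integrableOn_Ioc_of_le (by norm_num)]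
    refine intervalIntegral.integrableOn_deriv_right_of_nonneg
      (g := fun t => c * t - concaveEnvelope f t) ?_ ?_ ?_
    · exact ContinuousOn.sub (by fun_prop) (hcont.mono (Icc_subset_Icc_left (by norm_num)))
    · intro x hx
      have := ((hasDerivWithinAt_id x (Ioi x)).const_mul c).fun_sub
        (hf.hasDerivWithinAt_envDeriv (t := x) ⟨by linarith [hx.1], hx.2⟩)
      simpa using this
    · intro x hx
      exact sub_nonneg.2 (hf.envDeriv_antitoneOn ⟨by norm_num, by norm_num⟩
        ⟨by linarith [hx.1], hx.2⟩ hx.1.le)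
  have h3 : IntervalIntegrable (envDeriv f) volume 0 (1 / 2) := by
    simpa using h1.add (intervalIntegrable_const (c := c))
  have h4 : IntervalIntegrable (envDeriv f) volume (1 / 2) 1 := by
    simpa using (intervalIntegrable_const (c := c)).sub h2
  exact h3.trans h4

theorem IsDistortion.integrable_envDeriv {f : ℝ → ℝ} (hf : IsDistortion f) :
    Integrable (envDeriv f) unif :=
  ((intervalIntegrable_iff_integrableOn_Ioc_of_le zero_le_one).1
    hf.intervalIntegrable_envDeriv).mono_set Ioo_subset_Ioc_self

theorem IsDistortion.concaveEnvelope_eq_integral {f : ℝ → ℝ} (hf : IsDistortion f) {u : ℝ}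
    (hu : u ∈ Icc (0 : ℝ) 1) : concaveEnvelope f u = ∫ x in (0 : ℝ)..u, envDeriv f x := by
  rw [intervalIntegral.integral_eq_sub_of_hasDeriv_right_of_le hu.1
    (hf.concaveEnvelope_continuousOn.mono (Icc_subset_Icc_right hu.2))
    (fun x hx => hf.hasDerivWithinAt_envDeriv ⟨hx.1, hx.2.trans_le hu.2⟩)
    (hf.intervalIntegrable_envDeriv.mono_set ?_), hf.concaveEnvelope_zero, sub_zero]
  rw [uIcc_of_le hu.1, uIcc_of_le zero_le_one]
  exact Icc_subset_Icc_right hu.2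

theorem IsDistortion.integral_envDeriv {f : ℝ → ℝ} (hf : IsDistortion f) :
    ∫ t, envDeriv f t ∂unif = f 1 := by
  rw [← hf.concaveEnvelope_one, hf.concaveEnvelope_eq_integral (by simp),
    intervalIntegral.integral_of_le zero_le_one, integral_Ioc_eq_integral_Ioo, unif]

theorem envDeriv_eq_of_eventuallyEq {f : ℝ → ℝ} {φ : ℝ → ℝ} {t d : ℝ}
    (h : concaveEnvelope f =ᶠ[𝓝 t] φ) (hφ : HasDerivAt φ d t) : envDeriv f t = d := by
  unfold envDeriv
  rw [(h.filter_mono nhdsWithin_le_nhds).derivWithin_eq h.eq_of_nhds]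
  exact hφ.hasDerivWithinAt.derivWithin (uniqueDiffWithinAt_Ioi t)

theorem IsDistortion.envDeriv_const_mul {f : ℝ → ℝ} (hf : IsDistortion f) {c : ℝ}
    (hc : 0 < c) {t : ℝ} (ht : t ∈ Ioo (0 : ℝ) 1) :
    envDeriv (fun x => c * f x) t = c * envDeriv f t := by
  have h : concaveEnvelope (fun x => c * f x) =ᶠ[𝓝[>] t] fun x => c * concaveEnvelope f x := by
    filter_upwards [nhdsWithin_le_nhds (isOpen_Ioo.mem_nhds ht)] with x hx
    exact hf.concaveEnvelope_const_mul hc ⟨hx.1.le, hx.2.le⟩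
  unfold envDeriv
  rw [h.derivWithin_eq (hf.concaveEnvelope_const_mul hc ⟨ht.1.le, ht.2.le⟩)]
  exact ((hf.hasDerivWithinAt_envDeriv ht).const_mul c).derivWithin (uniqueDiffWithinAt_Ioi t)

/-- Where the envelope lies strictly above a function bounded near `u`, it is affine. -/
theorem IsDistortion.envDeriv_eventually_const {f : ℝ → ℝ} (hf : IsDistortion f) {u b : ℝ}
    (hu : u ∈ Ioo (0 : ℝ) 1) (hb : ∀ᶠ s in 𝓝 u, f s ≤ b) (hbE : b < concaveEnvelope f u) :
    ∃ c, ∀ᶠ t in 𝓝 u, envDeriv f t = c := by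
  set E := concaveEnvelope f
  have hcont : ContinuousAt E u := hf.concaveEnvelope_continuousOn.continuousAt
    (Icc_mem_nhds hu.1 hu.2)
  have hev : ∀ᶠ s in 𝓝 u, f s ≤ b ∧ b < E s ∧ s ∈ Ioo (0 : ℝ) 1 :=
    hb.and ((hcont.eventually (lt_mem_nhds hbE)).and (isOpen_Ioo.mem_nhds hu))
  obtain ⟨δ, hδ, hball⟩ := Metric.eventually_nhds_iff_ball.1 hev
  set x := u - δ / 2
  set y := u + δ / 2
  have hxy : x < y := by simp only [x, y]; linarith
  have hin : ∀ s ∈ Icc x y, f s ≤ b ∧ b < E s ∧ s ∈ Ioo (0 : ℝ) 1 := fun s hs => by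
    refine hball s ?_
    rw [Real.ball_eq_Ioo]
    simp only [x, y] at hs
    exact ⟨by linarith [hs.1], by linarith [hs.2]⟩
  have hx := hin x ⟨le_rfl, hxy.le⟩
  have hy := hin y ⟨hxy.le, le_rfl⟩
  have hxI : x ∈ Icc (0 : ℝ) 1 := ⟨hx.2.2.1.le, hx.2.2.2.le⟩
  have hyI : y ∈ Icc (0 : ℝ) 1 := ⟨hy.2.2.1.le, hy.2.2.2.le⟩
  have hconc : ConcaveOn ℝ (Icc 0 1) E := hf.concaveEnvelope_concaveOn
  -- `L` is the chord of the envelope over `[x, y]`. Concavity puts `E` above `L` inside and below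
  -- `L` outside the interval.
  set c := (E y - E x) / (y - x)
  set L : ℝ → ℝ := fun s => E x + c * (s - x)
  have hc : c * (y - x) = E y - E x := div_mul_cancel₀ _ (by linarith)
  have hinside : ∀ s ∈ Icc x y, L s ≤ E s := fun s hs => by
    have hsI : s ∈ Icc (0 : ℝ) 1 := ⟨(hin s hs).2.2.1.le, (hin s hs).2.2.2.le⟩
    rcases hs.1.eq_or_lt with h | h
    · simp [L, ← h]
    rcases hs.2.eq_or_lt with h' | h'
    · simp only [L, h', hc]; linarith
    have := hconc.slope_anti_adjacent hxI hyI h h'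
    rw [div_le_div_iff₀ (by linarith) (by linarith)] at this
    have h2 : 0 < y - x := by linarith
    refine le_of_mul_le_mul_right ?_ h2
    have : L s * (y - x) = E x * (y - x) + (E y - E x) * (s - x) := by
      simp only [L]; linear_combination (s - x) * hc
    rw [this]
    nlinarith
  have houtside : ∀ s ∈ Icc (0 : ℝ) 1, s ∉ Icc x y → E s ≤ L s := fun s hs hsn => by
    have h2 : 0 < y - x := by linarith
    have hL : L s * (y - x) = E x * (y - x) + (E y - E x) * (s - x) := by
      simp only [L]; linear_combination (s - x) * hc
    refine le_of_mul_le_mul_right ?_ h2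
    rw [hL]
    rcases lt_or_ge s x with h | h
    · have := hconc.slope_anti_adjacent hs hyI h hxy
      rw [div_le_div_iff₀ (by linarith) (by linarith)] at this
      nlinarith
    · have h' : y < s := not_le.1 fun h' => hsn ⟨h, h'⟩
      have := hconc.slope_anti_adjacent hxI hs hxy h'
      rw [div_le_div_iff₀ (by linarith) (by linarith)] at this
      nlinarith
  have hLconc : ConcaveOn ℝ (Icc 0 1) L := by
    refine ⟨convex_Icc 0 1, fun p _ q _ a b _ _ hab => le_of_eq ?_⟩
    simp only [L, smul_eq_mul]
    linear_combination (E x - c * x) * hab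
  have hbL : ∀ s ∈ Icc x y, b ≤ L s := fun s hs => by
    have h2 : 0 < y - x := by linarith
    refine le_of_mul_le_mul_right ?_ h2
    have hL : L s * (y - x) = E x * (y - s) + E y * (s - x) := by
      simp only [L]; linear_combination (s - x) * hc
    rw [hL]
    nlinarith [mul_le_mul_of_nonneg_right hx.2.1.le (sub_nonneg.2 hs.2),
      mul_le_mul_of_nonneg_right hy.2.1.le (sub_nonneg.2 hs.1)]
  have hEL : ∀ s ∈ Icc (0 : ℝ) 1, E s ≤ L s := by
    intro s hs
    -- `min E L` is still a concave majorant of `f`: inside the interval `f ≤ b ≤ L`, outside it `f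
    -- ≤ E ≤ L`. Minimality of `E` then gives `E ≤ L` everywhere.
    refine (hf.concaveEnvelope_le (hconc.inf hLconc) (fun r hr => ?_) hs).trans inf_le_right
    refine le_inf (hf.le_concaveEnvelope hr) ?_
    by_cases hr' : r ∈ Icc x y
    · exact (hin r hr').1.trans (hbL r hr')
    · exact (hf.le_concaveEnvelope hr).trans (houtside r hr hr')
  refine ⟨c, ?_⟩
  have hmem : Ioo x y ∈ 𝓝 u := Ioo_mem_nhds (by simp only [x]; linarith) (by simp only [y]; linarith)
  filter_upwards [hmem] with t ht
  refine envDeriv_eq_of_eventuallyEq (φ := L) ?_ ?_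
  · filter_upwards [isOpen_Ioo.mem_nhds ht] with s hs
    have hs' : s ∈ Icc x y := ⟨hs.1.le, hs.2.le⟩
    exact le_antisymm (hEL s ⟨(hin s hs').2.2.1.le, (hin s hs').2.2.2.le⟩) (hinside s hs')
  · simpa [L] using (((hasDerivAt_id t).sub_const x).const_mul c).const_add (E x)

/-! ### The upper semicontinuous version -/

theorem IsDistortion.tendsto_leftLim {f : ℝ → ℝ} (hf : IsDistortion f) {u : ℝ}
    (hu : u ∈ Ioo (0 : ℝ) 1) : Tendsto f (𝓝[<] u) (𝓝 (Function.leftLim f u)) := by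
  obtain ⟨l, hl⟩ := hf.boundedVariation.exists_tendsto_left u
  have : 𝓝[Icc 0 1 ∩ Iio u] u = 𝓝[<] u := by
    rw [inter_comm]
    exact nhdsWithin_inter_of_mem' (mem_nhdsWithin_of_mem_nhds (Icc_mem_nhds hu.1 hu.2))
  rw [this] at hl
  exact tendsto_leftLim_of_tendsto ⟨l, hl⟩

theorem IsDistortion.tendsto_rightLim {f : ℝ → ℝ} (hf : IsDistortion f) {u : ℝ}
    (hu : u ∈ Ioo (0 : ℝ) 1) : Tendsto f (𝓝[>] u) (𝓝 (Function.rightLim f u)) := by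
  obtain ⟨l, hl⟩ := hf.boundedVariation.exists_tendsto_right u
  have : 𝓝[Icc 0 1 ∩ Ioi u] u = 𝓝[>] u := by
    rw [inter_comm]
    exact nhdsWithin_inter_of_mem' (mem_nhdsWithin_of_mem_nhds (Icc_mem_nhds hu.1 hu.2))
  rw [this] at hl
  exact tendsto_rightLim_of_tendsto ⟨l, hl⟩

theorem uscVersion_of_mem {f : ℝ → ℝ} {u : ℝ} (hu : u ∈ Ioo (0 : ℝ) 1) :
    uscVersion f u = max (max (Function.leftLim f u) (f u)) (Function.rightLim f u) := by
  simp [uscVersion, hu.1, hu.2]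

theorem uscVersion_of_notMem {f : ℝ → ℝ} {u : ℝ} (hu : u ∉ Ioo (0 : ℝ) 1) :
    uscVersion f u = f u := if_neg hu

theorem le_uscVersion (f : ℝ → ℝ) (u : ℝ) : f u ≤ uscVersion f u := by
  by_cases hu : u ∈ Ioo (0 : ℝ) 1
  · rw [uscVersion_of_mem hu]
    exact (le_max_right _ _).trans (le_max_left _ _)
  · rw [uscVersion_of_notMem hu]

theorem uscVersion_one (f : ℝ → ℝ) : uscVersion f 1 = f 1 := uscVersion_of_notMem (by simp)

theorem uscVersion_zero (f : ℝ → ℝ) : uscVersion f 0 = f 0 := uscVersion_of_notMem (by simp)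

theorem IsDistortion.eventually_lt_of_uscVersion_lt {f : ℝ → ℝ} (hf : IsDistortion f) {u b : ℝ}
    (hu : u ∈ Ioo (0 : ℝ) 1) (hb : uscVersion f u < b) : ∀ᶠ s in 𝓝 u, f s < b := by
  rw [uscVersion_of_mem hu, max_lt_iff, max_lt_iff] at hb
  have h1 := (hf.tendsto_leftLim hu).eventually (gt_mem_nhds hb.1.1)
  have h2 := (hf.tendsto_rightLim hu).eventually (gt_mem_nhds hb.2)
  rw [← nhdsNE_sup_pure, eventually_sup, ← nhdsLT_sup_nhdsGT, eventually_sup]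
  exact ⟨⟨h1, h2⟩, hb.1.2⟩

theorem IsDistortion.exists_lt_of_lt_uscVersion {f : ℝ → ℝ} (hf : IsDistortion f) {u b : ℝ}
    (hu : u ∈ Icc (0 : ℝ) 1) (hb : b < uscVersion f u) {δ : ℝ} (hδ : 0 < δ) :
    ∃ v ∈ Icc (0 : ℝ) 1, |v - u| ≤ δ ∧ b < f v := by
  by_cases hu' : u ∈ Ioo (0 : ℝ) 1
  swap
  · rw [uscVersion_of_notMem hu'] at hb
    exact ⟨u, hu, by simpa using hδ.le, hb⟩
  rw [uscVersion_of_mem hu', lt_max_iff, lt_max_iff] at hb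
  have hnhds : ∀ᶠ v in 𝓝 u, v ∈ Icc (0 : ℝ) 1 ∧ |v - u| ≤ δ :=
    inter_mem (Icc_mem_nhds hu'.1 hu'.2) (Metric.closedBall_mem_nhds u hδ)
  rcases hb with (h | h) | h
  · obtain ⟨v, h1, h2⟩ := (((hf.tendsto_leftLim hu').eventually (lt_mem_nhds h)).and
      (hnhds.filter_mono nhdsWithin_le_nhds)).exists
    exact ⟨v, h2.1, h2.2, h1⟩
  · exact ⟨u, hu, by simpa using hδ.le, h⟩
  · obtain ⟨v, h1, h2⟩ := (((hf.tendsto_rightLim hu').eventually (lt_mem_nhds h)).and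
      (hnhds.filter_mono nhdsWithin_le_nhds)).exists
    exact ⟨v, h2.1, h2.2, h1⟩

theorem IsDistortion.uscVersion_le_of_continuousOn {f E : ℝ → ℝ} (hf : IsDistortion f)
    (hE : ContinuousOn E (Icc 0 1)) (hfE : ∀ t ∈ Icc (0 : ℝ) 1, f t ≤ E t) {u : ℝ}
    (hu : u ∈ Icc (0 : ℝ) 1) : uscVersion f u ≤ E u := by
  by_cases hu' : u ∈ Ioo (0 : ℝ) 1
  swap
  · rw [uscVersion_of_notMem hu']; exact hfE u hu
  have hc : Tendsto E (𝓝 u) (𝓝 (E u)) := hE.continuousAt (Icc_mem_nhds hu'.1 hu'.2)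
  have hle : ∀ᶠ v in 𝓝 u, f v ≤ E v := by
    filter_upwards [Icc_mem_nhds hu'.1 hu'.2] with v hv using hfE v hv
  rw [uscVersion_of_mem hu', max_le_iff, max_le_iff]
  exact ⟨⟨le_of_tendsto_of_tendsto (hf.tendsto_leftLim hu') (hc.mono_left nhdsWithin_le_nhds)
    (hle.filter_mono nhdsWithin_le_nhds), hfE u hu⟩,
    le_of_tendsto_of_tendsto (hf.tendsto_rightLim hu') (hc.mono_left nhdsWithin_le_nhds)
    (hle.filter_mono nhdsWithin_le_nhds)⟩

theorem IsDistortion.uscVersion_add {f κ : ℝ → ℝ} (hf : IsDistortion f) {u : ℝ}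
    (hκ : ContinuousOn κ (Icc 0 1)) :
    uscVersion (fun t => f t + κ t) u = uscVersion f u + κ u := by
  by_cases hu : u ∈ Ioo (0 : ℝ) 1
  swap
  · rw [uscVersion_of_notMem hu, uscVersion_of_notMem hu]
  have hc : Tendsto κ (𝓝 u) (𝓝 (κ u)) := hκ.continuousAt (Icc_mem_nhds hu.1 hu.2)
  rw [uscVersion_of_mem hu, uscVersion_of_mem hu, max_add, max_add]
  congr 2
  · exact leftLim_eq_of_tendsto
      ((hf.tendsto_leftLim hu).add (hc.mono_left nhdsWithin_le_nhds))
  · exact rightLim_eq_of_tendsto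
      ((hf.tendsto_rightLim hu).add (hc.mono_left nhdsWithin_le_nhds))

/-- The survival function of a law with quantile `t ↦ h (1 - t)`, `h` a function of the envelope
derivative, only takes values at which the envelope touches the upper semicontinuous version. -/
theorem IsDistortion.uscVersion_eq_concaveEnvelope_of_map {f q : ℝ → ℝ} (hf : IsDistortion f)
    (hq : MonotoneOn q (Ioo 0 1)) (ψ : ℝ → ℝ) (hqψ : ∀ t, q t = ψ (envDeriv f (1 - t))) (x : ℝ) :
    uscVersion f (1 - cdf (unif.map q) x) = concaveEnvelope f (1 - cdf (unif.map q) x) := by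
  set u := 1 - cdf (unif.map q) x with hu
  have huI : u ∈ Icc (0 : ℝ) 1 := one_sub_cdf_mem _ x
  rcases huI.1.eq_or_lt with h0 | h0
  · rw [← h0, uscVersion_zero, hf.concaveEnvelope_zero, hf.zero]
  rcases huI.2.eq_or_lt with h1 | h1
  · rw [h1, uscVersion_one, hf.concaveEnvelope_one]
  refine le_antisymm (hf.uscVersion_le_of_continuousOn hf.concaveEnvelope_continuousOn
    (fun t => hf.le_concaveEnvelope) huI) (not_lt.1 fun hlt => ?_)
  -- A strict gap at `u` makes the envelope affine near `u`, hence `q` constant near `1 - u`, so the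
  -- survival function cannot take the value `u`.
  obtain ⟨b, hb1, hb2⟩ := exists_between hlt
  obtain ⟨c, hc⟩ := hf.envDeriv_eventually_const ⟨h0, h1⟩
    ((hf.eventually_lt_of_uscVersion_lt ⟨h0, h1⟩ hb1).mono fun _ => le_of_lt) hb2
  have hc' : ∀ᶠ t in 𝓝 (1 - u), q t = ψ c := by
    have ht : Tendsto (fun t : ℝ => 1 - t) (𝓝 (1 - u)) (𝓝 u) := by
      have : Continuous fun t : ℝ => 1 - t := by fun_prop
      simpa using this.tendsto (1 - u)
    filter_upwards [ht.eventually hc] with t h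
    rw [hqψ, h]
  exact one_sub_cdf_map_ne_of_eventually_const hq ⟨h0, h1⟩ hc' x hu.symm

/-! ### Square-integrable functions on the unit interval -/

theorem integrable_mul_of_memLp {X Y : ℝ → ℝ} (hX : MemLp X 2 unif) (hY : MemLp Y 2 unif) :
    Integrable (fun t => X t * Y t) unif := hX.integrable_mul hY

theorem memLp_one_sub {X : ℝ → ℝ} (hX : MemLp X 2 unif) : MemLp (fun t => X (1 - t)) 2 unif :=
  hX.comp_measurePreserving measurePreserving_one_sub

theorem memLp_of_monotoneOn_of_bounded {X : ℝ → ℝ} (hX : AEMeasurable X unif) {C : ℝ}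
    (hC : ∀ t, |X t| ≤ C) : MemLp X 2 unif :=
  MemLp.of_bound hX.aestronglyMeasurable C (ae_of_all _ hC)

theorem monotoneOn_one_sub {φ : ℝ → ℝ} (hφ : AntitoneOn φ (Ioo 0 1)) :
    MonotoneOn (fun t => φ (1 - t)) (Ioo 0 1) := fun x hx y hy hxy =>
  hφ ⟨by linarith [hy.2], by linarith [hy.1]⟩ ⟨by linarith [hx.2], by linarith [hx.1]⟩
    (by linarith)

/-- Truncation of a real number to `[-N, N]`. -/
noncomputable def clip (N x : ℝ) : ℝ := max (-N) (min N x)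

theorem clip_mono (N : ℝ) : Monotone (clip N) := fun _ _ h =>
  max_le_max le_rfl (min_le_min le_rfl h)

theorem abs_clip_le {N : ℝ} (hN : 0 ≤ N) (x : ℝ) : |clip N x| ≤ N :=
  abs_le.2 ⟨le_max_left _ _, max_le (by linarith) (min_le_left _ _)⟩

theorem clip_of_abs_le {N x : ℝ} (h : |x| ≤ N) : clip N x = x := by
  rw [clip, min_eq_right (abs_le.1 h).2, max_eq_right (abs_le.1 h).1]

theorem clip_sq_le {N : ℝ} (hN : 0 ≤ N) (x : ℝ) : clip N x ^ 2 ≤ x * clip N x := by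
  rcases le_total |x| N with h | h
  · rw [clip_of_abs_le h, sq]
  · rcases le_total 0 x with hx | hx
    · rw [abs_of_nonneg hx] at h
      have : clip N x = N := by rw [clip, min_eq_left h, max_eq_right (by linarith)]
      rw [this]; nlinarith
    · rw [abs_of_nonpos hx] at h
      have : clip N x = -N := by
        rw [clip, min_eq_right (by linarith), max_eq_left (by linarith)]
      rw [this]; nlinarith

theorem abs_sub_clip_le {N : ℝ} (hN : 0 ≤ N) (x : ℝ) : |x - clip N x| ≤ |x| := by
  rcases le_total |x| N with h | h
  · rw [clip_of_abs_le h]; simp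
  · rcases le_total 0 x with hx | hx
    · rw [abs_of_nonneg hx] at h
      have : clip N x = N := by rw [clip, min_eq_left h, max_eq_right (by linarith)]
      rw [this, abs_of_nonneg hx, abs_of_nonneg (by linarith)]; linarith
    · rw [abs_of_nonpos hx] at h
      have : clip N x = -N := by
        rw [clip, min_eq_right (by linarith), max_eq_left (by linarith)]
      rw [this, abs_of_nonpos hx, abs_of_nonpos (by linarith)]; linarith

theorem continuous_clip (N : ℝ) : Continuous (clip N) := by unfold clip; fun_prop

/-- An antitone density whose primitive lies below that of a square-integrable one, with the same
total integral, is square-integrable with smaller norm. -/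
theorem memLp_and_integral_sq_le_of_primitive_le {φ₁ φ₂ Φ₁ Φ₂ : ℝ → ℝ}
    (hanti : AntitoneOn φ₁ (Ioo 0 1)) (hφ₁ : Integrable φ₁ unif) (hφ₂ : MemLp φ₂ 2 unif)
    (hΦ₁ : ∀ u ∈ Icc (0 : ℝ) 1, Φ₁ u = ∫ x in (0 : ℝ)..u, φ₁ x)
    (hΦ₂ : ∀ u ∈ Icc (0 : ℝ) 1, Φ₂ u = ∫ x in (0 : ℝ)..u, φ₂ x)
    (hle : ∀ u ∈ Icc (0 : ℝ) 1, Φ₁ u ≤ Φ₂ u) (h1 : Φ₁ 1 = Φ₂ 1) :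
    MemLp φ₁ 2 unif ∧ ∫ t, φ₁ t ^ 2 ∂unif ≤ ∫ t, φ₂ t ^ 2 ∂unif := by
  have hφ₂i : Integrable φ₂ unif := hφ₂.integrable (by norm_num)
  have hbound : ∀ n : ℕ, ∫ t, clip n (φ₁ t) ^ 2 ∂unif ≤ ∫ t, φ₂ t ^ 2 ∂unif := by
    intro n
    have hn : (0 : ℝ) ≤ n := n.cast_nonneg
    have hTm : AEMeasurable (fun t => clip n (φ₁ t)) unif :=
      (continuous_clip n).measurable.comp_aemeasurable hφ₁.1.aemeasurable
    have hT : MemLp (fun t => clip n (φ₁ t)) 2 unif :=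
      memLp_of_monotoneOn_of_bounded hTm fun t => abs_clip_le hn _
    have hT' := memLp_one_sub hT
    have hq : MonotoneOn (fun t => clip n (φ₁ (1 - t))) (Ioo 0 1) :=
      (clip_mono n).comp_monotoneOn (monotoneOn_one_sub hanti)
    have hi1 : Integrable (fun t => φ₁ t * clip n (φ₁ t)) unif :=
      hφ₁.mul_bdd (c := n) hTm.aestronglyMeasurable (ae_of_all _ fun t => abs_clip_le hn _)
    have hi2 : Integrable (fun t => φ₂ t * clip n (φ₁ t)) unif := integrable_mul_of_memLp hφ₂ hT
    have hi1' : Integrable (fun t => φ₁ (1 - t) * clip n (φ₁ (1 - t))) unif :=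
      measurePreserving_one_sub.integrable_comp_of_integrable hi1
    have hi2' : Integrable (fun t => φ₂ (1 - t) * clip n (φ₁ (1 - t))) unif :=
      measurePreserving_one_sub.integrable_comp_of_integrable hi2
    -- The test function is the clipped density `T = clip n φ₁`, monotone after reflection. From `T²
    -- ≤ φ₁ T` and `φ₂ T ≤ (φ₂² + T²)/2`, the finite term `∫ T²/2` is absorbed on the left.
    have hmain := integral_mul_le_of_primitive_le hq hφ₁ hi1' hΦ₁ hφ₂i hi2' hΦ₂ hle h1
    rw [integral_one_sub (fun t => φ₁ t * clip n (φ₁ t)),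
      integral_one_sub (fun t => φ₂ t * clip n (φ₁ t))] at hmain
    have e1 : ∫ t, clip n (φ₁ t) ^ 2 ∂unif ≤ ∫ t, φ₁ t * clip n (φ₁ t) ∂unif :=
      integral_mono hT.integrable_sq hi1 fun t => clip_sq_le hn _
    have e2 : ∫ t, φ₂ t * clip n (φ₁ t) ∂unif ≤
        ∫ t, (φ₂ t ^ 2 / 2 + clip n (φ₁ t) ^ 2 / 2) ∂unif :=
      integral_mono hi2 ((hφ₂.integrable_sq.div_const 2).add (hT.integrable_sq.div_const 2))
        fun t => by nlinarith [sq_nonneg (φ₂ t - clip n (φ₁ t))]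
    rw [integral_add (hφ₂.integrable_sq.div_const 2) (hT.integrable_sq.div_const 2),
      integral_div, integral_div] at e2
    linarith
  -- The bound is uniform in the truncation level, so Fatou removes the truncation.
  have hfatou : ∫⁻ t, ENNReal.ofReal (φ₁ t ^ 2) ∂unif ≤
      ENNReal.ofReal (∫ t, φ₂ t ^ 2 ∂unif) := by
    have hm : ∀ n : ℕ, AEMeasurable (fun t => ENNReal.ofReal (clip n (φ₁ t) ^ 2)) unif :=
      fun n => (((continuous_clip n).measurable.comp_aemeasurable
        hφ₁.1.aemeasurable).pow_const 2).ennreal_ofReal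
    have hlim : ∀ t, liminf (fun n : ℕ => ENNReal.ofReal (clip n (φ₁ t) ^ 2)) atTop
        = ENNReal.ofReal (φ₁ t ^ 2) := fun t => by
      refine Tendsto.liminf_eq (tendsto_const_nhds.congr' ?_)
      obtain ⟨N, hN⟩ := exists_nat_ge |φ₁ t|
      filter_upwards [eventually_ge_atTop N] with n hn
      rw [clip_of_abs_le (hN.trans (Nat.cast_le.2 hn))]
    calc _ = ∫⁻ t, liminf (fun n : ℕ => ENNReal.ofReal (clip n (φ₁ t) ^ 2)) atTop ∂unif := by
          simp_rw [hlim]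
      _ ≤ liminf (fun n : ℕ => ∫⁻ t, ENNReal.ofReal (clip n (φ₁ t) ^ 2) ∂unif) atTop :=
          lintegral_liminf_le' hm
      _ ≤ liminf (fun _ : ℕ => ENNReal.ofReal (∫ t, φ₂ t ^ 2 ∂unif)) atTop := by
          refine liminf_le_liminf (Eventually.of_forall fun n => ?_)
          have hT : MemLp (fun t => clip n (φ₁ t)) 2 unif :=
            memLp_of_monotoneOn_of_bounded ((continuous_clip n).measurable.comp_aemeasurable
              hφ₁.1.aemeasurable) fun t => abs_clip_le n.cast_nonneg _
          rw [← ofReal_integral_eq_lintegral_ofReal hT.integrable_sq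
            (ae_of_all _ fun t => sq_nonneg _)]
          exact ENNReal.ofReal_le_ofReal (hbound n)
      _ = _ := by simp
  have hint : Integrable (fun t => φ₁ t ^ 2) unif := by
    refine ⟨hφ₁.1.pow 2, ?_⟩
    rw [hasFiniteIntegral_iff_ofReal (ae_of_all _ fun t => sq_nonneg _)]
    exact hfatou.trans_lt ENNReal.ofReal_lt_top
  refine ⟨(memLp_two_iff_integrable_sq hφ₁.1).2 hint, ?_⟩
  rw [← ofReal_integral_eq_lintegral_ofReal hint (ae_of_all _ fun t => sq_nonneg _)] at hfatou
  exact (ENNReal.ofReal_le_ofReal_iff (integral_nonneg fun t => sq_nonneg _)).1 hfatou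

/-! ### Moments through quantiles -/

theorem integral_comp_quantile (G : Measure ℝ) [IsProbabilityMeasure G] {f : ℝ → ℝ}
    (hf : Continuous f) : ∫ x, f x ∂G = ∫ t, f (quantile G t) ∂unif := by
  have h := integral_map (μ := unif) (aemeasurable_of_monotoneOn (quantile_monotoneOn G))
    (f := f) hf.aestronglyMeasurable
  rwa [map_quantile] at h

theorem memLp_quantile {G : Measure ℝ} [IsProbabilityMeasure G]
    (hG : MemLp (fun x : ℝ => x) 2 G) : MemLp (quantile G) 2 unif := by
  have hm := aemeasurable_of_monotoneOn (quantile_monotoneOn G)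
  rw [← map_quantile G] at hG
  exact (memLp_map_measure_iff (continuous_id.aestronglyMeasurable) hm).1 hG

theorem integral_sub_sq {X Y : ℝ → ℝ} (hX : MemLp X 2 unif) (hY : MemLp Y 2 unif) :
    ∫ t, (X t - Y t) ^ 2 ∂unif =
      ∫ t, X t ^ 2 ∂unif + ∫ t, Y t ^ 2 ∂unif - 2 * ∫ t, X t * Y t ∂unif := by
  have h : ∀ t, (X t - Y t) ^ 2 = X t ^ 2 + Y t ^ 2 - 2 * (X t * Y t) := fun t => by ring
  simp_rw [h]
  rw [integral_sub (f := fun t => X t ^ 2 + Y t ^ 2) (hX.integrable_sq.add hY.integrable_sq)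
    ((integrable_mul_of_memLp hX hY).const_mul 2), integral_add hX.integrable_sq hY.integrable_sq,
    integral_const_mul]

theorem wasserstein_le_iff (F G : Measure ℝ) {ε : ℝ} (hε : 0 ≤ ε) :
    wasserstein G F ≤ √ε ↔ ∫ t, (quantile G t - quantile F t) ^ 2 ∂unif ≤ ε :=
  Real.sqrt_le_sqrt_iff hε

theorem quantile_of_mem_uncertaintySet {F G : Measure ℝ} {m s ε : ℝ} (hε : 0 ≤ ε)
    (hG : G ∈ uncertaintySet F m s ε) :
    MemLp (quantile G) 2 unif ∧ ∫ t, quantile G t ∂unif = m ∧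
      ∫ t, quantile G t ^ 2 ∂unif = m ^ 2 + s ^ 2 ∧
      ∫ t, (quantile G t - quantile F t) ^ 2 ∂unif ≤ ε := by
  obtain ⟨_, h2, h3, h4, h5⟩ := hG
  exact ⟨memLp_quantile h2, by rw [← h3, integral_comp_quantile G continuous_id'],
    by rw [← h4, integral_comp_quantile G (continuous_pow 2)],
    (wasserstein_le_iff F G hε).1 h5⟩

theorem map_mem_uncertaintySet {F : Measure ℝ} {q : ℝ → ℝ} {m s ε : ℝ} (hε : 0 ≤ ε)
    (hq : MonotoneOn q (Ioo 0 1)) (hq2 : MemLp q 2 unif) (hm : ∫ t, q t ∂unif = m)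
    (hs : ∫ t, q t ^ 2 ∂unif = m ^ 2 + s ^ 2)
    (hW : ∫ t, (q t - quantile F t) ^ 2 ∂unif ≤ ε) : unif.map q ∈ uncertaintySet F m s ε := by
  have hqm := aemeasurable_of_monotoneOn hq
  refine ⟨Measure.isProbabilityMeasure_map hqm,
    (memLp_map_measure_iff continuous_id.aestronglyMeasurable hqm).2 hq2, ?_, ?_, ?_⟩
  · rw [integral_map hqm continuous_id'.aestronglyMeasurable, hm]
  · rw [integral_map hqm (continuous_pow 2).aestronglyMeasurable, hs]
  · rw [wasserstein_le_iff F _ hε]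
    refine le_of_eq_of_le (integral_congr_ae ?_) hW
    filter_upwards [quantile_map_ae_eq hq] with t ht
    rw [ht]

/-! ### The integrated upper quantiles -/

/-- The integral of the quantile function of `F` over `[1 - t, 1]`. -/
noncomputable def tailIntegral (F : Measure ℝ) (t : ℝ) : ℝ := ∫ s in (1 - t)..1, quantile F s

theorem tailIntegral_eq (F : Measure ℝ) (u : ℝ) :
    tailIntegral F u = ∫ x in (0 : ℝ)..u, quantile F (1 - x) := by
  rw [intervalIntegral.integral_comp_sub_left (fun x => quantile F x) 1, sub_zero, tailIntegral]

/-- The value `φ y` separates the average of `φ` to the left of `y` from its average to the right.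
-/
theorem concaveOn_of_antitone_density {φ Φ : ℝ → ℝ} (hanti : AntitoneOn φ (Ioo 0 1))
    (hφ : Integrable φ unif) (hΦ : ∀ u ∈ Icc (0 : ℝ) 1, Φ u = ∫ x in (0 : ℝ)..u, φ x) :
    ConcaveOn ℝ (Icc 0 1) Φ := by
  have hi : IntervalIntegrable φ volume 0 1 := by
    rw [intervalIntegrable_iff_integrableOn_Ioo_of_le zero_le_one]; exact hφ
  have hsub : ∀ a ∈ Icc (0 : ℝ) 1, ∀ b ∈ Icc (0 : ℝ) 1, a ≤ b →
      IntervalIntegrable φ volume a b := fun a ha b hb hab => by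
    refine hi.mono_set ?_
    rw [uIcc_of_le hab, uIcc_of_le zero_le_one]
    exact Icc_subset_Icc ha.1 hb.2
  have hdiff : ∀ a ∈ Icc (0 : ℝ) 1, ∀ b ∈ Icc (0 : ℝ) 1, a ≤ b →
      Φ b - Φ a = ∫ x in a..b, φ x := fun a ha b hb hab => by
    rw [hΦ b hb, hΦ a ha, intervalIntegral.integral_interval_sub_left
      (hsub 0 (by simp) b hb hb.1) (hsub 0 (by simp) a ha ha.1)]
  refine concaveOn_of_slope_anti_adjacent (convex_Icc 0 1) fun {x y z} hx hz hxy hyz => ?_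
  have hy : y ∈ Ioo (0 : ℝ) 1 := ⟨hx.1.trans_lt hxy, hyz.trans_le hz.2⟩
  have hyI : y ∈ Icc (0 : ℝ) 1 := ⟨hy.1.le, hy.2.le⟩
  have h1 : φ y * (y - x) ≤ Φ y - Φ x := by
    rw [hdiff x hx y hyI hxy.le]
    have := intervalIntegral.integral_mono_on_of_le_Ioo hxy.le
      (intervalIntegrable_const (c := φ y)) (hsub x hx y hyI hxy.le)
      fun t ht => hanti ⟨hx.1.trans_lt ht.1, ht.2.trans hy.2⟩ hy ht.2.le
    rwa [intervalIntegral.integral_const, smul_eq_mul, mul_comm] at this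
  have h2 : Φ z - Φ y ≤ φ y * (z - y) := by
    rw [hdiff y hyI z hz hyz.le]
    have := intervalIntegral.integral_mono_on_of_le_Ioo hyz.le
      (hsub y hyI z hz hyz.le) (intervalIntegrable_const (c := φ y))
      fun t ht => hanti hy ⟨hy.1.trans ht.1, ht.2.trans_le hz.2⟩ ht.1.le
    rwa [intervalIntegral.integral_const, smul_eq_mul, mul_comm] at this
  have h3 : (Φ z - Φ y) / (z - y) ≤ φ y := by rwa [div_le_iff₀ (by linarith)]
  have h4 : φ y ≤ (Φ y - Φ x) / (y - x) := by rwa [le_div_iff₀ (by linarith)]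
  exact h3.trans h4

theorem quantile_one_sub_antitoneOn (F : Measure ℝ) :
    AntitoneOn (fun t => quantile F (1 - t)) (Ioo 0 1) := fun x hx y hy hxy =>
  quantile_monotoneOn F ⟨by linarith [hy.2], by linarith [hy.1]⟩
    ⟨by linarith [hx.2], by linarith [hx.1]⟩ (by linarith)

theorem integrable_quantile_one_sub {F : Measure ℝ} (hF : MemLp (quantile F) 2 unif) :
    Integrable (fun t => quantile F (1 - t)) unif :=
  (memLp_one_sub hF).integrable (by norm_num)

theorem tailIntegral_concaveOn {F : Measure ℝ} (hF : MemLp (quantile F) 2 unif) :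
    ConcaveOn ℝ (Icc 0 1) (tailIntegral F) :=
  concaveOn_of_antitone_density (quantile_one_sub_antitoneOn F) (integrable_quantile_one_sub hF)
    fun u _ => tailIntegral_eq F u

theorem tailIntegral_continuousOn {F : Measure ℝ} (hF : MemLp (quantile F) 2 unif) :
    ContinuousOn (tailIntegral F) (Icc 0 1) := by
  have h : IntegrableOn (fun x => quantile F (1 - x)) (uIcc 0 1) := by
    rw [uIcc_of_le zero_le_one, integrableOn_Icc_iff_integrableOn_Ioo]
    exact integrable_quantile_one_sub hF
  have := intervalIntegral.continuousOn_primitive_interval h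
  rw [uIcc_of_le zero_le_one] at this
  exact this.congr fun u _ => tailIntegral_eq F u

theorem tailIntegral_zero (F : Measure ℝ) : tailIntegral F 0 = 0 := by simp [tailIntegral]

theorem tailIntegral_one (F : Measure ℝ) : tailIntegral F 1 = ∫ t, quantile F t ∂unif := by
  rw [tailIntegral, sub_self, intervalIntegral.integral_of_le zero_le_one,
    integral_Ioc_eq_integral_Ioo, unif]

theorem isDistortion_tailIntegral {F : Measure ℝ} (hF : MemLp (quantile F) 2 unif) :
    IsDistortion (tailIntegral F) :=
  isDistortion_of_concaveOn (tailIntegral_concaveOn hF) (tailIntegral_continuousOn hF)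
    (tailIntegral_zero F)

/-! ### Combinations of a distortion function with the integrated upper quantiles -/

/-- The combination `a * g + b * tailIntegral F`. -/
noncomputable def blend (g : ℝ → ℝ) (F : Measure ℝ) (a b t : ℝ) : ℝ :=
  a * g t + b * tailIntegral F t

theorem tilt_eq_blend (g : ℝ → ℝ) (F : Measure ℝ) (l : ℝ) : tilt g F l = blend g F 1 l := by
  ext t
  simp [tilt, blend, tailIntegral]

theorem IsDistortion.blend {g : ℝ → ℝ} (hg : IsDistortion g) {F : Measure ℝ}
    (hF : MemLp (quantile F) 2 unif) (a b : ℝ) : IsDistortion (blend g F a b) :=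
  (hg.const_mul a).add ((isDistortion_tailIntegral hF).const_mul b)

theorem IsDistortion.concaveEnvelope_blend_le {g : ℝ → ℝ} (hg : IsDistortion g) {F : Measure ℝ}
    (hF : MemLp (quantile F) 2 unif) {a b u : ℝ} (ha : 0 ≤ a) (hb : 0 ≤ b)
    (hu : u ∈ Icc (0 : ℝ) 1) : concaveEnvelope (DistortionRisk.blend g F a b) u ≤
      a * concaveEnvelope g u + b * tailIntegral F u := by
  refine (hg.blend hF a b).concaveEnvelope_le
    ((hg.concaveEnvelope_concaveOn.smul ha).add ((tailIntegral_concaveOn hF).smul hb))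
    (fun t ht => ?_) hu
  exact add_le_add_left (mul_le_mul_of_nonneg_left (hg.le_concaveEnvelope ht) ha) _

theorem integral_lincomb {φ ψ : ℝ → ℝ} (hφ : Integrable φ unif) (hψ : Integrable ψ unif)
    {u : ℝ} (hu : u ∈ Icc (0 : ℝ) 1) (a b : ℝ) :
    ∫ x in (0 : ℝ)..u, (a * φ x + b * ψ x) =
      a * (∫ x in (0 : ℝ)..u, φ x) + b * ∫ x in (0 : ℝ)..u, ψ x := by
  have h : ∀ {f : ℝ → ℝ}, Integrable f unif → IntervalIntegrable f volume 0 u := fun {f} hf => by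
    rw [intervalIntegrable_iff_integrableOn_Ioo_of_le hu.1]
    exact IntegrableOn.mono_set (t := Ioo 0 1) hf (Ioo_subset_Ioo_right hu.2)
  rw [intervalIntegral.integral_add ((h hφ).const_mul a) ((h hψ).const_mul b),
    intervalIntegral.integral_const_mul, intervalIntegral.integral_const_mul]

/-- The envelope of the blend lies below `a g^* + b K`, with equality at `1`, and the latter has a
square-integrable density; the `L²` comparison applies. -/
theorem IsDistortion.memLp_envDeriv_blend {g : ℝ → ℝ} (hg : IsDistortion g) {F : Measure ℝ}
    (hF : MemLp (quantile F) 2 unif) (hA : MemLp (envDeriv g) 2 unif) {a b : ℝ} (ha : 0 ≤ a)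
    (hb : 0 ≤ b) : MemLp (envDeriv (DistortionRisk.blend g F a b)) 2 unif := by
  have hbl := hg.blend hF a b
  refine (memLp_and_integral_sq_le_of_primitive_le
    (φ₂ := fun t => a * envDeriv g t + b * quantile F (1 - t))
    (Φ₂ := fun u => a * concaveEnvelope g u + b * tailIntegral F u)
    hbl.envDeriv_antitoneOn hbl.integrable_envDeriv
    ((hA.const_mul a).add ((memLp_one_sub hF).const_mul b))
    (fun u hu => hbl.concaveEnvelope_eq_integral hu) (fun u hu => ?_)
    (fun u hu => hg.concaveEnvelope_blend_le hF ha hb hu) ?_).1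
  · rw [integral_lincomb hg.integrable_envDeriv (integrable_quantile_one_sub hF) hu,
      hg.concaveEnvelope_eq_integral hu, tailIntegral_eq]
  · rw [hbl.concaveEnvelope_one, hg.concaveEnvelope_one, DistortionRisk.blend]

theorem IsDistortion.tilt {g : ℝ → ℝ} (hg : IsDistortion g) {F : Measure ℝ}
    (hF : MemLp (quantile F) 2 unif) (l : ℝ) : IsDistortion (tilt g F l) :=
  tilt_eq_blend g F l ▸ hg.blend hF 1 l

theorem IsDistortion.memLp_envDeriv_tilt {g : ℝ → ℝ} (hg : IsDistortion g) {F : Measure ℝ}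
    (hF : MemLp (quantile F) 2 unif) (hA : MemLp (envDeriv g) 2 unif) {l : ℝ} (hl : 0 ≤ l) :
    MemLp (envDeriv (DistortionRisk.tilt g F l)) 2 unif :=
  tilt_eq_blend g F l ▸ hg.memLp_envDeriv_blend hF hA zero_le_one hl

/-! ### The dual bound -/

theorem IsDistortion.uscVersion_tilt {g : ℝ → ℝ} (hg : IsDistortion g) {F : Measure ℝ}
    (hF : MemLp (quantile F) 2 unif) (l u : ℝ) :
    uscVersion (DistortionRisk.tilt g F l) u = uscVersion g u + l * tailIntegral F u :=
  hg.uscVersion_add (κ := fun u => l * tailIntegral F u)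
    (continuousOn_const.mul (tailIntegral_continuousOn hF))

/-- The value of the concave relaxation of `uscVersion g`. -/
theorem IsDistortion.rho_relaxation {g q : ℝ → ℝ} (hg : IsDistortion g) {F : Measure ℝ}
    (hF : MemLp (quantile F) 2 unif) (hA : MemLp (envDeriv g) 2 unif) {l : ℝ} (hl : 0 ≤ l)
    (hq : MonotoneOn q (Ioo 0 1)) (hq2 : MemLp q 2 unif) :
    rho (fun u => concaveEnvelope (DistortionRisk.tilt g F l) u - l * tailIntegral F u)
      (unif.map q) = ((∫ t, envDeriv (DistortionRisk.tilt g F l) (1 - t) * q t ∂unif -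
        l * ∫ t, quantile F t * q t ∂unif : ℝ) : EReal) := by
  have ht := hg.tilt hF l
  have hφ2 := memLp_one_sub (hg.memLp_envDeriv_tilt hF hA hl)
  have i1 := integrable_mul_of_memLp hφ2 hq2
  have i2 := integrable_mul_of_memLp hF hq2
  obtain ⟨hi, he⟩ := integrable_rhoIntegrand_and_integral_eq hq
    (φ := fun t => 1 * envDeriv (DistortionRisk.tilt g F l) t + (-l) * quantile F (1 - t))
    (Φ := fun u => concaveEnvelope (DistortionRisk.tilt g F l) u - l * tailIntegral F u)
    ((ht.integrable_envDeriv.const_mul 1).add ((integrable_quantile_one_sub hF).const_mul (-l)))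
    (by
      refine (i1.sub (i2.const_mul l)).congr (ae_of_all _ fun t => ?_)
      simp only [Pi.sub_apply, sub_sub_cancel]
      ring)
    (fun u hu => by
      rw [integral_lincomb ht.integrable_envDeriv (integrable_quantile_one_sub hF) hu,
        ht.concaveEnvelope_eq_integral hu, tailIntegral_eq]
      ring)
  rw [rho_eq_integral hi, he, ← integral_const_mul, ← integral_sub i1 (i2.const_mul l)]
  congr 1
  refine integral_congr_ae (ae_of_all _ fun t => ?_)
  simp only [sub_sub_cancel]
  ring

/-- Weak duality. Continuity of `K` lets it pass through the upper semicontinuous version, so `ĝ` is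
the version of `g_l` minus `l K`, hence at most `g_l^* - l K`, with equality at `1`. -/
theorem IsDistortion.rho_uscVersion_map_le {g q : ℝ → ℝ} (hg : IsDistortion g) {F : Measure ℝ}
    (hF : MemLp (quantile F) 2 unif) (hA : MemLp (envDeriv g) 2 unif) {l : ℝ} (hl : 0 ≤ l)
    (hq : MonotoneOn q (Ioo 0 1)) (hq2 : MemLp q 2 unif) :
    rho (uscVersion g) (unif.map q) ≤
      ((∫ t, envDeriv (DistortionRisk.tilt g F l) (1 - t) * q t ∂unif -
        l * ∫ t, quantile F t * q t ∂unif : ℝ) : EReal) := by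
  have ht := hg.tilt hF l
  rw [← hg.rho_relaxation hF hA hl hq hq2]
  refine rho_mono (fun u hu => ?_) ?_ _
  · have := ht.uscVersion_le_of_continuousOn ht.concaveEnvelope_continuousOn
      (fun t => ht.le_concaveEnvelope) hu
    rw [hg.uscVersion_tilt hF] at this
    linarith
  · rw [ht.concaveEnvelope_one, uscVersion_one]
    simp [DistortionRisk.tilt, tailIntegral]

/-- No duality gap when `q` is a function of the envelope derivative: the survival function then
visits only levels at which the relaxation touches `ĝ`. -/
theorem IsDistortion.rho_uscVersion_map_eq {g q : ℝ → ℝ} (hg : IsDistortion g) {F : Measure ℝ}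
    (hF : MemLp (quantile F) 2 unif) (hA : MemLp (envDeriv g) 2 unif) {l : ℝ} (hl : 0 ≤ l)
    (hq : MonotoneOn q (Ioo 0 1)) (hq2 : MemLp q 2 unif) (ψ : ℝ → ℝ)
    (hqψ : ∀ t, q t = ψ (envDeriv (DistortionRisk.tilt g F l) (1 - t))) :
    rho (uscVersion g) (unif.map q) =
      ((∫ t, envDeriv (DistortionRisk.tilt g F l) (1 - t) * q t ∂unif -
        l * ∫ t, quantile F t * q t ∂unif : ℝ) : EReal) := by
  have ht := hg.tilt hF l
  rw [← hg.rho_relaxation hF hA hl hq hq2, rho_eq_extIntegral, rho_eq_extIntegral]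
  have : rhoIntegrand (uscVersion g) (unif.map q) = rhoIntegrand
      (fun u => concaveEnvelope (DistortionRisk.tilt g F l) u - l * tailIntegral F u)
      (unif.map q) := by
    ext x
    unfold rhoIntegrand
    beta_reduce
    rw [← ht.uscVersion_eq_concaveEnvelope_of_map hq ψ hqψ x, hg.uscVersion_tilt hF,
      ht.concaveEnvelope_one, uscVersion_one]
    simp [DistortionRisk.tilt, tailIntegral]
  rw [this]

/-! ### The extremal quantile function -/

/-- Zero variance gives constancy only almost everywhere. Integrating makes the envelope linear, and
its right derivative is then constant at every point of `(0,1)`. -/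
theorem IsDistortion.variance_envDeriv_pos {f : ℝ → ℝ} (hf : IsDistortion f)
    (h2 : MemLp (envDeriv f) 2 unif) (hnc : ¬ EnvDerivConst f) : 0 < Var[envDeriv f; unif] := by
  refine (variance_nonneg _ _).lt_of_ne fun h0 => hnc ⟨f 1, fun t ht => ?_⟩
  have hae := ae_eq_integral_of_variance_eq_zero h2 h0.symm
  rw [hf.integral_envDeriv] at hae
  have hE : ∀ u ∈ Icc (0 : ℝ) 1, concaveEnvelope f u = f 1 * u := fun u hu => by
    rw [hf.concaveEnvelope_eq_integral hu, intervalIntegral.integral_of_le hu.1,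
      integral_Ioc_eq_integral_Ioo]
    have h1 : ∀ᵐ x ∂volume.restrict (Ioo 0 u), envDeriv f x = f 1 :=
      ae_restrict_of_ae_restrict_of_subset (Ioo_subset_Ioo_right hu.2) hae
    rw [integral_congr_ae h1]
    simp [hu.1, mul_comm]
  refine envDeriv_eq_of_eventuallyEq (φ := fun u => f 1 * u) ?_ ?_
  · filter_upwards [Icc_mem_nhds ht.1 ht.2] with u hu using hE u hu
  · simpa using (hasDerivAt_id t).const_mul (f 1)

theorem hQuantile_monotoneOn {g : ℝ → ℝ} {F : Measure ℝ} {m s l : ℝ} (hs : 0 ≤ s)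
    (ht : IsDistortion (tilt g F l)) : MonotoneOn (hQuantile g F m s l) (Ioo 0 1) := by
  intro x hx y hy hxy
  unfold hQuantile
  have := monotoneOn_one_sub ht.envDeriv_antitoneOn hx hy hxy
  gcongr

theorem memLp_hQuantile {g : ℝ → ℝ} {F : Measure ℝ} {m s l : ℝ}
    (h2 : MemLp (envDeriv (tilt g F l)) 2 unif) : MemLp (hQuantile g F m s l) 2 unif := by
  have h := ((((memLp_one_sub h2).sub (memLp_const (∫ v, envDeriv (tilt g F l) v ∂unif))).const_mul
    (√(Var[envDeriv (tilt g F l); unif]))⁻¹).const_mul s).add (memLp_const m)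
  refine h.ae_eq (ae_of_all _ fun t => ?_)
  simp only [Pi.add_apply, Pi.sub_apply, hQuantile]
  ring

theorem integral_centered_mul {φ Y : ℝ → ℝ} (hφ : MemLp φ 2 unif) (hY : MemLp Y 2 unif) (m k a : ℝ) :
    ∫ t, Y t * (m + k * (φ t - a)) ∂unif =
      (m - k * a) * ∫ t, Y t ∂unif + k * ∫ t, φ t * Y t ∂unif := by
  have h : ∀ t, Y t * (m + k * (φ t - a)) = (m - k * a) * Y t + k * (φ t * Y t) := fun t => by ring
  simp_rw [h]
  rw [integral_add ((hY.integrable (by norm_num)).const_mul _)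
    ((integrable_mul_of_memLp hφ hY).const_mul k), integral_const_mul, integral_const_mul]

theorem integral_one_sub_sq (φ : ℝ → ℝ) :
    ∫ t, φ (1 - t) * φ (1 - t) ∂unif = ∫ t, φ t ^ 2 ∂unif := by
  rw [integral_one_sub (fun t => φ t * φ t)]
  simp_rw [sq]

theorem variance_eq_integral_sq_sub {X : ℝ → ℝ} (hX : MemLp X 2 unif) :
    Var[X; unif] = ∫ t, X t ^ 2 ∂unif - (∫ t, X t ∂unif) ^ 2 := by
  rw [variance_eq_sub hX]; rfl

/-- The extremal quantile `m + k * (φ (1 - t) - a)` with `k = s / b`. -/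
theorem extremal_moments {φ : ℝ → ℝ} (hφ : MemLp φ 2 unif) (hv : 0 < Var[φ; unif]) (m s : ℝ)
    {h : ℝ → ℝ} (hh : ∀ t, h t = m + s / √(Var[φ; unif]) * (φ (1 - t) - ∫ v, φ v ∂unif)) :
    ∫ t, h t ∂unif = m ∧ ∫ t, h t ^ 2 ∂unif = m ^ 2 + s ^ 2 ∧
      ∫ t, φ (1 - t) * h t ∂unif = m * ∫ v, φ v ∂unif + s * √(Var[φ; unif]) := by
  obtain rfl : h = fun t => m + s / √(Var[φ; unif]) * (φ (1 - t) - ∫ v, φ v ∂unif) := funext hh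
  have hφ' := memLp_one_sub hφ
  set a := ∫ v, φ v ∂unif with ha
  set k := s / √(Var[φ; unif]) with hk
  have hb : 0 < √(Var[φ; unif]) := Real.sqrt_pos.2 hv
  have hkb : k * √(Var[φ; unif]) = s := div_mul_cancel₀ _ hb.ne'
  have hb2 : √(Var[φ; unif]) ^ 2 = ∫ t, φ t ^ 2 ∂unif - a ^ 2 := by
    rw [Real.sq_sqrt hv.le, variance_eq_integral_sq_sub hφ]
  set b := √(Var[φ; unif])
  have ea : ∫ t, φ (1 - t) ∂unif = a := integral_one_sub φ
  have hh2 : MemLp (fun t => m + k * (φ (1 - t) - a)) 2 unif :=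
    (memLp_const m).add ((hφ'.sub (memLp_const a)).const_mul k)
  have e1 : ∫ t, (m + k * (φ (1 - t) - a)) ∂unif = m := by
    have := integral_centered_mul hφ' (memLp_const (1 : ℝ)) m k a
    simp only [one_mul, mul_one, ea] at this
    rw [this]; simp
  have e2 : ∫ t, φ (1 - t) * (m + k * (φ (1 - t) - a)) ∂unif = m * a + s * b := by
    rw [integral_centered_mul hφ' hφ' m k a, ea, integral_one_sub_sq]
    have : ∫ t, φ t ^ 2 ∂unif = b ^ 2 + a ^ 2 := by linarith
    rw [this, ← hkb]; ring
  refine ⟨e1, ?_, e2⟩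
  have h3 : ∀ t, (m + k * (φ (1 - t) - a)) ^ 2 =
    (m + k * (φ (1 - t) - a)) * (m + k * (φ (1 - t) - a)) := fun t => sq _
  simp_rw [h3]
  rw [integral_centered_mul hφ' hh2 m k a, e1, e2]
  linear_combination s * hkb

/-- Cauchy–Schwarz in the form `0 ≤ ∫ (q - h)²`, where `h` is the extremal quantile with the same
first two moments as `q`. -/
theorem integral_mul_le_of_moments {φ q : ℝ → ℝ} (hφ : MemLp φ 2 unif) (hv : 0 < Var[φ; unif])
    {m s : ℝ} (hs : 0 < s) (hq : MemLp q 2 unif) (hq1 : ∫ t, q t ∂unif = m)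
    (hq2 : ∫ t, q t ^ 2 ∂unif = m ^ 2 + s ^ 2) :
    ∫ t, φ (1 - t) * q t ∂unif ≤ m * ∫ v, φ v ∂unif + s * √(Var[φ; unif]) := by
  have hφ' := memLp_one_sub hφ
  set a := ∫ v, φ v ∂unif with ha
  obtain ⟨-, e2, -⟩ := extremal_moments hφ hv m s (fun t => rfl)
  set k := s / √(Var[φ; unif]) with hk
  have hb : 0 < √(Var[φ; unif]) := Real.sqrt_pos.2 hv
  have hk0 : 0 < k := div_pos hs hb
  have hh2 : MemLp (fun t => m + k * (φ (1 - t) - a)) 2 unif :=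
    (memLp_const m).add ((hφ'.sub (memLp_const a)).const_mul k)
  have h0 : 0 ≤ ∫ t, (q t - (m + k * (φ (1 - t) - a))) ^ 2 ∂unif :=
    integral_nonneg fun t => sq_nonneg _
  rw [integral_sub_sq hq hh2, hq2, e2, integral_centered_mul hφ' hq m k a, hq1] at h0
  have hkb : k * √(Var[φ; unif]) = s := div_mul_cancel₀ _ hb.ne'
  set b := √(Var[φ; unif])
  refine le_of_mul_le_mul_left ?_ hk0
  have : k * (m * a + s * b) = k * m * a + s ^ 2 := by linear_combination s * hkb
  rw [this]
  linarith

theorem hQuantile_eq (g : ℝ → ℝ) (F : Measure ℝ) (m s l t : ℝ) :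
    hQuantile g F m s l t = m + s / √(Var[envDeriv (tilt g F l); unif]) *
      (envDeriv (tilt g F l) (1 - t) - ∫ v, envDeriv (tilt g F l) v ∂unif) := by
  unfold hQuantile; ring

/-- A law `H_l` in the uncertainty set is optimal for `uscVersion g` if `l = 0` or if it lies at
the boundary of the Wasserstein ball. -/
theorem IsDistortion.worstCase_uscVersion_eq {g : ℝ → ℝ} (hg : IsDistortion g) {F : Measure ℝ}
    (hF : MemLp (quantile F) 2 unif) (hA : MemLp (envDeriv g) 2 unif) {m s ε l : ℝ} (hs : 0 < s)
    (hε : 0 ≤ ε) (hl : 0 ≤ l) (hnc : ¬ EnvDerivConst (DistortionRisk.tilt g F l))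
    (hW : ∫ t, (hQuantile g F m s l t - quantile F t) ^ 2 ∂unif ≤ ε)
    (hl' : l = 0 ∨ ∫ t, (hQuantile g F m s l t - quantile F t) ^ 2 ∂unif = ε) :
    worstCase (uscVersion g) F m s ε = rho (uscVersion g) (hLaw g F m s l) := by
  have ht := hg.tilt hF l
  have hφ := hg.memLp_envDeriv_tilt hF hA hl
  have hv := ht.variance_envDeriv_pos hφ hnc
  obtain ⟨e1, e2, e3⟩ := extremal_moments hφ hv m s (hQuantile_eq g F m s l)
  have hmono := hQuantile_monotoneOn (g := g) (F := F) (m := m) hs.le ht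
  have hh2 : MemLp (hQuantile g F m s l) 2 unif := memLp_hQuantile hφ
  have hrho : rho (uscVersion g) (hLaw g F m s l) = _ :=
    hg.rho_uscVersion_map_eq hF hA hl hmono hh2 (fun y => m + s * ((y -
      ∫ v, envDeriv (DistortionRisk.tilt g F l) v ∂unif) /
      √(Var[envDeriv (DistortionRisk.tilt g F l); unif]))) (fun t => rfl)
  refine le_antisymm (iSup₂_le fun G hG => ?_) ?_
  · obtain ⟨q1, q2, q3, q4⟩ := quantile_of_mem_uncertaintySet hε hG
    have := hG.1
    have hle := hg.rho_uscVersion_map_le hF hA hl (quantile_monotoneOn G) q1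
    rw [map_quantile] at hle
    refine hle.trans ?_
    rw [hrho, EReal.coe_le_coe_iff, e3]
    have hb := integral_mul_le_of_moments hφ hv hs q1 q2 q3
    -- Complementary slackness. The quantile of `G` and `h_l` have equal second moments, so being no
    -- farther from `F⁻¹` than `h_l` means having at least as large an inner product with it.
    have hcov : l * ∫ t, quantile F t * hQuantile g F m s l t ∂unif ≤
        l * ∫ t, quantile F t * quantile G t ∂unif := by
      rcases hl' with h0 | h0
      · simp [h0]
      · refine mul_le_mul_of_nonneg_left ?_ hl
        rw [← h0, integral_sub_sq q1 hF, integral_sub_sq hh2 hF, q3, e2] at q4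
        simp_rw [mul_comm (quantile F _)]
        linarith
    linarith
  · exact le_iSup₂_of_le _ (map_mem_uncertaintySet hε hmono hh2 e1 e2 hW) le_rfl

/-! ### Wasserstein distance to `F` in terms of moments and covariance -/

theorem mean_eq_integral_quantile (F : Measure ℝ) [IsProbabilityMeasure F] :
    mean F = ∫ t, quantile F t ∂unif := integral_comp_quantile F continuous_id'

theorem stdDev_eq_sqrt_variance_quantile {F : Measure ℝ} [IsProbabilityMeasure F]
    (hF : MemLp (fun x : ℝ => x) 2 F) : stdDev F = √(Var[quantile F; unif]) := by
  have h1 : Var[fun x : ℝ => x; F] = (∫ x, x ^ 2 ∂F) - (∫ x, x ∂F) ^ 2 := variance_eq_sub hF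
  rw [stdDev, variance_eq_integral_sq_sub (memLp_quantile hF), h1,
    integral_comp_quantile F (continuous_pow 2), integral_comp_quantile F continuous_id']

theorem integral_quantile_sq {F : Measure ℝ} [IsProbabilityMeasure F]
    (hF : MemLp (fun x : ℝ => x) 2 F) :
    ∫ t, quantile F t ^ 2 ∂unif = mean F ^ 2 + stdDev F ^ 2 := by
  rw [stdDev_eq_sqrt_variance_quantile hF, Real.sq_sqrt (variance_nonneg _ _),
    variance_eq_integral_sq_sub (memLp_quantile hF), mean_eq_integral_quantile]
  ring

theorem covariance_unif_eq {X Y : ℝ → ℝ} (hX : MemLp X 2 unif) (hY : MemLp Y 2 unif) :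
    cov[X, Y; unif] = ∫ t, X t * Y t ∂unif - (∫ t, X t ∂unif) * ∫ t, Y t ∂unif := by
  rw [covariance_eq_sub hX hY]; rfl

/-- Only the normalized covariance depends on `l`; finding an `H_l` on the boundary of the ball thus
becomes one scalar equation. -/
theorem integral_hQuantile_sub_sq {g : ℝ → ℝ} (hg : IsDistortion g) {F : Measure ℝ}
    [IsProbabilityMeasure F] (hF : MemLp (fun x : ℝ => x) 2 F) (hA : MemLp (envDeriv g) 2 unif)
    {m s l : ℝ} (hl : 0 ≤ l) (hnc : ¬ EnvDerivConst (tilt g F l)) :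
    ∫ t, (hQuantile g F m s l t - quantile F t) ^ 2 ∂unif =
      (mean F - m) ^ 2 + (stdDev F - s) ^ 2 + 2 * stdDev F * s -
        2 * s * (cov[quantile F, fun t => envDeriv (tilt g F l) (1 - t); unif] /
          √(Var[envDeriv (tilt g F l); unif])) := by
  have hF' := memLp_quantile hF
  have hφ := hg.memLp_envDeriv_tilt hF' hA hl
  have hv := (hg.tilt hF' l).variance_envDeriv_pos hφ hnc
  obtain ⟨e1, e2, e3⟩ := extremal_moments hφ hv m s (hQuantile_eq g F m s l)
  rw [integral_sub_sq (memLp_hQuantile hφ) hF', e2, integral_quantile_sq hF]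
  simp_rw [mul_comm (hQuantile g F m s l _), hQuantile_eq]
  rw [integral_centered_mul (memLp_one_sub hφ) hF', covariance_unif_eq hF' (memLp_one_sub hφ),
    integral_one_sub, ← mean_eq_integral_quantile]
  simp_rw [mul_comm (quantile F _)]
  ring

theorem wasserstein_map_eq_sqrt_iff {F : Measure ℝ} {q : ℝ → ℝ} (hq : MonotoneOn q (Ioo 0 1))
    {ε : ℝ} (hε : 0 ≤ ε) :
    wasserstein F (unif.map q) = √ε ↔ ∫ t, (q t - quantile F t) ^ 2 ∂unif = ε := by
  have h : ∫ t in Ioo (0 : ℝ) 1, (quantile F t - quantile (unif.map q) t) ^ 2 =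
      ∫ t, (q t - quantile F t) ^ 2 ∂unif := by
    refine integral_congr_ae ?_
    filter_upwards [quantile_map_ae_eq hq] with t ht
    rw [ht]; ring
  rw [wasserstein, h]
  exact Real.sqrt_inj (integral_nonneg fun t => sq_nonneg _) hε

/-! ### Continuity along the segment from `g` to the integrated upper quantiles -/

theorem integral_mul_sq_le {X Y : ℝ → ℝ} (hX : MemLp X 2 unif) (hY : MemLp Y 2 unif) :
    (∫ t, X t * Y t ∂unif) ^ 2 ≤ (∫ t, X t ^ 2 ∂unif) * ∫ t, Y t ^ 2 ∂unif := by
  have h : ∀ c : ℝ, 0 ≤ (∫ t, Y t ^ 2 ∂unif) * (c * c) + (-2 * ∫ t, X t * Y t ∂unif) * c +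
      ∫ t, X t ^ 2 ∂unif := fun c => by
    have h0 : 0 ≤ ∫ t, (X t - c * Y t) ^ 2 ∂unif := integral_nonneg fun t => sq_nonneg _
    rw [integral_sub_sq hX (hY.const_mul c)] at h0
    have e1 : ∀ t, (c * Y t) ^ 2 = c * c * Y t ^ 2 := fun t => by ring
    have e2 : ∀ t, X t * (c * Y t) = c * (X t * Y t) := fun t => by ring
    simp_rw [e1, e2, integral_const_mul] at h0
    linarith
  have := discrim_le_zero h
  rw [discrim] at this
  linarith

theorem tendsto_integral_sub_clip_sq {X : ℝ → ℝ} (hX : MemLp X 2 unif) :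
    Tendsto (fun n : ℕ => ∫ t, (X t - clip n (X t)) ^ 2 ∂unif) atTop (𝓝 0) := by
  have h0 : (0 : ℝ) = ∫ t, (0 : ℝ) ∂unif := by simp
  rw [h0]
  refine tendsto_integral_of_dominated_convergence (fun t => X t ^ 2) (fun n => ?_)
    hX.integrable_sq (fun n => ae_of_all _ fun t => ?_) (ae_of_all _ fun t => ?_)
  · exact (hX.1.sub ((continuous_clip n).comp_aestronglyMeasurable hX.1)).pow 2
  · rw [Real.norm_eq_abs, abs_pow, ← sq_abs (X t)]
    exact pow_le_pow_left₀ (abs_nonneg _) (abs_sub_clip_le n.cast_nonneg _) 2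
  · refine tendsto_const_nhds.congr' ?_
    obtain ⟨N, hN⟩ := exists_nat_ge |X t|
    filter_upwards [eventually_ge_atTop N] with n hn
    rw [clip_of_abs_le (hN.trans (Nat.cast_le.2 hn))]
    simp

theorem cdf_map_eq_one {q : ℝ → ℝ} (hq : MonotoneOn q (Ioo 0 1)) {N x : ℝ}
    (hN : ∀ t, q t ≤ N) (hx : N ≤ x) : cdf (unif.map q) x = 1 := by
  refine le_antisymm (cdf_le_one _ _) (not_lt.1 fun h => ?_)
  obtain ⟨t, h1, h2⟩ := exists_between h
  exact absurd (lt_of_cdf_map_lt hq ⟨(cdf_nonneg _ _).trans_lt h1, h2⟩ h1)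
    (not_lt.2 ((hN t).trans hx))

theorem cdf_map_eq_zero {q : ℝ → ℝ} (hq : MonotoneOn q (Ioo 0 1)) {N x : ℝ}
    (hN : ∀ t, N ≤ q t) (hx : x < N) : cdf (unif.map q) x = 0 := by
  refine le_antisymm (not_lt.1 fun h => ?_) (cdf_nonneg _ _)
  obtain ⟨t, h1, h2⟩ := exists_between h
  exact absurd (le_of_lt_cdf_map hq ⟨h1, h2.trans_le (cdf_le_one _ _)⟩ h2)
    (not_le.2 (hx.trans_le (hN t)))

/-- Uniformly close primitives give close integrals against bounded monotone functions. -/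
theorem abs_integral_sub_le_of_primitive {q φ₁ φ₂ Φ₁ Φ₂ : ℝ → ℝ} (hq : MonotoneOn q (Ioo 0 1))
    {N δ : ℝ} (hN0 : 0 ≤ N) (hN : ∀ t, |q t| ≤ N) (hφ₁ : Integrable φ₁ unif)
    (hΦ₁ : ∀ u ∈ Icc (0 : ℝ) 1, Φ₁ u = ∫ x in (0 : ℝ)..u, φ₁ x) (hφ₂ : Integrable φ₂ unif)
    (hΦ₂ : ∀ u ∈ Icc (0 : ℝ) 1, Φ₂ u = ∫ x in (0 : ℝ)..u, φ₂ x)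
    (hδ : ∀ u ∈ Icc (0 : ℝ) 1, |Φ₁ u - Φ₂ u| ≤ δ) :
    |∫ t, φ₁ (1 - t) * q t ∂unif - ∫ t, φ₂ (1 - t) * q t ∂unif| ≤ 4 * N * δ := by
  have hqm := (aemeasurable_of_monotoneOn hq).aestronglyMeasurable
  have hi : ∀ {φ : ℝ → ℝ}, Integrable φ unif → Integrable (fun t => φ (1 - t) * q t) unif :=
    fun {φ} hφ => (measurePreserving_one_sub.integrable_comp_of_integrable hφ).mul_bdd (c := N)
      hqm (ae_of_all _ hN)
  obtain ⟨i1, e1⟩ := integrable_rhoIntegrand_and_integral_eq hq hφ₁ (hi hφ₁) hΦ₁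
  obtain ⟨i2, e2⟩ := integrable_rhoIntegrand_and_integral_eq hq hφ₂ (hi hφ₂) hΦ₂
  rw [← e1, ← e2, ← integral_sub i1 i2]
  have hδ0 : 0 ≤ δ := (abs_nonneg _).trans (hδ 0 (by simp))
  -- Outside `[-N, N]` the distribution function is `0` or `1` and the integrands coincide. Inside,
  -- the values at the survival level and at `1` each contribute at most `δ`.
  have hbound : ∀ x, ‖rhoIntegrand Φ₁ (unif.map q) x - rhoIntegrand Φ₂ (unif.map q) x‖ ≤
      (Icc (-N) N).indicator (fun _ => 2 * δ) x := fun x => by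
    have hz1 : Φ₁ 0 = Φ₂ 0 := by rw [hΦ₁ 0 (by simp), hΦ₂ 0 (by simp)]; simp
    by_cases hx : x ∈ Icc (-N) N
    · rw [indicator_of_mem hx, Real.norm_eq_abs]
      unfold rhoIntegrand
      have h1 := abs_le.1 (hδ _ (one_sub_cdf_mem (unif.map q) x))
      have h2 := abs_le.1 (hδ 1 (by simp))
      split_ifs <;> rw [abs_le] <;> constructor <;> linarith [h1.1, h1.2, h2.1, h2.2]
    · rw [indicator_of_notMem hx, norm_le_zero_iff]
      unfold rhoIntegrand
      rcases lt_or_ge x (-N) with h | h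
      · rw [cdf_map_eq_zero hq (fun t => (abs_le.1 (hN t)).1) h, if_pos (by linarith),
          if_pos (by linarith)]
        simp
      · have h' : N < x := not_le.1 fun h' => hx ⟨h, h'⟩
        rw [cdf_map_eq_one hq (fun t => (abs_le.1 (hN t)).2) h'.le, if_neg (by linarith),
          if_neg (by linarith)]
        simp [hz1]
  refine (norm_integral_le_of_norm_le ((integrable_indicator_iff measurableSet_Icc).2
    (integrableOn_const (by simp))) (ae_of_all _ hbound)).trans_eq ?_
  rw [integral_indicator measurableSet_Icc, setIntegral_const, smul_eq_mul]
  have : volume.real (Icc (-N) N) = 2 * N := by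
    simp only [Real.volume_real_Icc]; rw [max_eq_left (by linarith)]; ring
  rw [this]; ring

/-- The combination of the two envelopes is a concave majorant of `f` agreeing with it at `1`; the
`L²` comparison and convexity of the square finish. -/
theorem IsDistortion.integral_envDeriv_sq_combination_le {f f₁ f₂ : ℝ → ℝ} (hf : IsDistortion f)
    (hf₁ : IsDistortion f₁) (hf₂ : IsDistortion f₂) (h₁ : MemLp (envDeriv f₁) 2 unif)
    (h₂ : MemLp (envDeriv f₂) 2 unif) {a b : ℝ} (ha : 0 ≤ a) (hb : 0 ≤ b) (hab : a + b = 1)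
    (hfab : ∀ t ∈ Icc (0 : ℝ) 1, f t = a * f₁ t + b * f₂ t) :
    ∫ t, envDeriv f t ^ 2 ∂unif ≤
      a * ∫ t, envDeriv f₁ t ^ 2 ∂unif + b * ∫ t, envDeriv f₂ t ^ 2 ∂unif := by
  have hm : MemLp (fun t => a * envDeriv f₁ t + b * envDeriv f₂ t) 2 unif :=
    (h₁.const_mul a).add (h₂.const_mul b)
  have h := (memLp_and_integral_sq_le_of_primitive_le
    (Φ₂ := fun u => a * concaveEnvelope f₁ u + b * concaveEnvelope f₂ u)
    hf.envDeriv_antitoneOn hf.integrable_envDeriv hm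
    (fun u hu => hf.concaveEnvelope_eq_integral hu) (fun u hu => ?_) (fun u hu => ?_) ?_).2
  · refine h.trans ?_
    rw [← integral_const_mul, ← integral_const_mul,
      ← integral_add (h₁.integrable_sq.const_mul a) (h₂.integrable_sq.const_mul b)]
    refine integral_mono hm.integrable_sq
      ((h₁.integrable_sq.const_mul a).add (h₂.integrable_sq.const_mul b)) fun t => ?_
    obtain rfl : b = 1 - a := by linarith
    nlinarith [mul_nonneg (mul_nonneg ha hb) (sq_nonneg (envDeriv f₁ t - envDeriv f₂ t))]
  · rw [integral_lincomb hf₁.integrable_envDeriv hf₂.integrable_envDeriv hu,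
      hf₁.concaveEnvelope_eq_integral hu, hf₂.concaveEnvelope_eq_integral hu]
  · refine hf.concaveEnvelope_le ((hf₁.concaveEnvelope_concaveOn.smul ha).add
      (hf₂.concaveEnvelope_concaveOn.smul hb)) (fun t ht => ?_) hu
    rw [hfab t ht]
    exact add_le_add (mul_le_mul_of_nonneg_left (hf₁.le_concaveEnvelope ht) ha)
      (mul_le_mul_of_nonneg_left (hf₂.le_concaveEnvelope ht) hb)
  · rw [hf.concaveEnvelope_one, hf₁.concaveEnvelope_one, hf₂.concaveEnvelope_one,
      hfab 1 (by simp)]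

section Segment

variable {f₀ f₁ : ℝ → ℝ}

/-- The segment between two functions. -/
noncomputable def segmentMap (f₀ f₁ : ℝ → ℝ) (θ t : ℝ) : ℝ := (1 - θ) * f₀ t + θ * f₁ t

theorem isDistortion_segmentMap (h₀ : IsDistortion f₀) (h₁ : IsDistortion f₁) (θ : ℝ) :
    IsDistortion (segmentMap f₀ f₁ θ) := (h₀.const_mul (1 - θ)).add (h₁.const_mul θ)

/-- Taking envelopes is monotone and commutes with adding constants up to the needed inequality, so
it does not increase uniform distance. -/
theorem abs_concaveEnvelope_segmentMap_sub_le (h₀ : IsDistortion f₀) (h₁ : IsDistortion f₁) :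
    ∃ K, ∀ θ η : ℝ, ∀ u ∈ Icc (0 : ℝ) 1, |concaveEnvelope (segmentMap f₀ f₁ θ) u -
      concaveEnvelope (segmentMap f₀ f₁ η) u| ≤ K * |θ - η| := by
  obtain ⟨M, hM0, hM⟩ := h₀.exists_bound
  obtain ⟨M', hM0', hM'⟩ := h₁.exists_bound
  have key : ∀ θ η : ℝ, ∀ s ∈ Icc (0 : ℝ) 1,
      segmentMap f₀ f₁ θ s ≤ segmentMap f₀ f₁ η s + (M + M') * |θ - η| := fun θ η s hs => by
    have e : segmentMap f₀ f₁ θ s - segmentMap f₀ f₁ η s = (θ - η) * (f₁ s - f₀ s) := by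
      unfold segmentMap; ring
    have h2 : |f₁ s - f₀ s| ≤ M + M' :=
      (abs_sub _ _).trans (by linarith [hM s hs, hM' s hs])
    have h3 := (le_abs_self ((θ - η) * (f₁ s - f₀ s)))
    rw [abs_mul] at h3
    have h4 := mul_le_mul_of_nonneg_left h2 (abs_nonneg (θ - η))
    linarith
  refine ⟨M + M', fun θ η u hu => abs_sub_le_iff.2 ⟨?_, ?_⟩⟩
  · have := (isDistortion_segmentMap h₀ h₁ θ).concaveEnvelope_le_add
      (isDistortion_segmentMap h₀ h₁ η) (key θ η) hu
    linarith
  · have := (isDistortion_segmentMap h₀ h₁ η).concaveEnvelope_le_add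
      (isDistortion_segmentMap h₀ h₁ θ) (key η θ) hu
    rw [abs_sub_comm] at this
    linarith

theorem continuous_integral_envDeriv_segmentMap_mul_of_bounded (h₀ : IsDistortion f₀)
    (h₁ : IsDistortion f₁) {q : ℝ → ℝ} (hq : MonotoneOn q (Ioo 0 1)) {N : ℝ} (hN0 : 0 ≤ N)
    (hN : ∀ t, |q t| ≤ N) :
    Continuous fun θ => ∫ t, envDeriv (segmentMap f₀ f₁ θ) (1 - t) * q t ∂unif := by
  obtain ⟨K, hK⟩ := abs_concaveEnvelope_segmentMap_sub_le h₀ h₁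
  have hK0 : 0 ≤ K := by
    have := (abs_nonneg _).trans (hK 1 0 0 (by simp)); simpa using this
  refine (LipschitzWith.of_dist_le_mul (K := ⟨4 * N * K, by positivity⟩) fun θ η => ?_).continuous
  have h1 := isDistortion_segmentMap h₀ h₁ θ
  have h2 := isDistortion_segmentMap h₀ h₁ η
  rw [Real.dist_eq, Real.dist_eq]
  refine (abs_integral_sub_le_of_primitive hq hN0 hN h1.integrable_envDeriv
    (fun u hu => h1.concaveEnvelope_eq_integral hu) h2.integrable_envDeriv
    (fun u hu => h2.concaveEnvelope_eq_integral hu) (hK θ η)).trans_eq ?_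
  change _ = 4 * N * K * |θ - η|
  ring

theorem convexOn_integral_envDeriv_segmentMap_sq (h₀ : IsDistortion f₀) (h₁ : IsDistortion f₁)
    (hm : ∀ θ ∈ Icc (0 : ℝ) 1, MemLp (envDeriv (segmentMap f₀ f₁ θ)) 2 unif) :
    ConvexOn ℝ (Icc 0 1) fun θ => ∫ t, envDeriv (segmentMap f₀ f₁ θ) t ^ 2 ∂unif := by
  refine ⟨convex_Icc 0 1, fun x hx y hy a b ha hb hab => ?_⟩
  refine (isDistortion_segmentMap h₀ h₁ _).integral_envDeriv_sq_combination_le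
    (isDistortion_segmentMap h₀ h₁ x) (isDistortion_segmentMap h₀ h₁ y) (hm x hx) (hm y hy)
    ha hb hab fun t _ => ?_
  simp only [segmentMap, smul_eq_mul]
  linear_combination (-f₀ t) * hab

/-- For clipped `q` the integral is Lipschitz in `θ`. Removing the clip costs at most the `L²`
clipping error times the norm of the derivative, which convexity bounds by its endpoint values; so
the convergence is uniform. -/
theorem continuousOn_integral_envDeriv_segmentMap_mul (h₀ : IsDistortion f₀)
    (h₁ : IsDistortion f₁)
    (hm : ∀ θ ∈ Icc (0 : ℝ) 1, MemLp (envDeriv (segmentMap f₀ f₁ θ)) 2 unif) {q : ℝ → ℝ}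
    (hq : MonotoneOn q (Ioo 0 1)) (hq2 : MemLp q 2 unif) :
    ContinuousOn (fun θ => ∫ t, envDeriv (segmentMap f₀ f₁ θ) (1 - t) * q t ∂unif)
      (Icc 0 1) := by
  set Q : ℝ → ℝ := fun θ => ∫ t, envDeriv (segmentMap f₀ f₁ θ) t ^ 2 ∂unif with hQ
  have hconv := convexOn_integral_envDeriv_segmentMap_sq h₀ h₁ hm
  set M := max (Q 0) (Q 1)
  have hM : ∀ θ ∈ Icc (0 : ℝ) 1, Q θ ≤ M := fun θ hθ =>
    hconv.le_max_of_mem_Icc (by simp) (by simp) hθ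
  have hlim := ((tendsto_integral_sub_clip_sq hq2).const_mul M).sqrt
  rw [mul_zero, Real.sqrt_zero] at hlim
  have hunif : TendstoUniformlyOn
      (fun (n : ℕ) θ => ∫ t, envDeriv (segmentMap f₀ f₁ θ) (1 - t) * clip n (q t) ∂unif)
      (fun θ => ∫ t, envDeriv (segmentMap f₀ f₁ θ) (1 - t) * q t ∂unif) atTop (Icc 0 1) := by
    rw [Metric.tendstoUniformlyOn_iff]
    intro ε hε
    filter_upwards [hlim.eventually (gt_mem_nhds hε)] with n hn θ hθ
    refine lt_of_le_of_lt ?_ hn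
    have hφ := memLp_one_sub (hm θ hθ)
    have hc : MemLp (fun t => clip n (q t)) 2 unif :=
      memLp_of_monotoneOn_of_bounded ((continuous_clip n).measurable.comp_aemeasurable
        hq2.1.aemeasurable) fun t => abs_clip_le n.cast_nonneg _
    have hcs := integral_mul_sq_le hφ (hq2.sub hc)
    simp only [Pi.sub_apply] at hcs
    rw [Real.dist_eq, ← integral_sub (integrable_mul_of_memLp hφ hq2)
      (integrable_mul_of_memLp hφ hc)]
    simp_rw [← mul_sub]
    refine Real.abs_le_sqrt (hcs.trans (mul_le_mul_of_nonneg_right ?_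
      (integral_nonneg fun t => sq_nonneg _)))
    rw [integral_one_sub (fun t => envDeriv (segmentMap f₀ f₁ θ) t ^ 2)]
    exact hM θ hθ
  refine hunif.continuousOn (Eventually.frequently (Eventually.of_forall fun n => ?_))
  exact (continuous_integral_envDeriv_segmentMap_mul_of_bounded h₀ h₁
    ((clip_mono n).comp_monotoneOn hq) n.cast_nonneg
    fun t => abs_clip_le n.cast_nonneg _).continuousOn

/-- Convexity gives continuity in the interior. At an endpoint `η`, the function `Q` is squeezed
between its chord and the bound `2 ∫ φ_θ φ_η - Q η` coming from `∫ (φ_θ - φ_η)² ≥ 0`, which tends to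
`Q η` by the continuity of integrals against a fixed quantile. -/
theorem continuousOn_integral_envDeriv_segmentMap_sq (h₀ : IsDistortion f₀)
    (h₁ : IsDistortion f₁)
    (hm : ∀ θ ∈ Icc (0 : ℝ) 1, MemLp (envDeriv (segmentMap f₀ f₁ θ)) 2 unif) :
    ContinuousOn (fun θ => ∫ t, envDeriv (segmentMap f₀ f₁ θ) t ^ 2 ∂unif) (Icc 0 1) := by
  have hconv := convexOn_integral_envDeriv_segmentMap_sq h₀ h₁ hm
  set Q : ℝ → ℝ := fun θ => ∫ t, envDeriv (segmentMap f₀ f₁ θ) t ^ 2 ∂unif with hQ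
  have hchord : ∀ θ ∈ Icc (0 : ℝ) 1, Q θ ≤ (1 - θ) * Q 0 + θ * Q 1 := fun θ hθ => by
    have := hconv.2 (x := 0) (y := 1) (by simp) (by simp) (sub_nonneg.2 hθ.2) hθ.1
      (by ring : 1 - θ + θ = 1)
    simpa using this
  have hend : ∀ η ∈ Icc (0 : ℝ) 1, (1 - η) * Q 0 + η * Q 1 = Q η →
      ContinuousWithinAt Q (Icc 0 1) η := fun η hη hηQ => by
    have hφη := memLp_one_sub (hm η hη)
    have hw := continuousOn_integral_envDeriv_segmentMap_mul h₀ h₁ hm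
      (monotoneOn_one_sub (isDistortion_segmentMap h₀ h₁ η).envDeriv_antitoneOn) hφη
    have hlow := ((hw η hη).const_mul 2).sub_const (Q η)
    have hval : 2 * (∫ t, envDeriv (segmentMap f₀ f₁ η) (1 - t) *
        envDeriv (segmentMap f₀ f₁ η) (1 - t) ∂unif) - Q η = Q η := by
      rw [integral_one_sub_sq]; simp only [hQ]; ring
    have hup : Tendsto (fun θ : ℝ => (1 - θ) * Q 0 + θ * Q 1) (𝓝[Icc 0 1] η)
        (𝓝 ((1 - η) * Q 0 + η * Q 1)) :=
      (Continuous.tendsto (by fun_prop) η).mono_left nhdsWithin_le_nhds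
    rw [hηQ] at hup
    rw [hval] at hlow
    refine tendsto_of_tendsto_of_tendsto_of_le_of_le' hlow hup ?_ ?_
    · filter_upwards [self_mem_nhdsWithin] with θ hθ
      have h0 : 0 ≤ ∫ t, (envDeriv (segmentMap f₀ f₁ θ) (1 - t) -
        envDeriv (segmentMap f₀ f₁ η) (1 - t)) ^ 2 ∂unif := integral_nonneg fun t => sq_nonneg _
      rw [integral_sub_sq (memLp_one_sub (hm θ hθ)) hφη,
        integral_one_sub (fun t => envDeriv (segmentMap f₀ f₁ θ) t ^ 2),
        integral_one_sub (fun t => envDeriv (segmentMap f₀ f₁ η) t ^ 2)] at h0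
      simp only [hQ]
      linarith
    · filter_upwards [self_mem_nhdsWithin] with θ hθ using hchord θ hθ
  refine hconv.continuousOn_Icc one_pos ?_ ?_
  · exact (hend 0 (by simp) (by ring)).mono_of_mem_nhdsWithin (Icc_mem_nhdsGE one_pos)
  · exact (hend 1 (by simp) (by ring)).mono_of_mem_nhdsWithin (Icc_mem_nhdsLE one_pos)

end Segment

/-! ### Existence of the multiplier -/

theorem variance_one_sub {φ : ℝ → ℝ} (hφ : MemLp φ 2 unif) :
    Var[fun t => φ (1 - t); unif] = Var[φ; unif] := by
  rw [variance_eq_integral_sq_sub hφ, variance_eq_integral_sq_sub (memLp_one_sub hφ),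
    integral_one_sub, integral_one_sub (fun t => φ t ^ 2)]

theorem integral_mul_eq_of_primitive_eq {q φ₁ φ₂ : ℝ → ℝ} (hq : MonotoneOn q (Ioo 0 1))
    (hq2 : MemLp q 2 unif) (hφ₁ : MemLp φ₁ 2 unif) (hφ₂ : MemLp φ₂ 2 unif)
    (h : ∀ u ∈ Icc (0 : ℝ) 1, ∫ x in (0 : ℝ)..u, φ₁ x = ∫ x in (0 : ℝ)..u, φ₂ x) :
    ∫ t, φ₁ (1 - t) * q t ∂unif = ∫ t, φ₂ (1 - t) * q t ∂unif := by
  have i1 := integrable_mul_of_memLp (memLp_one_sub hφ₁) hq2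
  have i2 := integrable_mul_of_memLp (memLp_one_sub hφ₂) hq2
  have j1 : Integrable φ₁ unif := hφ₁.integrable (by norm_num)
  have j2 : Integrable φ₂ unif := hφ₂.integrable (by norm_num)
  exact le_antisymm
    (integral_mul_le_of_primitive_le hq j1 i1 (fun _ _ => rfl) j2 i2 (fun _ _ => rfl)
      (fun u hu => (h u hu).le) (h 1 (by simp)))
    (integral_mul_le_of_primitive_le hq j2 i2 (fun _ _ => rfl) j1 i1 (fun _ _ => rfl)
      (fun u hu => (h u hu).ge) (h 1 (by simp)).symm)

theorem IsDistortion.concaveEnvelope_eq_self {f : ℝ → ℝ} (hf : IsDistortion f)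
    (hc : ConcaveOn ℝ (Icc 0 1) f) {u : ℝ} (hu : u ∈ Icc (0 : ℝ) 1) :
    concaveEnvelope f u = f u :=
  le_antisymm (hf.concaveEnvelope_le hc (fun _ _ => le_rfl) hu) (hf.le_concaveEnvelope hu)

theorem IsDistortion.memLp_envDeriv_segmentMap {g : ℝ → ℝ} (hg : IsDistortion g) {F : Measure ℝ}
    (hF : MemLp (quantile F) 2 unif) (hA : MemLp (envDeriv g) 2 unif) {θ : ℝ}
    (hθ : θ ∈ Icc (0 : ℝ) 1) : MemLp (envDeriv (segmentMap g (tailIntegral F) θ)) 2 unif :=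
  hg.memLp_envDeriv_blend hF hA (sub_nonneg.2 hθ.2) hθ.1

/-- The right derivative of `K` need not equal `F⁻¹(1 - t)` at jumps, but the primitives agree.
Testing this equality against `F⁻¹` and against the derivative itself identifies both integrals. -/
theorem tailIntegral_envDeriv_moments {F : Measure ℝ} (hF : MemLp (quantile F) 2 unif)
    (h2 : MemLp (envDeriv (tailIntegral F)) 2 unif) :
    ∫ t, envDeriv (tailIntegral F) (1 - t) * quantile F t ∂unif = ∫ t, quantile F t ^ 2 ∂unif ∧
      ∫ t, envDeriv (tailIntegral F) t ^ 2 ∂unif = ∫ t, quantile F t ^ 2 ∂unif := by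
  have hd := isDistortion_tailIntegral hF
  have hprim : ∀ u ∈ Icc (0 : ℝ) 1, ∫ x in (0 : ℝ)..u, envDeriv (tailIntegral F) x =
      ∫ x in (0 : ℝ)..u, quantile F (1 - x) := fun u hu => by
    rw [← hd.concaveEnvelope_eq_integral hu, hd.concaveEnvelope_eq_self
      (tailIntegral_concaveOn hF) hu, tailIntegral_eq]
  have e1 := integral_mul_eq_of_primitive_eq (quantile_monotoneOn F) hF h2 (memLp_one_sub hF) hprim
  have e2 := integral_mul_eq_of_primitive_eq (monotoneOn_one_sub hd.envDeriv_antitoneOn)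
    (memLp_one_sub h2) h2 (memLp_one_sub hF) hprim
  simp only [sub_sub_cancel] at e1 e2
  rw [integral_one_sub_sq] at e2
  simp_rw [← sq] at e1
  refine ⟨e1, ?_⟩
  rw [e2, ← e1]
  simp_rw [mul_comm]

/-- Dividing the segment point by `1 - θ` gives the tilt with multiplier `θ/(1 - θ)`, and the
envelope is positively homogeneous. The range `l ∈ (0, ∞)` is thereby compactified to `θ ∈ [0, 1]`.
-/
theorem IsDistortion.envDeriv_tilt_div {g : ℝ → ℝ} (hg : IsDistortion g) {F : Measure ℝ}
    (hF : MemLp (quantile F) 2 unif) {θ : ℝ} (hθ : θ < 1) {t : ℝ} (ht : t ∈ Ioo (0 : ℝ) 1) :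
    envDeriv (DistortionRisk.tilt g F (θ / (1 - θ))) t =
      (1 - θ)⁻¹ * envDeriv (segmentMap g (tailIntegral F) θ) t := by
  have h1 : 0 < 1 - θ := sub_pos.2 hθ
  have : DistortionRisk.tilt g F (θ / (1 - θ)) =
      fun x => (1 - θ)⁻¹ * segmentMap g (tailIntegral F) θ x := by
    ext x
    rw [tilt_eq_blend, DistortionRisk.blend, segmentMap]
    field_simp
  rw [this]
  exact (isDistortion_segmentMap hg (isDistortion_tailIntegral hF) θ).envDeriv_const_mul
    (inv_pos.2 h1) ht

theorem IsDistortion.exists_covariance_eq {g : ℝ → ℝ} (hg : IsDistortion g) {F : Measure ℝ}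
    (hF : MemLp (quantile F) 2 unif) (hA : MemLp (envDeriv g) 2 unif)
    (hA₂ : ∀ l : ℝ, 0 < l → ¬ EnvDerivConst (DistortionRisk.tilt g F l))
    (hnc : ¬ EnvDerivConst g) (hσ : 0 < √(Var[quantile F; unif])) {κ : ℝ}
    (h0 : cov[quantile F, fun t => envDeriv g (1 - t); unif] / √(Var[envDeriv g; unif]) < κ)
    (h1 : κ < √(Var[quantile F; unif])) :
    ∃ l : ℝ, 0 < l ∧ cov[quantile F, fun t => envDeriv (DistortionRisk.tilt g F l) (1 - t); unif] /
      √(Var[envDeriv (DistortionRisk.tilt g F l); unif]) = κ := by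
  have hd := isDistortion_tailIntegral hF
  set S : ℝ → ℝ → ℝ := segmentMap g (tailIntegral F) with hS
  have hSd : ∀ θ, IsDistortion (S θ) := isDistortion_segmentMap hg hd
  have hm : ∀ θ ∈ Icc (0 : ℝ) 1, MemLp (envDeriv (S θ)) 2 unif := fun θ hθ =>
    hg.memLp_envDeriv_segmentMap hF hA hθ
  set μF := ∫ t, quantile F t ∂unif with hμ
  have hS0 : S 0 = g := by ext t; simp [hS, segmentMap]
  have hS1 : S 1 = tailIntegral F := by ext t; simp [hS, segmentMap]
  have hcov : ∀ {φ : ℝ → ℝ}, MemLp φ 2 unif → cov[quantile F, fun t => φ (1 - t); unif] =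
      ∫ t, φ (1 - t) * quantile F t ∂unif - (∫ t, φ t ∂unif) * μF := fun {φ} hφ => by
    rw [covariance_unif_eq hF (memLp_one_sub hφ), integral_one_sub]
    simp_rw [mul_comm (quantile F _)]
    ring
  -- The equation with its denominator cleared: continuity on all of `[0, 1]` then needs no lower
  -- bound on the variance. The endpoint signs come from `h0` and `h1`.
  set D : ℝ → ℝ := fun θ => ∫ t, envDeriv (S θ) (1 - t) * quantile F t ∂unif - S θ 1 * μF -
    κ * √(∫ t, envDeriv (S θ) t ^ 2 ∂unif - (S θ 1) ^ 2) with hD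
  have hDeq : ∀ θ ∈ Icc (0 : ℝ) 1, D θ = cov[quantile F, fun t => envDeriv (S θ) (1 - t); unif] -
      κ * √(Var[envDeriv (S θ); unif]) := fun θ hθ => by
    rw [hcov (hm θ hθ), variance_eq_integral_sq_sub (hm θ hθ), (hSd θ).integral_envDeriv]
  have hSc : Continuous fun θ => S θ 1 := by simp only [hS, segmentMap]; fun_prop
  have hDc : ContinuousOn D (Icc 0 1) :=
    ((continuousOn_integral_envDeriv_segmentMap_mul hg hd hm (quantile_monotoneOn F) hF).sub
      (hSc.mul continuous_const).continuousOn).sub (continuousOn_const.mul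
      ((continuousOn_integral_envDeriv_segmentMap_sq hg hd hm).sub (hSc.pow 2).continuousOn).sqrt)
  have hD0 : D 0 < 0 := by
    rw [hDeq 0 (by simp), hS0]
    rw [div_lt_iff₀ (Real.sqrt_pos.2 (hg.variance_envDeriv_pos hA hnc))] at h0
    linarith
  have hD1 : 0 < D 1 := by
    obtain ⟨e1, e2⟩ := tailIntegral_envDeriv_moments hF (hS1 ▸ hm 1 (by simp))
    have hv := variance_eq_integral_sq_sub hF
    simp only [hD, hS1, e1, e2, tailIntegral_one]
    rw [← hv, ← hμ, ← sq, ← hv]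
    have hsq : √(Var[quantile F; unif]) * √(Var[quantile F; unif]) = Var[quantile F; unif] :=
      Real.mul_self_sqrt (variance_nonneg _ _)
    nlinarith
  obtain ⟨θ, hθ, hθ0⟩ := intermediate_value_Icc zero_le_one hDc ⟨hD0.le, hD1.le⟩
  have hθ1 : θ < 1 := hθ.2.lt_of_ne fun h => by rw [h] at hθ0; linarith
  have hθ2 : 0 < θ := hθ.1.lt_of_ne fun h => by rw [← h] at hθ0; linarith
  have h1θ : 0 < 1 - θ := sub_pos.2 hθ1
  have hl : 0 < θ / (1 - θ) := div_pos hθ2 h1θ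
  have hφ := hg.memLp_envDeriv_tilt hF hA hl.le
  have hv := (hg.tilt hF _).variance_envDeriv_pos hφ (hA₂ _ hl)
  refine ⟨_, hl, ?_⟩
  rw [div_eq_iff (Real.sqrt_pos.2 hv).ne']
  have hae : envDeriv (DistortionRisk.tilt g F (θ / (1 - θ))) =ᵐ[unif]
      fun t => (1 - θ)⁻¹ * envDeriv (S θ) t :=
    ae_unif_of_forall fun t ht => hg.envDeriv_tilt_div hF hθ1 ht
  have hcov' : cov[quantile F, fun t =>
      envDeriv (DistortionRisk.tilt g F (θ / (1 - θ))) (1 - t); unif] =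
      (1 - θ)⁻¹ * cov[quantile F, fun t => envDeriv (S θ) (1 - t); unif] := by
    have hae' : ∀ᵐ t ∂unif, envDeriv (DistortionRisk.tilt g F (θ / (1 - θ))) (1 - t) =
        (1 - θ)⁻¹ * envDeriv (S θ) (1 - t) :=
      measurePreserving_one_sub.quasiMeasurePreserving.ae hae
    rw [hcov hφ, hcov (hm θ hθ), integral_congr_ae hae, integral_const_mul,
      integral_congr_ae (g := fun t => (1 - θ)⁻¹ * (envDeriv (S θ) (1 - t) * quantile F t))
        (hae'.mono fun t ht => by simp only [ht]; ring), integral_const_mul]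
    ring
  rw [hcov', variance_congr hae, variance_const_mul, Real.sqrt_mul (sq_nonneg _),
    Real.sqrt_sq (inv_nonneg.2 h1θ.le)]
  rw [hDeq θ hθ] at hθ0
  linear_combination (1 - θ)⁻¹ * hθ0

/-! ### Step quantile functions -/

/-- The nondecreasing step function `c + ∑ i, w i * 1_{t > 1 - u i}`. -/
noncomputable def stepFun {ι : Type} [Fintype ι] (c : ℝ) (w u : ι → ℝ) (t : ℝ) : ℝ :=
  c + ∑ i, w i * (Ioi (1 - u i)).indicator 1 t

/-- `q` is a step quantile function on which the risk metric of `g` has the value `J`. -/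
def IsStepWith (g q : ℝ → ℝ) (J : ℝ) : Prop :=
  ∃ (ι : Type) (_ : Fintype ι) (c : ℝ) (w u : ι → ℝ), (∀ i, 0 ≤ w i) ∧
    (∀ i, u i ∈ Icc (0 : ℝ) 1) ∧ q = stepFun c w u ∧ J = c * g 1 + ∑ i, w i * g (u i)

theorem monotone_stepFun {ι : Type} [Fintype ι] {c : ℝ} {w u : ι → ℝ} (hw : ∀ i, 0 ≤ w i) :
    Monotone (stepFun c w u) := by
  intro x y hxy
  refine add_le_add_right (Finset.sum_le_sum fun i _ => mul_le_mul_of_nonneg_left ?_ (hw i)) c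
  by_cases hx : x ∈ Ioi (1 - u i)
  · have hy : y ∈ Ioi (1 - u i) := lt_of_lt_of_le (mem_Ioi.1 hx) hxy
    simp [indicator_of_mem hx, indicator_of_mem hy]
  · rw [indicator_of_notMem hx]
    exact indicator_nonneg (fun _ _ => zero_le_one) _

theorem IsStepWith.monotone {g q : ℝ → ℝ} {J : ℝ} (h : IsStepWith g q J) : Monotone q := by
  obtain ⟨ι, _, c, w, u, hw, -, rfl, -⟩ := h
  exact monotone_stepFun hw

theorem memLp_of_monotone {q : ℝ → ℝ} (hq : Monotone q) : MemLp q 2 unif := by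
  refine MemLp.of_bound hq.measurable.aestronglyMeasurable (max |q 0| |q 1|)
    (ae_unif_of_forall fun t ht => ?_)
  exact abs_le_max_abs_abs (hq ht.1.le) (hq ht.2.le)

theorem IsStepWith.memLp {g q : ℝ → ℝ} {J : ℝ} (h : IsStepWith g q J) : MemLp q 2 unif :=
  memLp_of_monotone h.monotone

theorem IsStepWith.add {g q q' : ℝ → ℝ} {J J' : ℝ} (h : IsStepWith g q J)
    (h' : IsStepWith g q' J') : IsStepWith g (fun t => q t + q' t) (J + J') := by
  obtain ⟨ι, _, c, w, u, hw, hu, rfl, rfl⟩ := h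
  obtain ⟨ι', _, c', w', u', hw', hu', rfl, rfl⟩ := h'
  refine ⟨ι ⊕ ι', inferInstance, c + c', Sum.elim w w', Sum.elim u u', ?_, ?_, ?_, ?_⟩
  · rintro (i | i) <;> simp [hw, hw']
  · rintro (i | i)
    · exact hu i
    · exact hu' i
  · ext t; simp only [stepFun, Fintype.sum_sum_type, Sum.elim_inl, Sum.elim_inr]; ring
  · simp only [Fintype.sum_sum_type, Sum.elim_inl, Sum.elim_inr]; ring

theorem IsStepWith.affine {g q : ℝ → ℝ} {J : ℝ} (h : IsStepWith g q J) (a : ℝ) {b : ℝ}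
    (hb : 0 ≤ b) : IsStepWith g (fun t => a + b * q t) (a * g 1 + b * J) := by
  obtain ⟨ι, _, c, w, u, hw, hu, rfl, rfl⟩ := h
  refine ⟨ι, inferInstance, a + b * c, fun i => b * w i, u, fun i => mul_nonneg hb (hw i), hu,
    ?_, ?_⟩
  · ext t; simp only [stepFun, mul_add, Finset.mul_sum]
    simp_rw [mul_assoc]; ring
  · simp only [mul_add, Finset.mul_sum, mul_assoc]; ring

/-- The shape of a step function does not involve the distortion function; only its value does. -/
theorem IsStepWith.exists_change {g q : ℝ → ℝ} {J : ℝ} (h : IsStepWith g q J) (g' : ℝ → ℝ) :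
    ∃ J', IsStepWith g' q J' := by
  obtain ⟨ι, _, c, w, u, hw, hu, rfl, rfl⟩ := h
  exact ⟨_, ι, inferInstance, c, w, u, hw, hu, rfl, rfl⟩

theorem isStepWith_two_point (g : ℝ → ℝ) {u : ℝ} (hu : u ∈ Icc (0 : ℝ) 1) :
    IsStepWith g ((Ioi (1 - u)).indicator 1) (g u) :=
  ⟨Unit, inferInstance, 0, fun _ => 1, fun _ => u, fun _ => zero_le_one, fun _ => hu,
    by ext t; simp [stepFun], by simp⟩

theorem one_sub_cdf_stepFun_mem {ι : Type} [Fintype ι] {c : ℝ} {w u : ι → ℝ}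
    (hw : ∀ i, 0 ≤ w i) (x : ℝ) :
    1 - cdf (unif.map (stepFun c w u)) x ∈ insert (0 : ℝ) (insert 1 (range u)) := by
  set v := 1 - cdf (unif.map (stepFun c w u)) x with hv
  have hvI : v ∈ Icc (0 : ℝ) 1 := one_sub_cdf_mem _ x
  by_contra hn
  simp only [mem_insert_iff, mem_range, not_or, not_exists] at hn
  have hv' : v ∈ Ioo (0 : ℝ) 1 :=
    ⟨hvI.1.lt_of_ne fun h => hn.1 h.symm, hvI.2.lt_of_ne hn.2.1⟩
  have hev : ∀ᶠ t in 𝓝 (1 - v), ∀ i, (Ioi (1 - u i)).indicator (1 : ℝ → ℝ) t =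
      (Ioi (1 - u i)).indicator 1 (1 - v) := by
    rw [eventually_all]
    intro i
    rcases lt_or_gt_of_ne (hn.2.2 i) with h | h
    · have h' : 1 - v < 1 - u i := by linarith
      filter_upwards [gt_mem_nhds h'] with t ht
      simp [not_lt.2 ht.le, not_lt.2 h'.le]
    · have h' : 1 - u i < 1 - v := by linarith
      filter_upwards [lt_mem_nhds h'] with t ht
      simp [ht, h']
  refine one_sub_cdf_map_ne_of_eventually_const ((monotone_stepFun hw).monotoneOn _) hv'
    (c := stepFun c w u (1 - v)) (hev.mono fun t ht => ?_) x hv.symm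
  simp only [stepFun, ht]

/-- The survival function of a step law takes finitely many values, so `g` may be replaced by the
Lagrange polynomial interpolating it there. The polynomial has a continuous density, and the
layer-cake formula applies with no regularity of `g`. -/
theorem IsStepWith.rho_eq {g q : ℝ → ℝ} {J : ℝ} (h : IsStepWith g q J) (hg0 : g 0 = 0) :
    rho g (unif.map q) = (J : EReal) := by
  classical
  have hq := (h.monotone).monotoneOn (Ioo 0 1)
  have hq2 := h.memLp
  obtain ⟨ι, _, c, w, u, hw, hu, rfl, rfl⟩ := h
  set S : Finset ℝ := insert 0 (insert 1 (Finset.univ.image u))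
  set P := Lagrange.interpolate S id g with hP
  have hPg : ∀ v ∈ S, P.eval v = g v := fun v hv =>
    Lagrange.eval_interpolate_at_node g (injOn_id _) hv
  set φ : ℝ → ℝ := fun t => P.derivative.eval t
  have hφc : Continuous φ := P.derivative.continuous
  have hΦ : ∀ v : ℝ, P.eval v = ∫ x in (0 : ℝ)..v, φ x := fun v => by
    rw [intervalIntegral.integral_eq_sub_of_hasDerivAt (f := fun x => P.eval x)
      (fun x _ => P.hasDerivAt x) (hφc.intervalIntegrable _ _), hPg 0 (by simp [S]), hg0, sub_zero]
  have hφ2 : MemLp φ 2 unif := by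
    obtain ⟨C, hC⟩ := isCompact_Icc.exists_bound_of_continuousOn (hφc.continuousOn (s := Icc 0 1))
    exact MemLp.of_bound hφc.aestronglyMeasurable C
      (ae_unif_of_forall fun t ht => hC t ⟨ht.1.le, ht.2.le⟩)
  have hφ2' := memLp_one_sub hφ2
  obtain ⟨hi, he⟩ := integrable_rhoIntegrand_and_integral_eq hq (hφ2.integrable (by norm_num))
    (integrable_mul_of_memLp hφ2' hq2) (Φ := fun v => P.eval v) fun v _ => hΦ v
  have hr : rhoIntegrand g (unif.map (stepFun c w u)) =
      rhoIntegrand (fun v => P.eval v) (unif.map (stepFun c w u)) := by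
    ext x
    have hmem := one_sub_cdf_stepFun_mem (c := c) (u := u) hw x
    unfold rhoIntegrand
    beta_reduce
    rw [hPg 1 (by simp [S]), hPg _ (by simpa [S] using hmem)]
  rw [rho_eq_integral (hr ▸ hi), hr, he]
  congr 1
  have hind : ∀ i, Integrable (fun t => φ (1 - t) * (Ioi (1 - u i)).indicator 1 t) unif :=
    fun i => integrable_mul_of_memLp hφ2' (memLp_of_monotone (isStepWith_two_point g (hu i)).monotone)
  have hexp : ∀ t, φ (1 - t) * stepFun c w u t =
      c * φ (1 - t) + ∑ i, w i * (φ (1 - t) * (Ioi (1 - u i)).indicator 1 t) := fun t => by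
    simp only [stepFun, mul_add, Finset.mul_sum]
    congr 1
    · ring
    · exact Finset.sum_congr rfl fun i _ => by ring
  simp_rw [hexp]
  rw [integral_add ((hφ2'.integrable (by norm_num)).const_mul c)
    (integrable_finsetSum _ fun i _ => (hind i).const_mul (w i)), integral_const_mul,
    integral_finsetSum _ fun i _ => (hind i).const_mul (w i)]
  congr 1
  · rw [integral_one_sub φ, ← hPg 1 (by simp [S]), hΦ 1,
      intervalIntegral.integral_of_le zero_le_one, integral_Ioc_eq_integral_Ioo, unif]
  · refine Finset.sum_congr rfl fun i _ => ?_
    rw [integral_const_mul, integral_indicator_Ioi_one_sub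
      ⟨by linarith [(hu i).2], by linarith [(hu i).1]⟩, sub_sub_cancel, ← hΦ,
      hPg _ (by simp [S])]

/-! ### Perturbation of the jump locations -/

theorem integral_abs_indicator_sub_le {u v : ℝ} :
    ∫ t, |(Ioi (1 - u)).indicator (1 : ℝ → ℝ) t - (Ioi (1 - v)).indicator 1 t| ∂unif ≤ |u - v| := by
  have h : ∀ t, |(Ioi (1 - u)).indicator (1 : ℝ → ℝ) t - (Ioi (1 - v)).indicator 1 t| =
      (uIoc (1 - u) (1 - v)).indicator (fun _ => (1 : ℝ)) t := fun t => by
    simp only [indicator, mem_Ioi, Pi.one_apply, mem_uIoc]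
    split_ifs <;> first | (exfalso; grind) | simp
  simp_rw [h]
  rw [integral_indicator measurableSet_uIoc, setIntegral_const, smul_eq_mul, mul_one, unif]
  rw [measureReal_restrict_apply measurableSet_uIoc]
  refine (measureReal_mono inter_subset_left (by simp)).trans_eq ?_
  rw [measureReal_def, Real.volume_uIoc, ENNReal.toReal_ofReal (abs_nonneg _)]
  congr 1
  ring

/-- Each jump level `u i` is moved to a nearby `v i` at which `g` almost reaches `ĝ(u i)`. -/
theorem IsDistortion.exists_step_perturbation {g : ℝ → ℝ} (hg : IsDistortion g) {q : ℝ → ℝ} {J : ℝ}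
    (h : IsStepWith (uscVersion g) q J) {δ : ℝ} (hδ : 0 < δ) :
    ∃ q' J', IsStepWith g q' J' ∧ ∫ t, (q' t - q t) ^ 2 ∂unif ≤ δ ∧ J - δ ≤ J' := by
  have hq2 := h.memLp
  obtain ⟨ι, _, c, w, u, hw, hu, rfl, rfl⟩ := h
  set W := ∑ i, w i with hWdef
  have hW : 0 ≤ W := Finset.sum_nonneg fun i _ => hw i
  -- The squared `L²` error is at most `W² η` and the loss of value at most `W η`; the summand `1`
  -- keeps the denominator positive.
  set η := δ / (W ^ 2 + W + 1) with hη
  have hden : 0 < W ^ 2 + W + 1 := by positivity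
  have hη0 : 0 < η := div_pos hδ hden
  have hηδ : (W ^ 2 + W + 1) * η = δ := mul_div_cancel₀ _ hden.ne'
  choose v hv1 hv2 hv3 using fun i =>
    hg.exists_lt_of_lt_uscVersion (hu i) (sub_lt_self (uscVersion g (u i)) hη0) hη0
  have hstep : IsStepWith g (stepFun c w v) (c * g 1 + ∑ i, w i * g (v i)) :=
    ⟨ι, inferInstance, c, w, v, hw, hv1, rfl, rfl⟩
  refine ⟨_, _, hstep, ?_, ?_⟩
  · set d : ι → ℝ → ℝ := fun i t =>
      |(Ioi (1 - v i)).indicator (1 : ℝ → ℝ) t - (Ioi (1 - u i)).indicator 1 t| with hd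
    have hd1 : ∀ i t, d i t ≤ 1 := fun i t => by
      simp only [hd, indicator, Pi.one_apply]
      split_ifs <;> simp
    have hd0 : ∀ i t, 0 ≤ d i t := fun i t => abs_nonneg _
    have hdi : ∀ i, Integrable (d i) unif := fun i =>
      (((memLp_of_monotone (isStepWith_two_point g (hv1 i)).monotone).sub
        (memLp_of_monotone (isStepWith_two_point g (hu i)).monotone)).integrable
        (by norm_num)).abs
    have hpt : ∀ t, (stepFun c w v t - stepFun c w u t) ^ 2 ≤ W * ∑ i, w i * d i t := fun t => by
      have e1 : |stepFun c w v t - stepFun c w u t| ≤ ∑ i, w i * d i t := by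
        simp only [stepFun, add_sub_add_left_eq_sub, ← Finset.sum_sub_distrib, ← mul_sub]
        refine (Finset.abs_sum_le_sum_abs _ _).trans_eq (Finset.sum_congr rfl fun i _ => ?_)
        rw [abs_mul, abs_of_nonneg (hw i)]
      have e2 : ∑ i, w i * d i t ≤ W := Finset.sum_le_sum fun i _ =>
        mul_le_of_le_one_right (hw i) (hd1 i t)
      rw [← sq_abs, sq]
      exact mul_le_mul (e1.trans e2) e1 (abs_nonneg _) hW
    have hint : Integrable (fun t => ∑ i, w i * d i t) unif :=
      integrable_finsetSum _ fun i _ => (hdi i).const_mul _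
    calc _ ≤ ∫ t, W * ∑ i, w i * d i t ∂unif :=
          integral_mono (hstep.memLp.sub hq2).integrable_sq (hint.const_mul W) hpt
      _ = W * ∑ i, w i * ∫ t, d i t ∂unif := by
          rw [integral_const_mul, integral_finsetSum _ fun i _ => (hdi i).const_mul _]
          simp_rw [integral_const_mul]
      _ ≤ W * ∑ i, w i * η := by
          gcongr with i
          · exact hw i
          · exact integral_abs_indicator_sub_le.trans (hv2 i)
      _ ≤ δ := by
          rw [← Finset.sum_mul, ← hWdef, ← hηδ]
          nlinarith [mul_nonneg hW hη0.le]
  · have : ∑ i, w i * uscVersion g (u i) ≤ ∑ i, w i * g (v i) + W * η := by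
      rw [Finset.sum_mul, ← Finset.sum_add_distrib]
      refine Finset.sum_le_sum fun i _ => ?_
      rw [← mul_add]
      exact mul_le_mul_of_nonneg_left (by linarith [hv3 i]) (hw i)
    have h2 : W * η ≤ δ := by rw [← hηδ]; nlinarith [mul_nonneg (sq_nonneg W) hη0.le]
    rw [uscVersion_one]
    linarith

/-! ### Discretization of a distribution -/

/-- A tagged grid with mesh `w` starting at `a` counts the tags below `z` up to one mesh. -/
theorem abs_grid_sum_sub_le {a w z : ℝ} (hw : 0 ≤ w) {y : ℕ → ℝ}
    (hy : ∀ j : ℕ, y j ∈ Ioo (a + j * w) (a + (j + 1) * w)) (n : ℕ) :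
    (a + n * w ≤ z → a + ∑ j ∈ Finset.range n, w * (Iio z).indicator 1 (y j) = a + n * w) ∧
      |a + ∑ j ∈ Finset.range n, w * (Iio z).indicator 1 (y j) -
        max a (min (a + n * w) z)| ≤ w := by
  induction n with
  | zero =>
    refine ⟨fun _ => by simp, ?_⟩
    simp [hw]
  | succ n ih =>
    rw [Finset.sum_range_succ]
    have hyn := hy n
    have hcast : ((n + 1 : ℕ) : ℝ) = n + 1 := by push_cast; ring
    rw [hcast]
    have hexp : a + ((n : ℝ) + 1) * w = a + n * w + w := by ring
    have hnw : 0 ≤ (n : ℝ) * w := mul_nonneg n.cast_nonneg hw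
    constructor
    · intro hz
      have : y n ∈ Iio z := hyn.2.trans_le hz
      rw [indicator_of_mem this, Pi.one_apply, ← add_assoc, ih.1 (by linarith)]
      ring
    · rcases le_or_gt z (a + n * w) with hz | hz
      · have : y n ∉ Iio z := not_lt.2 (hz.trans hyn.1.le)
        rw [indicator_of_notMem this, mul_zero, add_zero, min_eq_right (by linarith)]
        have h2 := ih.2
        rwa [min_eq_right hz] at h2
      · rw [← add_assoc, ih.1 hz.le, hexp]
        have h3 : 0 ≤ w * (Iio z).indicator (1 : ℝ → ℝ) (y n) ∧
            w * (Iio z).indicator (1 : ℝ → ℝ) (y n) ≤ w := by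
          by_cases h : y n ∈ Iio z <;> simp [h, hw]
        have h4 : a + n * w ≤ max a (min (a + n * w + w) z) :=
          le_max_of_le_right (le_min (by linarith) hz.le)
        have h5 : max a (min (a + n * w + w) z) ≤ a + n * w + w :=
          max_le (by linarith) (min_le_left _ _)
        rw [abs_le]
        constructor <;> linarith [h3.1, h3.2]

/-- A tag at which the integrand is at least its mean makes the tagged sum an upper bound for the
integral, so integrability alone suffices and no Riemann integrability is needed. -/
theorem exists_tag_le {r : ℝ → ℝ} (hr : Integrable r) {a b : ℝ} (hab : a < b) :
    ∃ y ∈ Ioo a b, ∫ x in a..b, r x ≤ (b - a) * r y := by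
  have h0 : volume (Ioo a b) ≠ 0 := by
    rw [Real.volume_Ioo]; simpa using hab
  obtain ⟨y, hy, hle⟩ := exists_setAverage_le h0 (by simp) (hr.integrableOn (s := Ioo a b))
  refine ⟨y, hy, ?_⟩
  rw [setAverage_eq, smul_eq_mul, Real.volume_real_Ioo_of_le hab.le] at hle
  rw [intervalIntegral.integral_of_le hab.le, integral_Ioc_eq_integral_Ioo]
  rwa [inv_mul_le_iff₀ (sub_pos.2 hab)] at hle

/-- The line is cut to `[-N, N]` and divided into `2M` cells of width `N/M`, with one favourable tag
per cell. Summing the tags lying below `G⁻¹(t)` recovers the clipped quantile up to one mesh width.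
-/
theorem exists_step_discretization {f : ℝ → ℝ} {G : Measure ℝ} [IsProbabilityMeasure G]
    (hG : MemLp (quantile G) 2 unif) (hr : Integrable (rhoIntegrand f G)) {δ : ℝ} (hδ : 0 < δ) :
    ∃ q J, IsStepWith f q J ∧ ∫ t, (q t - quantile G t) ^ 2 ∂unif ≤ δ ∧
      (∫ x, rhoIntegrand f G x) - δ ≤ J := by
  have hcast : Tendsto (fun n : ℕ => (n : ℝ)) atTop atTop := tendsto_natCast_atTop_atTop
  have hlim1 := intervalIntegral_tendsto_integral hr (tendsto_neg_atTop_atBot.comp hcast) hcast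
  have hlim2 := tendsto_integral_sub_clip_sq hG
  obtain ⟨N, hN1, hN2, hN3⟩ := ((hlim1.eventually (lt_mem_nhds (sub_lt_self _ hδ))).and
    ((hlim2.eventually (gt_mem_nhds (by linarith : (0 : ℝ) < δ / 4))).and
    (eventually_gt_atTop 0))).exists
  have hNpos : (0 : ℝ) < N := Nat.cast_pos.2 hN3
  obtain ⟨M, hM0, hM⟩ : ∃ M : ℕ, 0 < M ∧ ((N : ℝ) / M) ^ 2 ≤ δ / 4 := by
    have : Tendsto (fun M : ℕ => ((N : ℝ) / M) ^ 2) atTop (𝓝 (0 ^ 2)) :=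
      (tendsto_const_nhds.div_atTop hcast).pow 2
    obtain ⟨M, h1, h2⟩ := ((this.eventually (gt_mem_nhds
      (by linarith : (0 : ℝ) ^ 2 < δ / 4))).and (eventually_gt_atTop 0)).exists
    exact ⟨M, h2, h1.le⟩
  have hMpos : (0 : ℝ) < M := Nat.cast_pos.2 hM0
  set w : ℝ := N / M with hw
  have hw0 : 0 < w := div_pos hNpos hMpos
  have hMw : M * w = N := mul_div_cancel₀ _ hMpos.ne'
  choose y hy hyle using fun j : ℕ => exists_tag_le hr
    (show (-N + j * w : ℝ) < -N + (j + 1) * w by nlinarith)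
  have hsum : ∫ x in (-N : ℝ)..N, rhoIntegrand f G x ≤
      ∑ j ∈ Finset.range (2 * M), w * rhoIntegrand f G (y j) := by
    have h := intervalIntegral.sum_integral_adjacent_intervals (f := rhoIntegrand f G)
      (μ := volume) (a := fun j : ℕ => (-N + j * w : ℝ)) (n := 2 * M)
      fun k _ => hr.intervalIntegrable
    have e0 : (-N + (0 : ℕ) * w : ℝ) = -N := by simp
    have e1 : (-N + (2 * M : ℕ) * w : ℝ) = N := by push_cast; linear_combination 2 * hMw
    simp only [e0, e1] at h
    rw [← h]
    refine Finset.sum_le_sum fun j _ => ?_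
    have := hyle j
    rw [show (-N + (j + 1) * w - (-N + j * w) : ℝ) = w by ring] at this
    push_cast
    exact this
  -- The jump for the tag `y j` sits at `t = G(y j)`, because `t > G(y j)` exactly when `y j <
  -- G⁻¹(t)`.
  set v : Fin (2 * M) → ℝ := fun j => 1 - cdf G (y j) with hv
  refine ⟨stepFun (-N) (fun _ => w) v, _, ⟨Fin (2 * M), inferInstance, -N, fun _ => w, v,
    fun _ => hw0.le, fun j => one_sub_cdf_mem G _, rfl, rfl⟩, ?_, ?_⟩
  · have hq : MemLp (stepFun (-N) (fun _ => w) v) 2 unif :=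
      memLp_of_monotone (monotone_stepFun fun _ => hw0.le)
    have hc : MemLp (fun t => clip N (quantile G t)) 2 unif :=
      memLp_of_monotoneOn_of_bounded ((continuous_clip N).measurable.comp_aemeasurable
        hG.1.aemeasurable) fun t => abs_clip_le hNpos.le _
    have hpt : ∀ t ∈ Ioo (0 : ℝ) 1, (stepFun (-N) (fun _ => w) v t - quantile G t) ^ 2 ≤
        2 * w ^ 2 + 2 * (quantile G t - clip N (quantile G t)) ^ 2 := fun t ht => by
      have hstep : stepFun (-N) (fun _ => w) v t = -N + ∑ j ∈ Finset.range (2 * M),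
          w * (Iio (quantile G t)).indicator 1 (y j) := by
        rw [stepFun, Finset.sum_range]
        congr 1
        refine Finset.sum_congr rfl fun j _ => ?_
        congr 1
        have hiff : t ∈ Ioi (1 - v j) ↔ y j ∈ Iio (quantile G t) := by
          rw [mem_Ioi, mem_Iio, lt_quantile_iff G ht, hv, sub_sub_cancel]
        by_cases h : t ∈ Ioi (1 - v j)
        · rw [indicator_of_mem h, indicator_of_mem (hiff.1 h)]; rfl
        · rw [indicator_of_notMem h, indicator_of_notMem fun h' => h (hiff.2 h')]
      have hgrid := (abs_grid_sum_sub_le (z := quantile G t) hw0.le hy (2 * M)).2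
      have e1 : (-N + (2 * M : ℕ) * w : ℝ) = N := by push_cast; linear_combination 2 * hMw
      rw [e1, ← hstep] at hgrid
      have h1 : (stepFun (-N) (fun _ => w) v t - clip N (quantile G t)) ^ 2 ≤ w ^ 2 :=
        sq_le_sq' (abs_le.1 hgrid).1 (abs_le.1 hgrid).2
      nlinarith [sq_nonneg ((stepFun (-N) (fun _ => w) v t - clip N (quantile G t)) +
        (quantile G t - clip N (quantile G t)))]
    have hi2 : Integrable (fun t => (quantile G t - clip N (quantile G t)) ^ 2) unif :=
      (hG.sub hc).integrable_sq
    have hle := integral_mono_ae (hq.sub hG).integrable_sq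
      ((integrable_const (2 * w ^ 2)).add (hi2.const_mul 2)) (ae_unif_of_forall hpt)
    refine hle.trans ?_
    simp only [Pi.add_apply]
    rw [integral_add (integrable_const _) (hi2.const_mul 2), integral_const, probReal_univ,
      one_smul, integral_const_mul]
    linarith
  · have e1 : ∑ j : Fin (2 * M), w * f (v j) =
        ∑ j ∈ Finset.range (2 * M), w * f (1 - cdf G (y j)) :=
      (Finset.sum_range fun j => w * f (1 - cdf G (y j))).symm
    have e2 : ∑ j ∈ Finset.range (2 * M), w * rhoIntegrand f G (y j) =
        ∑ j ∈ Finset.range (2 * M), w * f (1 - cdf G (y j)) - N * f 1 := by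
      have e3 : ∀ j ∈ Finset.range (2 * M), w * rhoIntegrand f G (y j) =
          w * f (1 - cdf G (y j)) - if j < M then w * f 1 else 0 := fun j _ => by
        -- Exactly the first `M` cells lie left of `0`, since `M w = N`. Their correction terms add
        -- up to `N f(1)`, matching the starting value `-N` of the step function.
        have hneg : y j < 0 ↔ j < M := by
          constructor
          · intro h
            by_contra hj
            have h1 : (M : ℝ) ≤ j := Nat.cast_le.2 (not_lt.1 hj)
            have h2 := (hy j).1
            nlinarith
          · intro h
            have h1 : (j : ℝ) + 1 ≤ M := by exact_mod_cast h
            have h2 := (hy j).2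
            nlinarith
        simp only [rhoIntegrand, hneg]
        split_ifs <;> ring
      rw [Finset.sum_congr rfl e3, Finset.sum_sub_distrib]
      congr 1
      rw [two_mul, Finset.sum_range_add, Finset.sum_congr rfl
        (g := fun _ => w * f 1) fun j hj => if_pos (Finset.mem_range.1 hj)]
      simp [← mul_assoc, hMw]
    rw [e1]
    have hN1' : (∫ x, rhoIntegrand f G x) - δ < ∫ x in (-N : ℝ)..N, rhoIntegrand f G x := hN1
    linarith

theorem IsDistortion.exists_step_approximation {g : ℝ → ℝ} (hg : IsDistortion g) {G : Measure ℝ}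
    [IsProbabilityMeasure G] (hG : MemLp (quantile G) 2 unif)
    (hr : Integrable (rhoIntegrand (uscVersion g) G)) {δ : ℝ} (hδ : 0 < δ) :
    ∃ q J, IsStepWith g q J ∧ ∫ t, (q t - quantile G t) ^ 2 ∂unif ≤ δ ∧
      (∫ x, rhoIntegrand (uscVersion g) G x) - δ ≤ J := by
  obtain ⟨q, J, h1, h2, h3⟩ := exists_step_discretization hG hr (by linarith : 0 < δ / 4)
  obtain ⟨q', J', h1', h2', h3'⟩ := hg.exists_step_perturbation h1 (by linarith : 0 < δ / 4)
  refine ⟨q', J', h1', ?_, by linarith⟩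
  have i1 := (h1'.memLp.sub h1.memLp).integrable_sq
  have i2 := (h1.memLp.sub hG).integrable_sq
  have hle := integral_mono (μ := unif) (h1'.memLp.sub hG).integrable_sq
    ((i1.const_mul 2).add (i2.const_mul 2)) fun t => by
      simp only [Pi.sub_apply, Pi.add_apply]
      nlinarith [sq_nonneg ((q' t - q t) - (q t - quantile G t))]
  simp only [Pi.add_apply, Pi.sub_apply] at hle i1 i2
  rw [integral_add (i1.const_mul 2) (i2.const_mul 2), integral_const_mul,
    integral_const_mul] at hle
  linarith

/-! ### Measurability -/

/-- On `[0, 1]`, `g` is a difference of monotone functions, hence measurable, and `ĝ` differs from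
it only at its countably many discontinuities. Composing with the projection onto `[0, 1]` extends
this to the line. -/
theorem IsDistortion.aestronglyMeasurable_rhoIntegrand_uscVersion {g : ℝ → ℝ}
    (hg : IsDistortion g) (G : Measure ℝ) :
    AEStronglyMeasurable (rhoIntegrand (uscVersion g) G) volume := by
  obtain ⟨p, q, hp, hq, hpq⟩ :=
    hg.boundedVariation.locallyBoundedVariationOn.exists_monotoneOn_sub_monotoneOn
  set π : ℝ → ℝ := fun x => projIcc (0 : ℝ) 1 zero_le_one x
  have hπ : Monotone π := monotone_projIcc _
  have hπI : ∀ x, π x ∈ Icc (0 : ℝ) 1 := fun x => (projIcc (0 : ℝ) 1 zero_le_one x).2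
  have hgm : Measurable fun x => g (π x) := by
    have h1 : Monotone fun x => p (π x) := fun x y h => hp (hπI x) (hπI y) (hπ h)
    have h2 : Monotone fun x => q (π x) := fun x y h => hq (hπI x) (hπI y) (hπ h)
    rw [hpq]
    exact h1.measurable.sub h2.measurable
  have hcount : {x | g (π x) ≠ uscVersion g (π x)}.Countable := by
    refine (hp.countable_not_continuousWithinAt.union
      hq.countable_not_continuousWithinAt).mono fun x hx => ?_
    have hπx : π x ∈ Ioo (0 : ℝ) 1 := by
      by_contra h
      exact hx (uscVersion_of_notMem h).symm
    have hxπ : π x = x := by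
      have hx0 : 0 < x := not_le.1 fun h => by
        simp [π, projIcc_of_le_left zero_le_one h] at hπx
      have hx1 : x < 1 := not_le.1 fun h => by
        simp [π, projIcc_of_right_le zero_le_one h] at hπx
      simp [π, projIcc_of_mem zero_le_one (⟨hx0.le, hx1.le⟩ : x ∈ Icc (0 : ℝ) 1)]
    rw [hxπ] at hπx
    rw [mem_ofPred_eq, hxπ] at hx
    by_contra hc
    simp only [mem_union, mem_ofPred_eq, not_or, not_and, not_not] at hc
    have hI : x ∈ Icc (0 : ℝ) 1 := ⟨hπx.1.le, hπx.2.le⟩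
    have hcont : ContinuousAt g x := by
      have : ContinuousWithinAt g (Icc 0 1) x := by
        rw [hpq]; exact (hc.1 hI).sub (hc.2 hI)
      exact this.continuousAt (Icc_mem_nhds hπx.1 hπx.2)
    refine hx ?_
    rw [uscVersion_of_mem hπx,
      leftLim_eq_of_tendsto (hcont.tendsto.mono_left nhdsWithin_le_nhds),
      rightLim_eq_of_tendsto (hcont.tendsto.mono_left nhdsWithin_le_nhds)]
    simp
  have hm : Measurable fun x => uscVersion g (π x) := hgm.measurable_of_countable_ne hcount
  have heq : rhoIntegrand (uscVersion g) G = fun x => uscVersion g (π (1 - cdf G x)) -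
      if x < 0 then uscVersion g 1 else 0 := by
    ext x
    simp [rhoIntegrand, π, projIcc_of_mem zero_le_one (one_sub_cdf_mem G x)]
  rw [heq]
  exact ((hm.comp (measurable_const.sub (monotone_cdf G).measurable)).sub
    (Measurable.ite measurableSet_Iio measurable_const measurable_const)).aestronglyMeasurable

/-! ### Mean-square convergence -/

theorem covariance_sq_le {X Y : ℝ → ℝ} (hX : MemLp X 2 unif) (hY : MemLp Y 2 unif) :
    cov[X, Y; unif] ^ 2 ≤ Var[X; unif] * Var[Y; unif] := by
  rw [variance_eq_integral hX.1.aemeasurable, variance_eq_integral hY.1.aemeasurable]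
  exact integral_mul_sq_le (hX.sub (memLp_const _)) (hY.sub (memLp_const _))

theorem sqrt_variance_add_le {X Y : ℝ → ℝ} (hX : MemLp X 2 unif) (hY : MemLp Y 2 unif) :
    √(Var[fun t => X t + Y t; unif]) ≤ √(Var[X; unif]) + √(Var[Y; unif]) := by
  have h := Real.abs_le_sqrt (covariance_sq_le hX hY)
  rw [Real.sqrt_mul (variance_nonneg _ _)] at h
  refine Real.sqrt_le_iff.2 ⟨by positivity, ?_⟩
  rw [variance_fun_add hX hY]
  have h1 := Real.sq_sqrt (variance_nonneg X unif)
  have h2 := Real.sq_sqrt (variance_nonneg Y unif)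
  nlinarith [le_abs_self (cov[X, Y; unif])]

section Convergence

variable {X : ℕ → ℝ → ℝ} {Z Y : ℝ → ℝ}

theorem tendsto_integral_mul_of_tendsto (hX : ∀ n, MemLp (X n) 2 unif) (hZ : MemLp Z 2 unif)
    (h : Tendsto (fun n => ∫ t, (X n t - Z t) ^ 2 ∂unif) atTop (𝓝 0)) (hY : MemLp Y 2 unif) :
    Tendsto (fun n => ∫ t, X n t * Y t ∂unif) atTop (𝓝 (∫ t, Z t * Y t ∂unif)) := by
  have hlim := (h.mul_const (∫ t, Y t ^ 2 ∂unif)).sqrt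
  rw [zero_mul, Real.sqrt_zero] at hlim
  rw [tendsto_iff_dist_tendsto_zero]
  refine squeeze_zero (fun _ => dist_nonneg) (fun n => ?_) hlim
  rw [Real.dist_eq, ← integral_sub (integrable_mul_of_memLp (hX n) hY)
    (integrable_mul_of_memLp hZ hY)]
  simp_rw [← sub_mul]
  exact Real.abs_le_sqrt (integral_mul_sq_le ((hX n).sub hZ) hY)

theorem tendsto_integral_of_tendsto (hX : ∀ n, MemLp (X n) 2 unif) (hZ : MemLp Z 2 unif)
    (h : Tendsto (fun n => ∫ t, (X n t - Z t) ^ 2 ∂unif) atTop (𝓝 0)) :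
    Tendsto (fun n => ∫ t, X n t ∂unif) atTop (𝓝 (∫ t, Z t ∂unif)) := by
  simpa using tendsto_integral_mul_of_tendsto hX hZ h (memLp_const (1 : ℝ))

theorem tendsto_variance_of_tendsto (hX : ∀ n, MemLp (X n) 2 unif) (hZ : MemLp Z 2 unif)
    (h : Tendsto (fun n => ∫ t, (X n t - Z t) ^ 2 ∂unif) atTop (𝓝 0)) :
    Tendsto (fun n => Var[X n; unif]) atTop (𝓝 (Var[Z; unif])) := by
  have h1 := ((h.add ((tendsto_integral_mul_of_tendsto hX hZ h hZ).const_mul 2)).sub_const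
    (∫ t, Z t ^ 2 ∂unif)).sub ((tendsto_integral_of_tendsto hX hZ h).pow 2)
  rw [variance_eq_integral_sq_sub hZ]
  have e : 0 + 2 * (∫ t, Z t * Z t ∂unif) - ∫ t, Z t ^ 2 ∂unif - (∫ t, Z t ∂unif) ^ 2 =
      ∫ t, Z t ^ 2 ∂unif - (∫ t, Z t ∂unif) ^ 2 := by
    simp_rw [← sq]; ring
  rw [e] at h1
  refine h1.congr fun n => ?_
  rw [variance_eq_integral_sq_sub (hX n), integral_sub_sq (hX n) hZ]
  ring

theorem tendsto_covariance_of_tendsto (hX : ∀ n, MemLp (X n) 2 unif) (hZ : MemLp Z 2 unif)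
    (h : Tendsto (fun n => ∫ t, (X n t - Z t) ^ 2 ∂unif) atTop (𝓝 0)) (hY : MemLp Y 2 unif) :
    Tendsto (fun n => cov[Y, X n; unif]) atTop (𝓝 (cov[Y, Z; unif])) := by
  have h1 := (tendsto_integral_mul_of_tendsto hX hZ h hY).sub
    ((tendsto_integral_of_tendsto hX hZ h).const_mul (∫ t, Y t ∂unif))
  have e : ∀ {W : ℝ → ℝ}, MemLp W 2 unif → cov[Y, W; unif] =
      ∫ t, W t * Y t ∂unif - (∫ t, Y t ∂unif) * ∫ t, W t ∂unif := fun {W} hW => by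
    rw [covariance_unif_eq hY hW]
    simp_rw [mul_comm (Y _)]
  rw [e hZ]
  exact h1.congr fun n => (e (hX n)).symm

end Convergence

/-! ### Normalization -/

theorem normalized_moments {X : ℝ → ℝ} (hX : MemLp X 2 unif) (hv : 0 < Var[X; unif]) (m s : ℝ)
    {k : ℝ} (hk : k = s / √(Var[X; unif])) {h : ℝ → ℝ}
    (hh : h = fun t => (m - k * ∫ v, X v ∂unif) + k * X t) :
    MemLp h 2 unif ∧ ∫ t, h t ∂unif = m ∧ ∫ t, h t ^ 2 ∂unif = m ^ 2 + s ^ 2 ∧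
      ∀ Y : ℝ → ℝ, MemLp Y 2 unif →
        ∫ t, h t * Y t ∂unif = m * ∫ t, Y t ∂unif + k * cov[Y, X; unif] := by
  have hX' := memLp_one_sub hX
  have hvar := variance_one_sub hX
  have hv' : 0 < Var[fun t => X (1 - t); unif] := by rw [hvar]; exact hv
  obtain ⟨e1, e2, -⟩ := extremal_moments hX' hv' m s (h := h) fun t => by
    simp only [hh, hvar, integral_one_sub X, sub_sub_cancel, hk]; ring
  have h0 : MemLp h 2 unif := by
    rw [hh]
    exact (memLp_const (m - k * ∫ v, X v ∂unif)).add (hX.const_mul k)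
  refine ⟨h0, e1, e2, fun Y hY => ?_⟩
  have h1 : Integrable (fun t => X t * Y t) unif := integrable_mul_of_memLp hX hY
  have h2 : Integrable Y unif := hY.integrable (by norm_num)
  have h3 : ∫ t, h t * Y t ∂unif =
      ∫ t, ((m - k * ∫ v, X v ∂unif) * Y t + k * (X t * Y t)) ∂unif := by
    refine integral_congr_ae (ae_of_all _ fun t => ?_)
    simp only [hh]
    ring
  have h4 : ∫ t, Y t * X t ∂unif = ∫ t, X t * Y t ∂unif :=
    integral_congr_ae (ae_of_all _ fun t => mul_comm _ _)
  rw [h3, integral_add (h2.const_mul _) (h1.const_mul _), integral_const_mul, integral_const_mul,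
    covariance_unif_eq hY hX, h4]
  ring

/-- Normalization fixes the first two moments, so membership reduces to a lower bound on the
covariance with `F⁻¹`. -/
theorem normalized_map_mem_uncertaintySet {F : Measure ℝ} [IsProbabilityMeasure F]
    (hF : MemLp (fun x : ℝ => x) 2 F) {X : ℝ → ℝ} (hXm : MonotoneOn X (Ioo 0 1))
    (hX : MemLp X 2 unif) (hv : 0 < Var[X; unif]) {m s ε k : ℝ} (hs : 0 ≤ s) (hε : 0 ≤ ε)
    (hk : k = s / √(Var[X; unif])) (hc : (mean F - m) ^ 2 + (stdDev F - s) ^ 2 +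
      2 * stdDev F * s - ε ≤ 2 * (k * cov[quantile F, X; unif])) :
    unif.map (fun t => (m - k * ∫ v, X v ∂unif) + k * X t) ∈ uncertaintySet F m s ε := by
  obtain ⟨e0, e1, e2, e3⟩ := normalized_moments hX hv m s hk rfl
  have hF' := memLp_quantile hF
  have hk0 : 0 ≤ k := hk ▸ div_nonneg hs (Real.sqrt_nonneg _)
  refine map_mem_uncertaintySet hε (fun x hx y hy hxy => ?_) e0 e1 e2 ?_
  · have := mul_le_mul_of_nonneg_left (hXm hx hy hxy) hk0
    simpa using this
  · rw [integral_sub_sq e0 hF', e2, e3 _ hF', integral_quantile_sq hF, ← mean_eq_integral_quantile]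
    linarith

theorem covariance_quantile_indicator {F : Measure ℝ} (hF : MemLp (quantile F) 2 unif) {u : ℝ}
    (hu : u ∈ Icc (0 : ℝ) 1) : cov[quantile F, (Ioi (1 - u)).indicator 1; unif] =
      tailIntegral F u - u * ∫ t, quantile F t ∂unif ∧
      Var[(Ioi (1 - u)).indicator 1; unif] = u * (1 - u) := by
  have h2 : MemLp ((Ioi (1 - u)).indicator (1 : ℝ → ℝ)) 2 unif :=
    memLp_of_monotone (isStepWith_two_point 0 hu).monotone
  have hc : (1 - u) ∈ Icc (0 : ℝ) 1 := ⟨by linarith [hu.2], by linarith [hu.1]⟩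
  have e1 : ∫ t, (Ioi (1 - u)).indicator (1 : ℝ → ℝ) t ∂unif = u := by
    have := integral_indicator_Ioi_one_sub (φ := fun _ => 1) hc
    simpa using this
  have e2 : ∫ t, quantile F t * (Ioi (1 - u)).indicator 1 t ∂unif = tailIntegral F u := by
    have := integral_indicator_Ioi_one_sub (φ := fun t => quantile F (1 - t)) hc
    simp only [sub_sub_cancel] at this
    rw [this, tailIntegral_eq]
  have e3 : ∀ t, (Ioi (1 - u)).indicator (1 : ℝ → ℝ) t ^ 2 = (Ioi (1 - u)).indicator 1 t :=
    fun t => by by_cases h : t ∈ Ioi (1 - u) <;> simp [h]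
  rw [covariance_unif_eq hF h2, variance_eq_integral_sq_sub h2]
  simp_rw [e3]
  rw [e1, e2]
  constructor <;> ring

theorem tailIntegral_chord_le {F : Measure ℝ} (hF : MemLp (quantile F) 2 unif) {u : ℝ}
    (hu : u ∈ Icc (0 : ℝ) 1) : u * ∫ t, quantile F t ∂unif ≤ tailIntegral F u := by
  have := (tailIntegral_concaveOn hF).2 (x := 0) (y := 1) (by simp) (by simp)
    (sub_nonneg.2 hu.2) hu.1 (by ring : 1 - u + u = 1)
  simpa [tailIntegral_zero, tailIntegral_one] using this

/-- Monotone functions are positively associated: the concave `K` lies above its chord, and the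
comparison of primitives is applied to these two. -/
theorem covariance_quantile_nonneg {F : Measure ℝ} (hF : MemLp (quantile F) 2 unif) {q : ℝ → ℝ}
    (hq : MonotoneOn q (Ioo 0 1)) (hq2 : MemLp q 2 unif) : 0 ≤ cov[quantile F, q; unif] := by
  have h := integral_mul_le_of_primitive_le hq (φ₁ := fun _ => ∫ t, quantile F t ∂unif)
    (Φ₁ := fun u => u * ∫ t, quantile F t ∂unif) (φ₂ := fun t => quantile F (1 - t))
    (Φ₂ := tailIntegral F) (integrable_const _)
    ((hq2.integrable (by norm_num)).const_mul _) (fun u _ => by simp)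
    (integrable_quantile_one_sub hF) (by simpa using integrable_mul_of_memLp hF hq2)
    (fun u _ => tailIntegral_eq F u) (fun u hu => tailIntegral_chord_le hF hu)
    (by simp [tailIntegral_one])
  simp only [sub_sub_cancel, integral_const_mul] at h
  rw [covariance_unif_eq hF hq2]
  linarith

/-! ### The supremum for `g` equals the supremum for its upper semicontinuous version -/

theorem exists_seq_of_forall_pos {α : Type*} {P : ℝ → α → Prop} (h : ∀ δ : ℝ, 0 < δ → ∃ a, P δ a) :
    ∃ a : ℕ → α, ∀ n : ℕ, P (1 / ((n : ℝ) + 1)) (a n) :=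
  Classical.axiomOfChoice fun _ : ℕ => h _ Nat.one_div_pos_of_nat

theorem isDistortion_zero : IsDistortion fun _ => 0 where
  boundedVariation := by
    rw [BoundedVariationOn, eVariationOn.constant_on]
    · exact ENNReal.zero_ne_top
    · rintro _ ⟨x, -, rfl⟩ _ ⟨y, -, rfl⟩; rfl
  zero := rfl
  right_zero := tendsto_const_nhds
  left_one := tendsto_const_nhds

/-- A step quantile function almost perfectly correlated with the one of `F`. -/
theorem exists_step_covariance_gt (g : ℝ → ℝ) {F : Measure ℝ} [IsProbabilityMeasure F]
    (hF : MemLp (fun x : ℝ => x) 2 F) {κ : ℝ} (hκ : κ < stdDev F) (hσ : 0 < stdDev F) :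
    ∃ T J, IsStepWith g T J ∧ κ * √(Var[T; unif]) < cov[quantile F, T; unif] := by
  have hF' := memLp_quantile hF
  -- Only the `L²` approximation of `F⁻¹` is wanted, so the zero distortion function, for which
  -- integrability is trivial, is used.
  have h0 : rhoIntegrand (uscVersion fun _ => 0) F = 0 := by
    ext x
    have : ∀ u, uscVersion (fun _ => 0) u = 0 := fun u => by
      by_cases hu : u ∈ Ioo (0 : ℝ) 1
      · rw [uscVersion_of_mem hu, leftLim_eq_of_tendsto tendsto_const_nhds,
          rightLim_eq_of_tendsto tendsto_const_nhds]; simp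
      · rw [uscVersion_of_notMem hu]
    simp [rhoIntegrand, this]
  have hr : Integrable (rhoIntegrand (uscVersion fun _ => 0) F) := h0 ▸ integrable_zero _ _ _
  obtain ⟨T, hT⟩ := exists_seq_of_forall_pos fun δ hδ =>
    isDistortion_zero.exists_step_approximation hF' hr hδ
  choose J hT hT2 _ using hT
  have hTm : ∀ n, MemLp (T n) 2 unif := fun n => (hT n).memLp
  have hlim : Tendsto (fun n => ∫ t, (T n t - quantile F t) ^ 2 ∂unif) atTop (𝓝 0) :=
    squeeze_zero (fun n => integral_nonneg fun t => sq_nonneg _) hT2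
      tendsto_one_div_add_atTop_nhds_zero_nat
  have h1 := (tendsto_variance_of_tendsto hTm hF' hlim).sqrt.const_mul κ
  have h2 := tendsto_covariance_of_tendsto hTm hF' hlim hF'
  have hlt : κ * √(Var[quantile F; unif]) < cov[quantile F, quantile F; unif] := by
    have hv : Var[quantile F; unif] = stdDev F * stdDev F := by
      rw [stdDev_eq_sqrt_variance_quantile hF, Real.mul_self_sqrt (variance_nonneg _ _)]
    rw [covariance_self hF'.1.aemeasurable, ← stdDev_eq_sqrt_variance_quantile hF, hv]
    exact mul_lt_mul_of_pos_right hκ hσ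
  obtain ⟨n, hn⟩ := (h1.eventually_lt h2 hlt).exists
  obtain ⟨J', hJ'⟩ := (hT n).exists_change g
  exact ⟨T n, J', hJ', hn⟩

theorem le_covariance_of_mem_uncertaintySet {F G : Measure ℝ} [IsProbabilityMeasure F]
    (hF : MemLp (fun x : ℝ => x) 2 F) {m s ε : ℝ} (hε : 0 ≤ ε) (hG : G ∈ uncertaintySet F m s ε) :
    (mean F - m) ^ 2 + (stdDev F - s) ^ 2 + 2 * stdDev F * s - ε ≤
      2 * cov[quantile F, quantile G; unif] := by
  obtain ⟨q1, q2, q3, q4⟩ := quantile_of_mem_uncertaintySet hε hG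
  have hF' := memLp_quantile hF
  rw [integral_sub_sq q1 hF', q3, integral_quantile_sq hF] at q4
  rw [covariance_unif_eq hF' q1, q2, ← mean_eq_integral_quantile]
  simp_rw [mul_comm (quantile F _)]
  linarith

theorem tendsto_integral_add_mul_sub_sq {X : ℕ → ℝ → ℝ} {Z T : ℝ → ℝ} {η : ℕ → ℝ}
    (hX : ∀ n, MemLp (X n) 2 unif) (hZ : MemLp Z 2 unif) (hT : MemLp T 2 unif)
    (h : Tendsto (fun n => ∫ t, (X n t - Z t) ^ 2 ∂unif) atTop (𝓝 0))
    (hη : Tendsto η atTop (𝓝 0)) :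
    Tendsto (fun n => ∫ t, (X n t + (0 + η n * T t) - Z t) ^ 2 ∂unif) atTop (𝓝 0) := by
  have hlim := (h.const_mul 2).add (((hη.pow 2).const_mul 2).mul_const (∫ t, T t ^ 2 ∂unif))
  simp only [mul_zero, ne_eq, OfNat.ofNat_ne_zero, not_false_eq_true, zero_pow, zero_mul,
    add_zero] at hlim
  refine squeeze_zero (fun n => integral_nonneg fun t => sq_nonneg _) (fun n => ?_) hlim
  have i1 := ((hX n).sub hZ).integrable_sq.const_mul 2
  have i2 := hT.integrable_sq.const_mul (2 * η n ^ 2)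
  have hle : ∫ t, (X n t + (0 + η n * T t) - Z t) ^ 2 ∂unif ≤
      ∫ t, (2 * (X n t - Z t) ^ 2 + 2 * η n ^ 2 * T t ^ 2) ∂unif := by
    refine integral_mono_of_nonneg (ae_of_all _ fun t => sq_nonneg _) (i1.add i2)
      (ae_of_all _ fun t => ?_)
    beta_reduce
    nlinarith [sq_nonneg (X n t - Z t - η n * T t)]
  refine hle.trans_eq ?_
  have := integral_add i1 i2
  simp only [Pi.sub_apply, integral_const_mul] at this
  exact this

/-- If `A` is approached from below by the values of `g` on step quantile functions tending to the
quantile function of a member of the uncertainty set, then `A` is at most the worst case. -/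
theorem le_worstCase_of_step_approximation {g : ℝ → ℝ} (hg0 : g 0 = 0) {F G : Measure ℝ}
    [IsProbabilityMeasure F] (hF : MemLp (fun x : ℝ => x) 2 F) (hσ : 0 < stdDev F)
    {m s ε : ℝ} (hs : 0 < s) (hε : (mean F - m) ^ 2 + (stdDev F - s) ^ 2 < ε)
    (hG : G ∈ uncertaintySet F m s ε) {A : ℝ} (hA : ∀ δ : ℝ, 0 < δ → ∃ q J, IsStepWith g q J ∧
      ∫ t, (q t - quantile G t) ^ 2 ∂unif ≤ δ ∧ A - δ ≤ J) :
    (A : EReal) ≤ worstCase g F m s ε := by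
  have hε0 : 0 ≤ ε := le_trans (by positivity) hε.le
  have hF' := memLp_quantile hF
  obtain ⟨hQ, hQ1, hQ2, -⟩ := quantile_of_mem_uncertaintySet hε0 hG
  have hQv : Var[quantile G; unif] = s ^ 2 := by
    rw [variance_eq_integral_sq_sub hQ, hQ2, hQ1]; ring
  have hQc := le_covariance_of_mem_uncertaintySet hF hε0 hG
  have : IsProbabilityMeasure G := hG.1
  have hQc0 := covariance_quantile_nonneg hF' (quantile_monotoneOn G) hQ
  -- the correlation constraint
  obtain ⟨κ, hκ0, hκσ, hκ1, hκ2⟩ : ∃ κ : ℝ, 0 ≤ κ ∧ κ < stdDev F ∧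
      (mean F - m) ^ 2 + (stdDev F - s) ^ 2 + 2 * stdDev F * s - ε ≤ 2 * (s * κ) ∧
      κ * s ≤ cov[quantile F, quantile G; unif] := by
    set D := (mean F - m) ^ 2 + (stdDev F - s) ^ 2 + 2 * stdDev F * s - ε with hD
    have e : D / (2 * s) * (2 * s) = D := div_mul_cancel₀ _ (by positivity)
    -- A law with mean `m` and deviation `s` lies in the ball as soon as its covariance with `F⁻¹`
    -- is at least `κ s`. The maximum with `0` keeps `κ` nonnegative for the triangle inequality
    -- below, and `κ < σ_F` is where `ε > ε_min` enters.
    refine ⟨max 0 (D / (2 * s)), le_max_left _ _, max_lt hσ ?_, ?_, ?_⟩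
    · rw [div_lt_iff₀ (by positivity)]; linarith
    · have := mul_le_mul_of_nonneg_right (le_max_right 0 (D / (2 * s)))
        (by positivity : 0 ≤ 2 * s)
      linarith
    · rcases max_cases 0 (D / (2 * s)) with h | h <;> rw [h.1]
      · simpa using hQc0
      · linarith
  obtain ⟨T, JT, hT, hgap⟩ := exists_step_covariance_gt g hF hκσ hσ
  obtain ⟨q, hq⟩ := exists_seq_of_forall_pos hA
  choose J hq hq2 hJ using hq
  have hqm : ∀ n, MemLp (q n) 2 unif := fun n => (hq n).memLp
  have hlim : Tendsto (fun n => ∫ t, (q n t - quantile G t) ^ 2 ∂unif) atTop (𝓝 0) :=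
    squeeze_zero (fun n => integral_nonneg fun t => sq_nonneg _) hq2
      tendsto_one_div_add_atTop_nhds_zero_nat
  set γ := cov[quantile F, T; unif] - κ * √(Var[T; unif]) with hγ
  have hγ0 : 0 < γ := sub_pos.2 hgap
  -- `γ` is the surplus in the covariance constraint per unit of `T`, so `η n` is the amount of `T`
  -- that repairs the deficit of `q n`. The deficit has a nonpositive limit, hence `η n → 0`.
  set η : ℕ → ℝ := fun n =>
    max 0 ((κ * √(Var[q n; unif]) - cov[quantile F, q n; unif]) / γ) with hη
  have hη0 : ∀ n, 0 ≤ η n := fun n => le_max_left _ _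
  have hηlim : Tendsto η atTop (𝓝 0) := by
    have h := ((((tendsto_variance_of_tendsto hqm hQ hlim).sqrt.const_mul κ).sub
      (tendsto_covariance_of_tendsto hqm hQ hlim hF')).div_const γ)
    have h' := (tendsto_const_nhds (x := (0 : ℝ))).max h
    rw [hQv, Real.sqrt_sq hs.le, max_eq_left (div_nonpos_of_nonpos_of_nonneg (by linarith) hγ0.le)]
      at h'
    exact h'
  set X : ℕ → ℝ → ℝ := fun n t => q n t + (0 + η n * T t) with hX
  have hXs : ∀ n, IsStepWith g (X n) (J n + (0 * g 1 + η n * JT)) := fun n =>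
    (hq n).add (hT.affine 0 (hη0 n))
  have hXm : ∀ n, MemLp (X n) 2 unif := fun n => (hXs n).memLp
  have hXlim : Tendsto (fun n => ∫ t, (X n t - quantile G t) ^ 2 ∂unif) atTop (𝓝 0) :=
    tendsto_integral_add_mul_sub_sq hqm hQ hT.memLp hlim hηlim
  have hXv := tendsto_variance_of_tendsto hXm hQ hXlim
  have hX1 := tendsto_integral_of_tendsto hXm hQ hXlim
  rw [hQv] at hXv
  rw [hQ1] at hX1
  -- Covariance is additive and standard deviation subadditive, so the surplus from `η n T` covers
  -- the deficit.
  have hXc : ∀ n, κ * √(Var[X n; unif]) ≤ cov[quantile F, X n; unif] := fun n => by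
    have hTm := hT.memLp
    have hηT : MemLp (fun t => 0 + η n * T t) 2 unif := (hT.affine 0 (hη0 n)).memLp
    have h1 := sqrt_variance_add_le (hqm n) hηT
    have h2 : √(Var[fun t => 0 + η n * T t; unif]) = η n * √(Var[T; unif]) := by
      simp_rw [zero_add]
      rw [variance_const_mul, Real.sqrt_mul (sq_nonneg _), Real.sqrt_sq (hη0 n)]
    have h3 : cov[quantile F, X n; unif] =
        cov[quantile F, q n; unif] + η n * cov[quantile F, T; unif] := by
      have e1 : X n = q n + fun t => η n * T t := by ext t; simp [hX]
      rw [e1, covariance_add_right hF' (hqm n) (hTm.const_mul _), covariance_const_mul_right]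
    have h4 : κ * √(Var[q n; unif]) - cov[quantile F, q n; unif] ≤ η n * γ :=
      (div_le_iff₀ hγ0).1 (le_max_right _ _)
    rw [h3]
    have h5 := mul_le_mul_of_nonneg_left h1 hκ0
    rw [h2] at h5
    rw [hγ] at h4
    have h6 : κ * √(Var[X n; unif]) ≤ κ * (√(Var[q n; unif]) + η n * √(Var[T; unif])) := h5
    linarith
  set k : ℕ → ℝ := fun n => s / √(Var[X n; unif]) with hk
  have hklim : Tendsto k atTop (𝓝 1) := by
    have h := hXv.sqrt
    rw [Real.sqrt_sq hs.le] at h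
    have h' := (tendsto_const_nhds (x := s)).div h hs.ne'
    rwa [div_self hs.ne'] at h'
  have hbound : ∀ᶠ n in atTop, (((m - k n * ∫ v, X n v ∂unif) * g 1 +
      k n * (A - 1 / ((n : ℝ) + 1) + η n * JT) : ℝ) : EReal) ≤ worstCase g F m s ε := by
    filter_upwards [hXv.eventually (lt_mem_nhds (by positivity : 0 < s ^ 2))] with n hn
    have hb : 0 < √(Var[X n; unif]) := Real.sqrt_pos.2 hn
    have hk0 : 0 ≤ k n := by positivity
    have hkb : k n * √(Var[X n; unif]) = s := div_mul_cancel₀ _ hb.ne'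
    have hmem := normalized_map_mem_uncertaintySet (m := m) hF ((hXs n).monotone.monotoneOn _)
      (hXm n) hn hs.le hε0 (rfl : k n = _) (hκ1.trans (by
        have := mul_le_mul_of_nonneg_left (hXc n) hk0
        have e : k n * (κ * √(Var[X n; unif])) = s * κ := by rw [← hkb]; ring
        linarith))
    refine le_iSup₂_of_le _ hmem ?_
    rw [((hXs n).affine _ hk0).rho_eq hg0, EReal.coe_le_coe_iff]
    have := mul_le_mul_of_nonneg_left (hJ n) hk0
    linarith
  have hfin : Tendsto (fun n : ℕ => (m - k n * ∫ v, X n v ∂unif) * g 1 +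
      k n * (A - 1 / ((n : ℝ) + 1) + η n * JT)) atTop (𝓝 A) := by
    have h := (((hklim.mul hX1).const_sub m).mul_const (g 1)).add (hklim.mul
      ((tendsto_one_div_add_atTop_nhds_zero_nat.const_sub A).add (hηlim.mul_const JT)))
    have e : (m - 1 * m) * g 1 + 1 * (A - 0 + 0 * JT) = A := by ring
    rwa [e] at h
  exact le_of_tendsto (continuous_coe_real_ereal.continuousAt.tendsto.comp hfin) hbound

theorem worstCase_le_worstCase_uscVersion (g : ℝ → ℝ) (F : Measure ℝ) (m s ε : ℝ) :
    worstCase g F m s ε ≤ worstCase (uscVersion g) F m s ε :=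
  iSup₂_mono fun G _ => rho_mono (fun u _ => le_uscVersion g u) (uscVersion_one g).symm G

/-- A `G` with `ρ_ĝ(G) = ⊥` is harmless. Otherwise the integrand is integrable, with majorant coming
from `g^*`, and the step approximation applies. -/
theorem IsDistortion.worstCase_eq_worstCase_uscVersion {g : ℝ → ℝ} (hg : IsDistortion g)
    (hA : MemLp (envDeriv g) 2 unif) {F : Measure ℝ} [IsProbabilityMeasure F]
    (hF : MemLp (fun x : ℝ => x) 2 F) (hσ : 0 < stdDev F) {m s ε : ℝ} (hs : 0 < s)
    (hε : (mean F - m) ^ 2 + (stdDev F - s) ^ 2 < ε) :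
    worstCase g F m s ε = worstCase (uscVersion g) F m s ε := by
  refine (worstCase_le_worstCase_uscVersion g F m s ε).antisymm (iSup₂_le fun G hG => ?_)
  have hε0 : 0 ≤ ε := le_trans (by positivity) hε.le
  have : IsProbabilityMeasure G := hG.1
  have hQ := (quantile_of_mem_uncertaintySet hε0 hG).1
  have hb := (integrable_rhoIntegrand_and_integral_eq (quantile_monotoneOn G)
    hg.integrable_envDeriv (integrable_mul_of_memLp (memLp_one_sub hA) hQ)
    (fun u hu => hg.concaveEnvelope_eq_integral hu)).1
  rw [map_quantile] at hb
  rcases rho_eq_bot_or_integrable (hg.aestronglyMeasurable_rhoIntegrand_uscVersion G) hb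
    (fun x => by
      unfold rhoIntegrand
      beta_reduce
      rw [uscVersion_one, hg.concaveEnvelope_one]
      exact sub_le_sub_right (hg.uscVersion_le_of_continuousOn hg.concaveEnvelope_continuousOn
        (fun t => hg.le_concaveEnvelope) (one_sub_cdf_mem G x)) _) with h | h
  · rw [h]; exact bot_le
  · rw [rho_eq_integral h]
    exact le_worstCase_of_step_approximation hg.zero hF hσ hs hε hG
      fun δ hδ => hg.exists_step_approximation hQ h hδ

/-! ### Constant envelope derivative -/

theorem tilt_zero (g : ℝ → ℝ) (F : Measure ℝ) : tilt g F 0 = g := by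
  ext t; simp [tilt]

theorem IsDistortion.envDeriv_eq_of_envDerivConst {g : ℝ → ℝ} (hg : IsDistortion g)
    (hc : EnvDerivConst g) : ∀ t ∈ Ioo (0 : ℝ) 1, envDeriv g t = g 1 := by
  obtain ⟨c, hc⟩ := hc
  have h := hg.integral_envDeriv
  rw [integral_congr_ae (ae_unif_of_forall hc)] at h
  have h1 : c = g 1 := by simpa using h
  exact h1 ▸ hc

/-- Were `f` nowhere above its chord on `(0,1)`, the chord would be its envelope and the derivative
constant. -/
theorem IsDistortion.exists_chord_lt {f : ℝ → ℝ} (hf : IsDistortion f)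
    (hnc : ¬ EnvDerivConst f) : ∃ u ∈ Ioo (0 : ℝ) 1, u * f 1 < f u := by
  by_contra! h
  refine hnc ⟨f 1, fun t ht => ?_⟩
  have hlin : ConcaveOn ℝ (Icc (0 : ℝ) 1) fun u => f 1 * u :=
    ⟨convex_Icc _ _, fun x _ y _ a b _ _ _ => by simp only [smul_eq_mul]; linarith⟩
  have hle : ∀ u ∈ Icc (0 : ℝ) 1, f u ≤ f 1 * u := fun u hu => by
    rcases hu.1.eq_or_lt with h0 | h0
    · simp [← h0, hf.zero]
    rcases hu.2.eq_or_lt with h1 | h1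
    · simp [h1]
    · linarith [h u ⟨h0, h1⟩]
  refine envDeriv_eq_of_eventuallyEq (φ := fun u => f 1 * u) ?_
    (by simpa using (hasDerivAt_id t).const_mul (f 1))
  filter_upwards [Icc_mem_nhds ht.1 ht.2] with u hu
  refine le_antisymm (hf.concaveEnvelope_le hlin hle hu) ?_
  have := hf.concaveEnvelope_concaveOn.2 (x := 0) (y := 1) (by simp) (by simp)
    (sub_nonneg.2 hu.2) hu.1 (by ring : 1 - u + u = 1)
  simp only [smul_eq_mul, mul_zero, mul_one, zero_add, hf.concaveEnvelope_zero,
    hf.concaveEnvelope_one] at this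
  linarith

theorem IsDistortion.rho_le_of_envDerivConst {g : ℝ → ℝ} (hg : IsDistortion g)
    (hA : MemLp (envDeriv g) 2 unif) (hc : EnvDerivConst g) {F G : Measure ℝ}
    (hF : MemLp (quantile F) 2 unif) {m s ε : ℝ} (hε : 0 ≤ ε) (hG : G ∈ uncertaintySet F m s ε) :
    rho g G ≤ ((g 1 * m : ℝ) : EReal) := by
  have : IsProbabilityMeasure G := hG.1
  obtain ⟨q1, q2, -, -⟩ := quantile_of_mem_uncertaintySet hε hG
  have h := hg.rho_uscVersion_map_le hF hA le_rfl (quantile_monotoneOn G) q1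
  rw [map_quantile, tilt_zero, zero_mul, sub_zero] at h
  have e : ∫ t, envDeriv g (1 - t) * quantile G t ∂unif = g 1 * m := by
    rw [← q2, ← integral_const_mul]
    refine integral_congr_ae (ae_unif_of_forall fun t ht => ?_)
    beta_reduce
    rw [hg.envDeriv_eq_of_envDerivConst hc (1 - t) ⟨by linarith [ht.2], by linarith [ht.1]⟩]
  rw [e] at h
  exact (rho_mono (fun u _ => le_uscVersion g u) (uscVersion_one g).symm G).trans h

/-- A level `u` where `g_l` exceeds its chord satisfies `u g(1) - g(u) < l Cov(F⁻¹, 1_{t > 1-u})`.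
The normalized two-point law jumping there therefore loses at most `l s σ_F` against `g(1) m`,
whatever `u` is; then `l → 0`. -/
theorem IsDistortion.worstCase_of_envDerivConst {g : ℝ → ℝ} (hg : IsDistortion g)
    (hA : MemLp (envDeriv g) 2 unif) (hc : EnvDerivConst g) {F : Measure ℝ}
    [IsProbabilityMeasure F] (hF : MemLp (fun x : ℝ => x) 2 F) {m s ε : ℝ} (hs : 0 < s)
    (hε : (mean F - m) ^ 2 + (stdDev F - s) ^ 2 + 2 * stdDev F * s ≤ ε)
    (hnc : ∀ l : ℝ, 0 < l → ¬ EnvDerivConst (DistortionRisk.tilt g F l)) :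
    worstCase g F m s ε = ((g 1 * m : ℝ) : EReal) := by
  have hσ : 0 ≤ stdDev F := Real.sqrt_nonneg _
  have hε0 : 0 ≤ ε := le_trans (by positivity) hε
  have hF' := memLp_quantile hF
  refine le_antisymm (iSup₂_le fun G hG => hg.rho_le_of_envDerivConst hA hc hF' hε0 hG) ?_
  have hbound : ∀ᶠ l : ℝ in 𝓝[>] 0,
      ((g 1 * m - l * (s * stdDev F) : ℝ) : EReal) ≤ worstCase g F m s ε := by
    filter_upwards [self_mem_nhdsWithin] with l hl
    obtain ⟨u, hu, hlt⟩ := (hg.tilt hF' l).exists_chord_lt (hnc l hl)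
    have huI : u ∈ Icc (0 : ℝ) 1 := ⟨hu.1.le, hu.2.le⟩
    have hX := isStepWith_two_point g huI
    obtain ⟨hcov, hvar⟩ := covariance_quantile_indicator hF' huI
    have hXm := hX.memLp
    set X : ℝ → ℝ := (Ioi (1 - u)).indicator 1 with hXdef
    have hv : 0 < Var[X; unif] := by rw [hvar]; exact mul_pos hu.1 (sub_pos.2 hu.2)
    have hb : 0 < √(Var[X; unif]) := Real.sqrt_pos.2 hv
    obtain ⟨k, hk⟩ : ∃ k, k = s / √(Var[X; unif]) := ⟨_, rfl⟩
    have hk0 : 0 ≤ k := hk ▸ div_nonneg hs.le hb.le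
    have hkb : k * √(Var[X; unif]) = s := by rw [hk, div_mul_cancel₀ _ hb.ne']
    have hc0 : 0 ≤ cov[quantile F, X; unif] :=
      covariance_quantile_nonneg hF' (hX.monotone.monotoneOn _) hXm
    -- For a radius this large, nonnegative covariance alone puts a law with the right moments in
    -- the ball.
    have hmem := normalized_map_mem_uncertaintySet (m := m) (ε := ε) hF
      (hX.monotone.monotoneOn _) hXm hv hs.le hε0 hk
      ((by linarith : _ ≤ (0 : ℝ)).trans (by positivity))
    refine le_iSup₂_of_le _ hmem ?_
    rw [(hX.affine _ hk0).rho_eq hg.zero, EReal.coe_le_coe_iff]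
    have hXu : ∫ v, X v ∂unif = u := by
      have := integral_indicator_Ioi_one_sub (φ := fun _ => 1) (c := 1 - u)
        ⟨by linarith [hu.2], by linarith [hu.1]⟩
      simpa [hXdef] using this
    rw [hXu]
    have h1 : cov[quantile F, X; unif] ≤ stdDev F * √(Var[X; unif]) := by
      rw [stdDev_eq_sqrt_variance_quantile hF, ← Real.sqrt_mul (variance_nonneg _ _)]
      exact Real.le_sqrt_of_sq_le (covariance_sq_le hF' hXm)
    have h2 : u * g 1 - g u ≤ l * cov[quantile F, X; unif] := by
      rw [hcov]
      have e : ∀ x, DistortionRisk.tilt g F l x = g x + l * tailIntegral F x := fun _ => rfl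
      rw [e, e, tailIntegral_one] at hlt
      linarith
    have h3 : u * g 1 - g u ≤ l * (stdDev F * √(Var[X; unif])) :=
      h2.trans (mul_le_mul_of_nonneg_left h1 (le_of_lt hl))
    have h4 := mul_le_mul_of_nonneg_left h3 hk0
    have h5 : k * (l * (stdDev F * √(Var[X; unif]))) = l * (s * stdDev F) := by
      rw [← hkb]; ring
    linarith
  have hlim : Tendsto (fun l : ℝ => g 1 * m - l * (s * stdDev F)) (𝓝[>] 0) (𝓝 (g 1 * m)) := by
    have : Tendsto (fun l : ℝ => g 1 * m - l * (s * stdDev F)) (𝓝 0)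
        (𝓝 (g 1 * m - 0 * (s * stdDev F))) := Continuous.tendsto (by fun_prop) 0
    rw [zero_mul, sub_zero] at this
    exact this.mono_left nhdsWithin_le_nhds
  exact le_of_tendsto (continuous_coe_real_ereal.continuousAt.tendsto.comp hlim) hbound

/-! ### Correlation at multiplier zero and the final assembly -/

theorem IsDistortion.corrZero_eq_zero {g : ℝ → ℝ} (hg : IsDistortion g) (hc : EnvDerivConst g)
    (F : Measure ℝ) :
    corrZero g F = 0 := by
  have h : Var[fun v => envDeriv g (1 - v); unif] = 0 := by
    have hae : (fun v => envDeriv g (1 - v)) =ᵐ[unif] fun _ => g 1 :=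
      ae_unif_of_forall fun t ht =>
        hg.envDeriv_eq_of_envDerivConst hc (1 - t) ⟨by linarith [ht.2], by linarith [ht.1]⟩
    rw [variance_congr hae, variance_eq_integral aemeasurable_const]
    simp
  simp [corrZero, h]

theorem corrZero_mul_stdDev {g : ℝ → ℝ} {F : Measure ℝ} [IsProbabilityMeasure F]
    (hF : MemLp (fun x : ℝ => x) 2 F) (hσ : 0 < stdDev F) (hA : MemLp (envDeriv g) 2 unif) :
    stdDev F * corrZero g F = cov[quantile F, fun v => envDeriv g (1 - v); unif] /
      √(Var[envDeriv g; unif]) := by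
  rw [corrZero, variance_one_sub hA, ← stdDev_eq_sqrt_variance_quantile hF, ← mul_div_assoc,
    mul_div_mul_left _ _ hσ.ne']

theorem IsDistortion.wasserstein_hLaw_eq_sqrt_iff {g : ℝ → ℝ} {F : Measure ℝ}
    (hF : MemLp (quantile F) 2 unif) (hg : IsDistortion g) {m s l ε : ℝ} (hs : 0 ≤ s)
    (hε : 0 ≤ ε) : wasserstein F (hLaw g F m s l) = √ε ↔
      ∫ t, (hQuantile g F m s l t - quantile F t) ^ 2 ∂unif = ε :=
  wasserstein_map_eq_sqrt_iff (hQuantile_monotoneOn hs (hg.tilt hF l)) hε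

end DistortionRisk

theorem theorem2 (F : Measure ℝ) [IsProbabilityMeasure F]
    (hF : MemLp (fun x : ℝ => x) 2 F) (hσF : 0 < stdDev F)
    (m s ε : ℝ) (hs : 0 < s) (hε : 0 < ε)
    (g : ℝ → ℝ) (hg : IsDistortion g)
    (hA₁ : IntegrableOn (fun t => envDeriv g t ^ 2) (Ioo 0 1))
    (hA₂ : ∀ l : ℝ, 0 < l → ¬ EnvDerivConst (tilt g F l)) :
    -- small radius
    ((mean F - m) ^ 2 + (stdDev F - s) ^ 2 < ε →
      ε < (mean F - m) ^ 2 + (stdDev F - s) ^ 2 + 2 * stdDev F * s * (1 - corrZero g F) →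
      ContinuousOn (fun l => rho (uscVersion g) (hLaw g F m s l)) (Ioi 0) →
        worstCase g F m s ε = worstCase (uscVersion g) F m s ε ∧
        (∀ l : ℝ, 0 < l → wasserstein F (hLaw g F m s l) = √ε →
          worstCase (uscVersion g) F m s ε = rho (uscVersion g) (hLaw g F m s l)) ∧
        (¬ EnvDerivConst g → ∃ l : ℝ, 0 < l ∧ wasserstein F (hLaw g F m s l) = √ε)) ∧
    -- large radius
    ((mean F - m) ^ 2 + (stdDev F - s) ^ 2 + 2 * stdDev F * s * (1 - corrZero g F) ≤ ε →
      (¬ EnvDerivConst g →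
        worstCase (uscVersion g) F m s ε = rho (uscVersion g) (hLaw g F m s 0) ∧
        ((mean F - m) ^ 2 + (stdDev F - s) ^ 2 < ε →
          worstCase g F m s ε = worstCase (uscVersion g) F m s ε)) ∧
      (EnvDerivConst g → worstCase g F m s ε = ((g 1 * m : ℝ) : EReal))) := by
  have hF' := memLp_quantile hF
  have hA : MemLp (envDeriv g) 2 unif :=
    (memLp_two_iff_integrable_sq hg.integrable_envDeriv.aestronglyMeasurable).2 hA₁
  have hcorr := corrZero_mul_stdDev hF hσF hA
  refine ⟨fun h1 h2 _ => ⟨hg.worstCase_eq_worstCase_uscVersion hA hF hσF hs h1,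
    fun l hl hW => ?_, fun hnc => ?_⟩, fun h2 => ⟨fun hnc => ⟨?_, fun h1 =>
      hg.worstCase_eq_worstCase_uscVersion hA hF hσF hs h1⟩, fun hc => ?_⟩⟩
  · have hW' := (hg.wasserstein_hLaw_eq_sqrt_iff hF' hs.le hε.le).1 hW
    exact hg.worstCase_uscVersion_eq hF' hA hs hε.le hl.le (hA₂ l hl) hW'.le (Or.inr hW')
  -- `κ` is the normalized covariance at which the squared distance equals `ε`. The bound `ε >
  -- ε_min` says `κ < σ_F`, and `ε < ε₀` says `κ > σ_F c₀`.
  · obtain ⟨κ, hκ⟩ : ∃ κ : ℝ, 2 * s * κ =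
        (mean F - m) ^ 2 + (stdDev F - s) ^ 2 + 2 * stdDev F * s - ε :=
      ⟨_, mul_div_cancel₀ _ (by positivity)⟩
    obtain ⟨l, hl, hcov⟩ := hg.exists_covariance_eq (κ := κ) hF' hA hA₂ hnc
      (stdDev_eq_sqrt_variance_quantile hF ▸ hσF)
      (by rw [← hcorr]; exact lt_of_mul_lt_mul_left (by linarith) (by positivity : 0 ≤ 2 * s))
      (by
        rw [← stdDev_eq_sqrt_variance_quantile hF]
        exact lt_of_mul_lt_mul_left (by linarith) (by positivity : 0 ≤ 2 * s))
    refine ⟨l, hl, (hg.wasserstein_hLaw_eq_sqrt_iff hF' hs.le hε.le).2 ?_⟩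
    rw [integral_hQuantile_sub_sq hg hF hA hl.le (hA₂ l hl), hcov, hκ]
    ring
  · have hnc' : ¬ EnvDerivConst (tilt g F 0) := by rwa [tilt_zero]
    refine hg.worstCase_uscVersion_eq hF' hA hs hε.le le_rfl hnc' ?_ (Or.inl rfl)
    rw [integral_hQuantile_sub_sq hg hF hA le_rfl hnc', tilt_zero, ← hcorr]
    linarith
  -- Here `c₀ = 0`, so the radius hypothesis reads `ε_min + 2 σ_F s ≤ ε`.
  · rw [hg.corrZero_eq_zero hc F] at h2
    exact hg.worstCase_of_envDerivConst hA hc hF hs (by linarith) hA₂
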